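/- Let $k$ be a field. All algebras are associative $k$-algebras, possibly without unit, $A\neq 0$, with nondegenerate product ($ab=0$ for all $b$, or $ba=0$ for all $b$, implies $a=0$); $M(A)$ is the multiplier algebra and $\iota$ the identity map. Nondegenerate homomorphisms $f:A\to M(B)$ (those with $f(A)B=B=Bf(A)$) are extended to $M(A)$ in the unique way. Derivations $d$ with respect to a nondegenerate endomorphism $T$, i.e. linear maps with $d(st)=d(s)t+T(s)d(t)$, are extended to the multiplier algebra in the unique way that keeps this rule. A *regular multiplier Hopf coquasigroup* is such an algebra $A$ with algebra homomorphisms $\Delta:A\to M(A\otimes A)$ and $\varepsilon:A\to k$ and a bijective linear map $S:A\to A$, antimultiplicative and anticomultiplicative, such that $\Delta(a)(1\otimes b)$, $(a\otimes 1)\Delta(b)$, $\Delta(a)(b\otimes 1)$, $(1\otimes a)\Delta(b)$ lie in $A\otimes A$, $(\varepsilon\otimes\iota)(\Delta(a)(1\otimes b))=ab=(\iota\otimes\varepsilon)((a\otimes 1)\Delta(b))$, and, writing $\Delta(a)=a_{(1)}\otimes a_{(2)}$, $$S(a_{(1)})a_{(2)(1)}\otimes a_{(2)(2)}=1\otimes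 a=a_{(1)}S(a_{(2)(1)})\otimes a_{(2)(2)},\qquad a_{(1)(1)}\otimes a_{(1)(2)}S(a_{(2)})=a\otimes 1=a_{(1)(1)}\otimes S(a_{(1)(2)})a_{(2)}.$$ An element $r\in M(A)$ is *group-like* if $r\ne 0$ and $\Delta(r)=r\otimes r$; it is then invertible, and $Ad_r(a)=rar^{-1}$. A *character* of $A$ is a nonzero algebra homomorphism $A\to k$. Let $(A,\Delta,\varepsilon,S)$ be a regular multiplier Hopf coquasigroup, $\tau$ a surjective nondegenerate algebra endomorphism of $A$ and $\delta:A\to A$ a $\tau$-derivation, i.e. linear with $\delta(ab)=\delta(a)b+\tau(a)\delta(b)$. The Ore extension $A[y;\tau,\delta]$ is the algebra of finite sums $\sum_n a_ny^n$ with $a_n\in A$, whose product is determined by $ya=\tau(a)y+\delta(a)$; $y$ is a multiplier of it, and $M(A)\subseteq M(A[y;\tau,\delta])$. Call $A[y;\tau,\delta]$ an *MHC-Ore extension of $A$ with respect to* a group-like $r\in M(A)$ if the algebra $A[y;\tau,\delta]$ has a structure of regular multiplier Hopf coquasigroup whose comultiplication extends that of $A$ and satisfies $\Delta(y)=y\otimes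 1+r\otimes y$; call it an *MHC-Ore extension of $A$* if it is one with respect to some group-like $r\in M(A)$. **Theorem.** $A[y;\tau,\delta]$ is an MHC-Ore extension of $A$ if and only if there is a group-like element $r\in M(A)$ such that the following conditions hold. 1. There is a character $\chi:A\to k$ with $\tau(a)=\chi(a_{(1)})a_{(2)}=(\chi\otimes\iota)\Delta(a)$ for all $a\in A$. 2. For this $\chi$ and all $a\in A$, $$\chi(a_{(1)})a_{(2)(1)}\otimes a_{(2)(2)}=Ad_r(a_{(1)})\chi(a_{(2)(1)})\otimes a_{(2)(2)}=\chi(a_{(1)(1)})a_{(1)(2)}\otimes a_{(2)}.$$ 3. For all $a\in A$, $\Delta(\delta(a))=(\delta\otimes\iota)\Delta(a)+(r\otimes 1)\big((\iota\otimes\delta)\Delta(a)\big)$. More precisely, for every group-like $r\in M(A)$, $A[y;\tau,\delta]$ is an MHC-Ore extension of $A$ with respect to $r$ if and only if conditions 1–3 hold for this $r$. -/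

import Mathlib

open scoped TensorProduct

namespace MHC

noncomputable section

/-! ### Multipliers of a (possibly non-unital) algebra -/

section Multipliers

variable (k : Type*) [Field k]

/-- The product of `A` is nondegenerate. -/
def NondegenerateProduct (A : Type*) [NonUnitalRing A] : Prop :=
  (∀ a : A, (∀ b, a * b = 0) → a = 0) ∧ (∀ a : A, (∀ b, b * a = 0) → a = 0)

/-- The multiplier algebra `M(A)`: pairs `(ρ₁, ρ₂)` of a left multiplier `a ↦ x a` and a right
multiplier `a ↦ a x` with `ρ₂(a) b = a ρ₁(b)`. The product is composition (in the opposite order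
for the right multipliers). -/
def multiplierAlgebra (A : Type*) [NonUnitalRing A] [Module k A] [IsScalarTower k A A]
    [SMulCommClass k A A] : Subalgebra k (Module.End k A × (Module.End k A)ᵐᵒᵖ) where
  carrier := {x | (∀ a b, x.1 (a * b) = x.1 a * b) ∧
    (∀ a b, x.2.unop (a * b) = a * x.2.unop b) ∧ (∀ a b, x.2.unop a * b = a * x.1 b)}
  mul_mem' := by
    rintro x y ⟨hx1, hx2, hx3⟩ ⟨hy1, hy2, hy3⟩
    refine ⟨fun a b => ?_, fun a b => ?_, fun a b => ?_⟩
    · simp [hx1, hy1]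
    · simp [hx2, hy2]
    · simp [hx3, hy3]
  add_mem' := by
    rintro x y ⟨hx1, hx2, hx3⟩ ⟨hy1, hy2, hy3⟩
    refine ⟨fun a b => ?_, fun a b => ?_, fun a b => ?_⟩
    · simp [hx1, hy1, add_mul]
    · simp [hx2, hy2, mul_add]
    · simp [hx3, hy3, add_mul, mul_add]
  algebraMap_mem' := by
    intro c
    refine ⟨fun a b => ?_, fun a b => ?_, fun a b => ?_⟩ <;>
    simp [Prod.algebraMap_apply, MulOpposite.algebraMap_apply, Module.algebraMap_end_apply,
      smul_mul_assoc, mul_smul_comm]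

/-- `M(A)` as a type; it is a unital `k`-algebra. -/
abbrev Mult (A : Type*) [NonUnitalRing A] [Module k A] [IsScalarTower k A A]
    [SMulCommClass k A A] : Type _ := ↥(multiplierAlgebra k A)

variable {k}
variable {A : Type*} [NonUnitalRing A] [Module k A] [IsScalarTower k A A] [SMulCommClass k A A]
variable {B : Type*} [NonUnitalRing B] [Module k B] [IsScalarTower k B B] [SMulCommClass k B B]
variable {C : Type*} [NonUnitalRing C] [Module k C] [IsScalarTower k C C] [SMulCommClass k C C]
variable {D : Type*} [NonUnitalRing D] [Module k D] [IsScalarTower k D D] [SMulCommClass k D D]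

/-- `x.left a = x a`. -/
def Mult.left (x : Mult k A) : A →ₗ[k] A := x.1.1

/-- `x.right a = a x`. -/
def Mult.right (x : Mult k A) : A →ₗ[k] A := x.1.2.unop

/-- A multiplier from a left and a right multiplier. -/
def Mult.mk (l r : A →ₗ[k] A) (hl : ∀ a b, l (a * b) = l a * b) (hr : ∀ a b, r (a * b) = a * r b)
    (h : ∀ a b, r a * b = a * l b) : Mult k A :=
  ⟨(l, MulOpposite.op r), hl, hr, h⟩

theorem Mult.left_mul (x : Mult k A) (a b : A) : x.left (a * b) = x.left a * b := x.2.1 a b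

theorem Mult.right_mul (x : Mult k A) (a b : A) : x.right (a * b) = a * x.right b := x.2.2.1 a b

theorem Mult.right_mul_eq (x : Mult k A) (a b : A) : x.right a * b = a * x.left b := x.2.2.2 a b

/-- The canonical map `A → M(A)`, injective when the product of `A` is nondegenerate. -/
def toMult : A →ₗ[k] Mult k A where
  toFun a := Mult.mk (LinearMap.mulLeft k a) (LinearMap.mulRight k a)
    (fun b c => by simp [mul_assoc]) (fun b c => by simp [mul_assoc])
    (fun b c => by simp [mul_assoc])
  map_add' a b := by
    apply Subtype.ext
    refine Prod.ext ?_ (MulOpposite.unop_injective ?_) <;> ext c <;>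
    simp [Mult.mk, add_mul, mul_add]
  map_smul' r a := by
    apply Subtype.ext
    refine Prod.ext ?_ (MulOpposite.unop_injective ?_) <;> ext c <;>
    simp [Mult.mk, smul_mul_assoc, mul_smul_comm]

/-- The canonical map `M(A) × M(B) → M(A ⊗ B)`, `(x, y) ↦ x ⊗ y`. -/
def Mult.tmul : Mult k A →ₗ[k] Mult k B →ₗ[k] Mult k (A ⊗[k] B) :=
  LinearMap.mk₂ k
    (fun x y => Mult.mk (TensorProduct.map x.left y.left) (TensorProduct.map x.right y.right)
      (fun s t => by
        induction s using TensorProduct.induction_on with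
        | zero => simp
        | add s₁ s₂ h₁ h₂ => simp only [add_mul, map_add, h₁, h₂]
        | tmul a b =>
          induction t using TensorProduct.induction_on with
          | zero => simp
          | add t₁ t₂ h₁ h₂ => simp only [mul_add, map_add, h₁, h₂]
          | tmul c d => simp [Mult.left_mul])
      (fun s t => by
        induction s using TensorProduct.induction_on with
        | zero => simp
        | add s₁ s₂ h₁ h₂ => simp only [add_mul, map_add, h₁, h₂]
        | tmul a b =>
          induction t using TensorProduct.induction_on with
          | zero => simp
          | add t₁ t₂ h₁ h₂ => simp only [mul_add, map_add, h₁, h₂]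
          | tmul c d => simp [Mult.right_mul])
      (fun s t => by
        induction s using TensorProduct.induction_on with
        | zero => simp
        | add s₁ s₂ h₁ h₂ => simp only [add_mul, map_add, h₁, h₂]
        | tmul a b =>
          induction t using TensorProduct.induction_on with
          | zero => simp
          | add t₁ t₂ h₁ h₂ => simp only [mul_add, map_add, h₁, h₂]
          | tmul c d => simp [Mult.right_mul_eq]))
    (fun x₁ x₂ y => by
      apply Subtype.ext
      refine Prod.ext ?_ (MulOpposite.unop_injective ?_)
      · exact TensorProduct.map_add_left x₁.left x₂.left y.left
      · exact TensorProduct.map_add_left x₁.right x₂.right y.right)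
    (fun c x y => by
      apply Subtype.ext
      refine Prod.ext ?_ (MulOpposite.unop_injective ?_)
      · exact TensorProduct.map_smul_left c x.left y.left
      · exact TensorProduct.map_smul_left c x.right y.right)
    (fun x y₁ y₂ => by
      apply Subtype.ext
      refine Prod.ext ?_ (MulOpposite.unop_injective ?_)
      · exact TensorProduct.map_add_right x.left y₁.left y₂.left
      · exact TensorProduct.map_add_right x.right y₁.right y₂.right)
    (fun c x y => by
      apply Subtype.ext
      refine Prod.ext ?_ (MulOpposite.unop_injective ?_)
      · exact TensorProduct.map_smul_right c x.left y.left
      · exact TensorProduct.map_smul_right c x.right y.right)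

/-- `f ⊗ g : A ⊗ B → M(C ⊗ D)` for `f : A → M(C)` and `g : B → M(D)`. -/
def tensorMap (f : A →ₗ[k] Mult k C) (g : B →ₗ[k] Mult k D) :
    A ⊗[k] B →ₗ[k] Mult k (C ⊗[k] D) :=
  TensorProduct.lift (Mult.tmul.compl₁₂ f g)

/-- `χ ⊗ g : A ⊗ B → M(D)`, `a ⊗ b ↦ χ(a) g(b)`, for a functional `χ` on `A` and `g : B → M(D)`. -/
def functionalTensorMap (χ : A →ₗ[k] k) (g : B →ₗ[k] Mult k D) : A ⊗[k] B →ₗ[k] Mult k D :=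
  TensorProduct.lift ((LinearMap.lsmul k (Mult k D)).compl₁₂ χ g)

/-- `z` is the value at `x ∈ M(A)` of the extension to `M(A)` of the map `f : A → M(B)`.
A nondegenerate homomorphism `f` (all the maps below to which this is applied) has exactly one
extension to a homomorphism `M(A) → M(B)`, and its value at `x` is the unique `z` with
`f(xa) = z f(a)` and `f(ax) = f(a) z` for all `a ∈ A`. -/
def ExtendsTo (f : A →ₗ[k] Mult k B) (x : Mult k A) (z : Mult k B) : Prop :=
  ∀ a : A, f (x.left a) = z * f a ∧ f (x.right a) = f a * z

/-- `z` is the value at `x ∈ M(B)` of the extension to `M(B)` of the `T`-derivation `d` of `B`,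
where `T` is a nondegenerate endomorphism of `B`: with `w = T(x)`, for all `t ∈ B`
`d(xt) = z t + w d(t)` and `d(tx) = d(t) x + T(t) z`. -/
def DerivationExtendsTo (T d : B →ₗ[k] B) (x z : Mult k B) : Prop :=
  ∃ w : Mult k B, ExtendsTo (toMult ∘ₗ T) x w ∧
    ∀ t : B, d (x.left t) = z.left t + w.left (d t) ∧
      d (x.right t) = x.right (d t) + z.right (T t)

/-- An endomorphism of `A` is nondegenerate: `τ(A)A = A = Aτ(A)`. -/
def NondegenerateEnd (τ : A →ₙₐ[k] A) : Prop :=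
  Submodule.span k {c : A | ∃ a b, c = τ a * b} = ⊤ ∧
    Submodule.span k {c : A | ∃ a b, c = a * τ b} = ⊤

end Multipliers

/-! ### Regular multiplier Hopf coquasigroups -/

/-- A regular multiplier Hopf coquasigroup structure on the algebra `A`. The maps `T₁, …, T₄` are
determined by `Δ`: their presence says that the indicated multipliers lie in `A ⊗ A`
(`T₁`, `T₂` are the Galois maps; the elements given by `T₃`, `T₄` are those in which the antipode
identities are written, after covering). -/
structure RegularMHC (k A : Type*) [Field k] [NonUnitalRing A] [Module k A] [IsScalarTower k A A]
    [SMulCommClass k A A] where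
  nondegenerate : NondegenerateProduct A
  /-- comultiplication -/
  Δ : A →ₙₐ[k] Mult k (A ⊗[k] A)
  /-- counit -/
  ε : A →ₙₐ[k] k
  /-- antipode, bijective by regularity -/
  S : A ≃ₗ[k] A
  T₁ : A ⊗[k] A →ₗ[k] A ⊗[k] A
  T₂ : A ⊗[k] A →ₗ[k] A ⊗[k] A
  T₃ : A ⊗[k] A →ₗ[k] A ⊗[k] A
  T₄ : A ⊗[k] A →ₗ[k] A ⊗[k] A
  /-- `T₁(a ⊗ b) = Δ(a)(1 ⊗ b)` -/
  T₁_spec : ∀ a b : A, toMult (T₁ (a ⊗ₜ[k] b)) = Δ a * Mult.tmul (1 : Mult k A) (toMult b)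
  /-- `T₂(a ⊗ b) = (a ⊗ 1)Δ(b)` -/
  T₂_spec : ∀ a b : A, toMult (T₂ (a ⊗ₜ[k] b)) = Mult.tmul (toMult a) (1 : Mult k A) * Δ b
  /-- `T₃(a ⊗ b) = Δ(a)(b ⊗ 1)` -/
  T₃_spec : ∀ a b : A, toMult (T₃ (a ⊗ₜ[k] b)) = Δ a * Mult.tmul (toMult b) (1 : Mult k A)
  /-- `T₄(a ⊗ b) = (1 ⊗ a)Δ(b)` -/
  T₄_spec : ∀ a b : A, toMult (T₄ (a ⊗ₜ[k] b)) = Mult.tmul (1 : Mult k A) (toMult a) * Δ b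
  /-- `(ε ⊗ ι)T₁(a ⊗ b) = ab` -/
  counit_left : ∀ a b : A,
    TensorProduct.lid k A (TensorProduct.map (ε : A →ₗ[k] k) LinearMap.id (T₁ (a ⊗ₜ[k] b))) = a * b
  /-- `(ι ⊗ ε)T₂(a ⊗ b) = ab` -/
  counit_right : ∀ a b : A,
    TensorProduct.rid k A (TensorProduct.map LinearMap.id (ε : A →ₗ[k] k) (T₂ (a ⊗ₜ[k] b))) = a * b
  /-- `S` is antimultiplicative. -/
  S_mul : ∀ a b : A, S (a * b) = S b * S a
  /-- `S` is anticomultiplicative: `Δ(S(a)) = s(Δ(a))`, where the antiautomorphism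
  `s(a ⊗ b) = S(b) ⊗ S(a)` of `A ⊗ A` is extended to `M(A ⊗ A)` by `s(x)s(t) = s(tx)` and
  `s(t)s(x) = s(xt)`. -/
  S_comul : ∀ (a : A) (t : A ⊗[k] A),
    (Δ (S a)).left (TensorProduct.comm k A A (TensorProduct.congr S S t)) =
        TensorProduct.comm k A A (TensorProduct.congr S S ((Δ a).right t)) ∧
      (Δ (S a)).right (TensorProduct.comm k A A (TensorProduct.congr S S t)) =
        TensorProduct.comm k A A (TensorProduct.congr S S ((Δ a).left t))
  /-- `(m ⊗ ι)(S ⊗ Δ)Δ(a) = 1 ⊗ a`, i.e. `S(a₁)a₂₁ ⊗ a₂₂ = 1 ⊗ a`, multiplied by `S(b) ⊗ 1` on the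
  left: `(m ⊗ ι)(S ⊗ Δ)(Δ(a)(b ⊗ 1)) = S(b) ⊗ a`, and `(m ⊗ ι)(S ⊗ Δ)(c ⊗ d) = T₂(S(c) ⊗ d)`. -/
  antipode₁ : ∀ a b : A, T₂ (TensorProduct.map S.toLinearMap LinearMap.id (T₃ (a ⊗ₜ[k] b))) =
    S b ⊗ₜ[k] a
  /-- `(m ⊗ ι)(ι ⊗ S ⊗ ι)(ι ⊗ Δ)Δ(a) = 1 ⊗ a`, i.e. `a₁S(a₂₁) ⊗ a₂₂ = 1 ⊗ a`, multiplied by `b ⊗ 1`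
  on the left: the map `c ⊗ d ↦ cS(d₁) ⊗ d₂ = (S ⊗ ι)(Δ(d)(S⁻¹(c) ⊗ 1))` is applied to
  `(b ⊗ 1)Δ(a)`. -/
  antipode₂ : ∀ a b : A,
    TensorProduct.map S.toLinearMap LinearMap.id (T₃ (TensorProduct.comm k A A
      (TensorProduct.map S.symm.toLinearMap LinearMap.id (T₂ (b ⊗ₜ[k] a))))) = b ⊗ₜ[k] a
  /-- `(ι ⊗ m)(Δ ⊗ S)Δ(a) = a ⊗ 1`, i.e. `a₁₁ ⊗ a₁₂S(a₂) = a ⊗ 1`, multiplied by `1 ⊗ S(b)` on the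
  right: `(ι ⊗ m)(Δ ⊗ S)((1 ⊗ b)Δ(a)) = a ⊗ S(b)`, and `(ι ⊗ m)(Δ ⊗ S)(c ⊗ d) = T₁(c ⊗ S(d))`. -/
  antipode₃ : ∀ a b : A, T₁ (TensorProduct.map LinearMap.id S.toLinearMap (T₄ (b ⊗ₜ[k] a))) =
    a ⊗ₜ[k] S b
  /-- `(ι ⊗ m)(ι ⊗ S ⊗ ι)(Δ ⊗ ι)Δ(a) = a ⊗ 1`, i.e. `a₁₁ ⊗ S(a₁₂)a₂ = a ⊗ 1`, multiplied by `1 ⊗ b`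
  on the right: the map `c ⊗ d ↦ c₁ ⊗ S(c₂)d = (ι ⊗ S)((1 ⊗ S⁻¹(d))Δ(c))` is applied to
  `Δ(a)(1 ⊗ b)`. -/
  antipode₄ : ∀ a b : A,
    TensorProduct.map LinearMap.id S.toLinearMap (T₄ (TensorProduct.comm k A A
      (TensorProduct.map LinearMap.id S.symm.toLinearMap (T₁ (a ⊗ₜ[k] b))))) = a ⊗ₜ[k] b

/-! ### Ore extensions of algebras -/

section Ore

variable {k : Type*} [Field k]
variable {A : Type*} [NonUnitalRing A] [Module k A] [IsScalarTower k A A] [SMulCommClass k A A]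

set_option linter.unusedSectionVars false

/-- A `τ`-derivation of `A`. -/
structure TwistedDerivation (τ : A →ₙₐ[k] A) where
  toLinearMap : A →ₗ[k] A
  leibniz : ∀ a b : A, toLinearMap (a * b) = toLinearMap a * b + τ a * toLinearMap b

variable {τ : A →ₙₐ[k] A}

/-- The Ore extension `A[y; τ, δ]`: finite sums `∑ aₙ yⁿ` with coefficients `aₙ ∈ A` on the left.
The element `y` itself need not belong to it when `A` has no unit. -/
def OreExt (_δ : TwistedDerivation τ) : Type _ := ℕ →₀ A

namespace OreExt

variable (δ : TwistedDerivation τ)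

instance : AddCommGroup (OreExt δ) := inferInstanceAs (AddCommGroup (ℕ →₀ A))

instance : Module k (OreExt δ) := inferInstanceAs (Module k (ℕ →₀ A))

/-- The monomial `a yⁿ`. -/
def monomial (n : ℕ) : A →ₗ[k] OreExt δ := Finsupp.lsingle n

variable {δ} in
theorem hom_ext {M : Type*} [AddCommGroup M] [Module k M] {f g : OreExt δ →ₗ[k] M}
    (h : ∀ n a, f (monomial δ n a) = g (monomial δ n a)) : f = g :=
  Finsupp.lhom_ext h

/-- The linear map on `A[y; τ, δ]` with prescribed values on monomials. -/
def lift {M : Type*} [AddCommGroup M] [Module k M] (f : ℕ → A →ₗ[k] M) : OreExt δ →ₗ[k] M :=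
  Finsupp.lsum k f

theorem lift_monomial {M : Type*} [AddCommGroup M] [Module k M] (f : ℕ → A →ₗ[k] M) (n : ℕ)
    (a : A) : lift δ f (monomial δ n a) = f n a := by
  exact Finsupp.lsum_single k f n a

/-- Left multiplication by `y`: `y (a yⁿ) = τ(a) yⁿ⁺¹ + δ(a) yⁿ`. -/
def yLeft : OreExt δ →ₗ[k] OreExt δ :=
  lift δ fun n => monomial δ (n + 1) ∘ₗ (τ : A →ₗ[k] A) + monomial δ n ∘ₗ δ.toLinearMap

/-- Right multiplication by `y`: `(a yⁿ) y = a yⁿ⁺¹`. -/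
def yRight : OreExt δ →ₗ[k] OreExt δ := lift δ fun n => monomial δ (n + 1)

/-- Left multiplication by `a ∈ A`: `a (b yⁿ) = (ab) yⁿ`. -/
def coeffMul : A →ₗ[k] OreExt δ →ₗ[k] OreExt δ where
  toFun a := lift δ fun n => monomial δ n ∘ₗ LinearMap.mulLeft k a
  map_add' a b := hom_ext fun n c => by simp [lift_monomial, add_mul]
  map_smul' r a := hom_ext fun n c => by simp [lift_monomial, smul_mul_assoc]

/-- The product of `A[y; τ, δ]`: `(a yⁿ) g = a (y (⋯ (y g)))`. -/
def mulMap : OreExt δ →ₗ[k] OreExt δ →ₗ[k] OreExt δ :=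
  lift δ fun n => (LinearMap.lcomp k (OreExt δ) ((yLeft δ) ^ n)) ∘ₗ coeffMul δ

instance : Mul (OreExt δ) := ⟨fun f g => mulMap δ f g⟩

variable {δ}

theorem mul_def (f g : OreExt δ) : f * g = mulMap δ f g := rfl

theorem monomial_mul (n : ℕ) (a : A) (g : OreExt δ) :
    monomial δ n a * g = coeffMul δ a (((yLeft δ) ^ n) g) := by
  simp [mul_def, mulMap, lift_monomial]

theorem coeffMul_monomial (a : A) (n : ℕ) (b : A) :
    coeffMul δ a (monomial δ n b) = monomial δ n (a * b) := by
  simp [coeffMul, lift_monomial]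

theorem yLeft_monomial (n : ℕ) (b : A) :
    yLeft δ (monomial δ n b) = monomial δ (n + 1) (τ b) + monomial δ n (δ.toLinearMap b) := by
  simp [yLeft, lift_monomial]

theorem yRight_monomial (n : ℕ) (b : A) :
    yRight δ (monomial δ n b) = monomial δ (n + 1) b := by
  simp [yRight, lift_monomial]

theorem coeffMul_mul (a b : A) (g : OreExt δ) :
    coeffMul δ (a * b) g = coeffMul δ a (coeffMul δ b g) := by
  have : coeffMul δ (a * b) = coeffMul δ a ∘ₗ coeffMul δ b :=
    hom_ext fun n c => by simp [coeffMul_monomial, mul_assoc]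
  exact LinearMap.congr_fun this g

theorem yLeft_coeffMul (a : A) (g : OreExt δ) :
    yLeft δ (coeffMul δ a g) =
      coeffMul δ (τ a) (yLeft δ g) + coeffMul δ (δ.toLinearMap a) g := by
  have : yLeft δ ∘ₗ coeffMul δ a =
      coeffMul δ (τ a) ∘ₗ yLeft δ + coeffMul δ (δ.toLinearMap a) :=
    hom_ext fun n c => by
      simp only [LinearMap.comp_apply, LinearMap.add_apply, coeffMul_monomial, yLeft_monomial,
        map_add, map_mul, δ.leibniz]
      abel
  exact LinearMap.congr_fun this g

theorem yLeft_mul (f g : OreExt δ) : yLeft δ (f * g) = yLeft δ f * g := by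
  have : (mulMap δ).compr₂ (yLeft δ) = mulMap δ ∘ₗ yLeft δ :=
    hom_ext fun n a => by
      ext1 g
      simp only [LinearMap.compr₂_apply, LinearMap.comp_apply, yLeft_monomial, map_add,
        LinearMap.add_apply, ← mul_def, monomial_mul, yLeft_coeffMul, pow_succ', Module.End.mul_apply]
  exact LinearMap.congr_fun (LinearMap.congr_fun this f) g

theorem coeffMul_mul_assoc (a : A) (f g : OreExt δ) :
    coeffMul δ a (f * g) = coeffMul δ a f * g := by
  have : (mulMap δ).compr₂ (coeffMul δ a) = mulMap δ ∘ₗ coeffMul δ a :=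
    hom_ext fun n b => by
      ext1 g
      simp only [LinearMap.compr₂_apply, LinearMap.comp_apply, coeffMul_monomial,
        ← mul_def, monomial_mul, coeffMul_mul]
  exact LinearMap.congr_fun (LinearMap.congr_fun this f) g

theorem yLeft_pow_mul (n : ℕ) (f g : OreExt δ) :
    ((yLeft δ) ^ n) (f * g) = ((yLeft δ) ^ n) f * g := by
  induction n with
  | zero => simp
  | succ n ih => simp only [pow_succ', Module.End.mul_apply, ih, yLeft_mul]

theorem mul_assoc' (f g h : OreExt δ) : f * g * h = f * (g * h) := by
  have : (mulMap δ).compr₂ ((mulMap δ).flip h) = (mulMap δ).compl₂ ((mulMap δ).flip h) :=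
    hom_ext fun n a => by
      ext1 g
      simp only [LinearMap.compr₂_apply, LinearMap.compl₂_apply, LinearMap.flip_apply, ← mul_def,
        monomial_mul, yLeft_pow_mul, coeffMul_mul_assoc]
  exact LinearMap.congr_fun (LinearMap.congr_fun this f) g

instance : NonUnitalRing (OreExt δ) :=
  { (inferInstance : AddCommGroup (OreExt δ)), (inferInstance : Mul (OreExt δ)) with
    left_distrib := fun f g h => by simp [mul_def]
    right_distrib := fun f g h => by simp [mul_def]
    zero_mul := fun f => by simp [mul_def]
    mul_zero := fun f => by simp [mul_def]
    mul_assoc := mul_assoc' }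

instance : IsScalarTower k (OreExt δ) (OreExt δ) :=
  ⟨fun r f g => by simp [mul_def]⟩

instance : SMulCommClass k (OreExt δ) (OreExt δ) :=
  ⟨fun r f g => by simp [mul_def]⟩

theorem yRight_mul (f g : OreExt δ) : yRight δ (f * g) = f * yRight δ g := by
  have hc : ∀ a : A, yRight δ ∘ₗ coeffMul δ a = coeffMul δ a ∘ₗ yRight δ := fun a =>
    hom_ext fun n b => by simp [coeffMul_monomial, yRight_monomial]
  have hy : Commute (yRight δ) (yLeft δ) := by
    refine hom_ext fun n b => ?_
    simp [Module.End.mul_apply, yLeft_monomial, yRight_monomial]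
  have : (mulMap δ).compr₂ (yRight δ) = (mulMap δ).compl₂ (yRight δ) :=
    hom_ext fun n a => by
      ext1 g
      simp only [LinearMap.compr₂_apply, LinearMap.compl₂_apply, ← mul_def, monomial_mul]
      have h1 := LinearMap.congr_fun (hc a) (((yLeft δ) ^ n) g)
      have h2 := LinearMap.congr_fun (hy.pow_right n).eq g
      simp only [LinearMap.comp_apply, Module.End.mul_apply] at h1 h2
      rw [h1, h2]
  exact LinearMap.congr_fun (LinearMap.congr_fun this f) g

theorem yRight_mul_eq (f g : OreExt δ) : yRight δ f * g = f * yLeft δ g := by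
  have : mulMap δ ∘ₗ yRight δ = (mulMap δ).compl₂ (yLeft δ) :=
    hom_ext fun n a => by
      ext1 g
      simp only [LinearMap.compl₂_apply, LinearMap.comp_apply, yRight_monomial, ← mul_def,
        monomial_mul, pow_succ, Module.End.mul_apply]
  exact LinearMap.congr_fun (LinearMap.congr_fun this f) g

variable (δ)

/-- The variable `y` as a multiplier of `A[y; τ, δ]`. -/
def y : Mult k (OreExt δ) := Mult.mk (yLeft δ) (yRight δ) yLeft_mul yRight_mul yRight_mul_eq

/-- The inclusion `A → A[y; τ, δ]`, `a ↦ a y⁰`. -/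
def incl : A →ₗ[k] OreExt δ := monomial δ 0

end OreExt

end Ore

/-! ### The notions in the theorem -/

section Main

variable {k : Type*} [Field k]
variable {A : Type*} [NonUnitalRing A] [Module k A] [IsScalarTower k A A] [SMulCommClass k A A]

/-- The comultiplication as a linear map. -/
def RegularMHC.comul (H : RegularMHC k A) : A →ₗ[k] Mult k (A ⊗[k] A) := (H.Δ : A →ₗ[k] _)

/-- `r ∈ M(A)` is group-like: `r ≠ 0` and `Δ(r) = r ⊗ r`. Such an `r` is invertible, with
inverse `S(r)`. -/
def RegularMHC.IsGroupLike (H : RegularMHC k A) (r : Mult k A) : Prop :=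
  r ≠ 0 ∧ ExtendsTo H.comul r (Mult.tmul r r)

/-- `A[y; τ, δ]` is an Ore extension of the multiplier Hopf coquasigroup `(A, Δ)`, with respect to
`r`: the algebra `A[y; τ, δ]` has a structure of regular multiplier Hopf coquasigroup whose
comultiplication `Δ'` extends that of `A` and satisfies `Δ'(y) = y ⊗ 1 + r ⊗ y`. Here `r` is viewed
in `M(A[y; τ, δ])` via the extension to `M(A)` of the inclusion `A → A[y; τ, δ]`. -/
def RegularMHC.IsOreExtensionWith (H : RegularMHC k A) {τ : A →ₙₐ[k] A} (δ : TwistedDerivation τ)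
    (r : Mult k A) : Prop :=
  ∃ H' : RegularMHC k (OreExt δ),
    (∀ a : A, ExtendsTo (toMult ∘ₗ TensorProduct.map (OreExt.incl δ) (OreExt.incl δ)) (H.Δ a)
      (H'.Δ (OreExt.incl δ a))) ∧
    ∃ r' : Mult k (OreExt δ), ExtendsTo (toMult ∘ₗ OreExt.incl δ) r r' ∧
      ExtendsTo H'.comul (OreExt.y δ)
        (Mult.tmul (OreExt.y δ) 1 + Mult.tmul r' (OreExt.y δ))

/-- `A[y; τ, δ]` is an MHC-Ore extension of `A`. -/
def RegularMHC.IsOreExtension (H : RegularMHC k A) {τ : A →ₙₐ[k] A} (δ : TwistedDerivation τ) :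
    Prop :=
  ∃ r : Mult k A, H.IsGroupLike r ∧ H.IsOreExtensionWith δ r

/-- `Ad_r : A → M(A)`, `a ↦ r a r⁻¹`, for an invertible `r ∈ M(A)`. -/
def adMap (r : Mult k A) : A →ₗ[k] Mult k A :=
  LinearMap.mulRight k (Ring.inverse r) ∘ₗ LinearMap.mulLeft k r ∘ₗ toMult

/-- `τ(a) = (χ ⊗ ι)Δ(a)` for all `a`. -/
def RegularMHC.CharacterCondition (H : RegularMHC k A) (τ : A →ₙₐ[k] A) (χ : A →ₙₐ[k] k) : Prop :=
  ∀ a : A, ExtendsTo (functionalTensorMap (χ : A →ₗ[k] k) toMult) (H.Δ a) (toMult (τ a))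

/-- `χ(a₁)a₂₁ ⊗ a₂₂ = Ad_r(a₁)χ(a₂₁) ⊗ a₂₂ = χ(a₁₁)a₁₂ ⊗ a₂` for all `a`. Here
`u = (ι ⊗ Δ)Δ(a) ∈ M(A ⊗ (A ⊗ A))`, `v = (Δ ⊗ ι)Δ(a) ∈ M((A ⊗ A) ⊗ A)`, and `z` is the common
value of `(χ ⊗ ι ⊗ ι)(u)`, `(Ad_r ⊗ χ ⊗ ι)(u)` and `(χ ⊗ ι ⊗ ι)(v)`. -/
def RegularMHC.AdCondition (H : RegularMHC k A) (χ : A →ₙₐ[k] k) (r : Mult k A) : Prop :=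
  ∀ a : A, ∃ (u : Mult k (A ⊗[k] (A ⊗[k] A))) (v : Mult k ((A ⊗[k] A) ⊗[k] A))
      (z : Mult k (A ⊗[k] A)),
    ExtendsTo (tensorMap toMult H.comul) (H.Δ a) u ∧
    ExtendsTo (tensorMap H.comul toMult) (H.Δ a) v ∧
    ExtendsTo (functionalTensorMap (χ : A →ₗ[k] k) toMult) u z ∧
    ExtendsTo (tensorMap (adMap r) (functionalTensorMap (χ : A →ₗ[k] k) toMult)) u z ∧
    ExtendsTo (tensorMap (functionalTensorMap (χ : A →ₗ[k] k) toMult) toMult) v z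

/-- `Δ(δ(a)) = (δ ⊗ ι)Δ(a) + (r ⊗ 1)((ι ⊗ δ)Δ(a))` for all `a`, where the `(τ ⊗ ι)`-derivation
`δ ⊗ ι` and the `(ι ⊗ τ)`-derivation `ι ⊗ δ` of `A ⊗ A` are extended to `M(A ⊗ A)`. -/
def RegularMHC.DerivationCondition (H : RegularMHC k A) {τ : A →ₙₐ[k] A} (δ : TwistedDerivation τ)
    (r : Mult k A) : Prop :=
  ∀ a : A, ∃ u v : Mult k (A ⊗[k] A),
    DerivationExtendsTo (TensorProduct.map (τ : A →ₗ[k] A) LinearMap.id)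
      (TensorProduct.map δ.toLinearMap LinearMap.id) (H.Δ a) u ∧
    DerivationExtendsTo (TensorProduct.map LinearMap.id (τ : A →ₗ[k] A))
      (TensorProduct.map LinearMap.id δ.toLinearMap) (H.Δ a) v ∧
    H.Δ (δ.toLinearMap a) = u + Mult.tmul r 1 * v

end Main

end

end MHC

namespace MHC

noncomputable section

section Separation

variable {k A B V W : Type*} [Field k] [AddCommGroup A] [Module k A] [AddCommGroup B] [Module k B]
  [AddCommGroup V] [Module k V] [AddCommGroup W] [Module k W]

theorem eq_zero_of_map_left_eq_zero {ι : Type*} (f : ι → A →ₗ[k] V)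
    (hf : ∀ a, (∀ i, f i a = 0) → a = 0) (t : A ⊗[k] B)
    (h : ∀ i, TensorProduct.map (f i) LinearMap.id t = 0) : t = 0 := by
  classical
  let b := Module.Basis.ofVectorSpace k B
  apply (TensorProduct.equivFinsuppOfBasisRight (M := A) b).injective
  rw [map_zero]
  ext j
  apply hf
  intro i
  have key : ∀ s : A ⊗[k] B, f i (TensorProduct.equivFinsuppOfBasisRight b s j) =
      TensorProduct.equivFinsuppOfBasisRight b (TensorProduct.map (f i) LinearMap.id s) j := by
    intro s
    induction s using TensorProduct.induction_on with
    | zero => simp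
    | add s₁ s₂ h₁ h₂ => simp only [map_add, Finsupp.add_apply, h₁, h₂]
    | tmul x y => simp
  rw [key, h, map_zero, Finsupp.zero_apply]

theorem eq_zero_of_map_right_eq_zero {ι : Type*} (g : ι → B →ₗ[k] W)
    (hg : ∀ b, (∀ i, g i b = 0) → b = 0) (t : A ⊗[k] B)
    (h : ∀ i, TensorProduct.map LinearMap.id (g i) t = 0) : t = 0 := by
  apply (TensorProduct.comm k A B).injective
  rw [map_zero]
  refine eq_zero_of_map_left_eq_zero g hg _ fun i => ?_
  have : TensorProduct.map (g i) LinearMap.id (TensorProduct.comm k A B t) =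
      TensorProduct.comm k A W (TensorProduct.map LinearMap.id (g i) t) :=
    TensorProduct.map_comm _ _ _
  rw [this, h, map_zero]

theorem eq_zero_of_map_eq_zero {ι κ : Type*} (f : ι → A →ₗ[k] V) (g : κ → B →ₗ[k] W)
    (hf : ∀ a, (∀ i, f i a = 0) → a = 0) (hg : ∀ b, (∀ i, g i b = 0) → b = 0) (t : A ⊗[k] B)
    (h : ∀ i j, TensorProduct.map (f i) (g j) t = 0) : t = 0 := by
  refine eq_zero_of_map_left_eq_zero f hf t fun i => ?_
  refine eq_zero_of_map_right_eq_zero g hg _ fun j => ?_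
  rw [← LinearMap.comp_apply, ← TensorProduct.map_comp]
  exact h i j

theorem map_map_apply {A' B' : Type*} [AddCommGroup A'] [Module k A'] [AddCommGroup B']
    [Module k B'] (f : V →ₗ[k] A') (g : W →ₗ[k] B') (f' : A →ₗ[k] V) (g' : B →ₗ[k] W)
    (t : A ⊗[k] B) :
    TensorProduct.map f g (TensorProduct.map f' g' t) =
      TensorProduct.map (f ∘ₗ f') (g ∘ₗ g') t := by
  rw [TensorProduct.map_comp, LinearMap.comp_apply]

theorem eq_zero_of_tmul_eq_zero {a : A} {b : B} (hb : b ≠ 0) (h : a ⊗ₜ[k] b = 0) : a = 0 := by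
  obtain ⟨g, hg⟩ : ∃ g : Module.Dual k B, g b ≠ 0 := by
    by_contra! H
    exact hb ((Module.forall_dual_apply_eq_zero_iff k b).1 H)
  have := congrArg (TensorProduct.rid k A) (congrArg (TensorProduct.map LinearMap.id g) h)
  simpa [hg] using this

end Separation

section Multipliers

set_option linter.unusedSectionVars false

variable {k : Type*} [Field k]
variable {A : Type*} [NonUnitalRing A] [Module k A] [IsScalarTower k A A] [SMulCommClass k A A]
variable {B : Type*} [NonUnitalRing B] [Module k B] [IsScalarTower k B B] [SMulCommClass k B B]
variable {C : Type*} [NonUnitalRing C] [Module k C] [IsScalarTower k C C] [SMulCommClass k C C]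
variable {D : Type*} [NonUnitalRing D] [Module k D] [IsScalarTower k D D] [SMulCommClass k D D]

namespace Mult

@[simp] theorem one_left (a : A) : (1 : Mult k A).left a = a := rfl
@[simp] theorem one_right (a : A) : (1 : Mult k A).right a = a := rfl
@[simp] theorem zero_left (a : A) : (0 : Mult k A).left a = 0 := rfl
@[simp] theorem zero_right (a : A) : (0 : Mult k A).right a = 0 := rfl
@[simp] theorem mul_left_apply (x y : Mult k A) (a : A) :
    (x * y).left a = x.left (y.left a) := rfl
@[simp] theorem mul_right_apply (x y : Mult k A) (a : A) :
    (x * y).right a = y.right (x.right a) := rfl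
@[simp] theorem add_left_apply (x y : Mult k A) (a : A) :
    (x + y).left a = x.left a + y.left a := rfl
@[simp] theorem add_right_apply (x y : Mult k A) (a : A) :
    (x + y).right a = x.right a + y.right a := rfl
@[simp] theorem sub_left_apply (x y : Mult k A) (a : A) :
    (x - y).left a = x.left a - y.left a := rfl
@[simp] theorem sub_right_apply (x y : Mult k A) (a : A) :
    (x - y).right a = x.right a - y.right a := rfl
@[simp] theorem neg_left_apply (x : Mult k A) (a : A) : (-x).left a = -x.left a := rfl
@[simp] theorem neg_right_apply (x : Mult k A) (a : A) : (-x).right a = -x.right a := rfl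
@[simp] theorem smul_left_apply (c : k) (x : Mult k A) (a : A) :
    (c • x).left a = c • x.left a := rfl
@[simp] theorem smul_right_apply (c : k) (x : Mult k A) (a : A) :
    (c • x).right a = c • x.right a := rfl
@[simp] theorem mk_left (l r : A →ₗ[k] A) (hl hr h) : (Mult.mk l r hl hr h).left = l := rfl
@[simp] theorem mk_right (l r : A →ₗ[k] A) (hl hr h) : (Mult.mk l r hl hr h).right = r := rfl
@[simp] theorem toMult_left (a b : A) : (toMult a : Mult k A).left b = a * b := rfl
@[simp] theorem toMult_right (a b : A) : (toMult a : Mult k A).right b = b * a := rfl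
@[simp] theorem tmul_left (x : Mult k A) (y : Mult k B) :
    (Mult.tmul x y).left = TensorProduct.map x.left y.left := rfl
@[simp] theorem tmul_right (x : Mult k A) (y : Mult k B) :
    (Mult.tmul x y).right = TensorProduct.map x.right y.right := rfl

theorem ext' {x y : Mult k A} (h₁ : ∀ a, x.left a = y.left a) (h₂ : ∀ a, x.right a = y.right a) :
    x = y :=
  Subtype.ext (Prod.ext (LinearMap.ext h₁) (MulOpposite.unop_injective (LinearMap.ext h₂)))

theorem ext_left (hA : NondegenerateProduct A) {x y : Mult k A} (h : ∀ a, x.left a = y.left a) :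
    x = y := by
  refine ext' h fun a => sub_eq_zero.1 (hA.1 _ fun b => ?_)
  rw [sub_mul, right_mul_eq, right_mul_eq, h, sub_self]

theorem ext_right (hA : NondegenerateProduct A) {x y : Mult k A}
    (h : ∀ a, x.right a = y.right a) : x = y := by
  refine ext' (fun a => sub_eq_zero.1 (hA.2 _ fun b => ?_)) h
  rw [mul_sub, ← right_mul_eq, ← right_mul_eq, h, sub_self]

/-- For a nondegenerate product, the compatibility `(a x) b = a (x b)` is enough. -/
def ofCompat (hA : NondegenerateProduct A) (l r : A →ₗ[k] A) (h : ∀ a b, r a * b = a * l b) :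
    Mult k A :=
  Mult.mk l r
    (fun a b => sub_eq_zero.1 (hA.2 _ fun c => by
      rw [mul_sub, ← h, ← mul_assoc c, ← h, mul_assoc, sub_self]))
    (fun a b => sub_eq_zero.1 (hA.1 _ fun c => by
      rw [sub_mul, h, mul_assoc, mul_assoc, h, sub_self])) h

theorem mul_toMult (x : Mult k A) (a : A) : x * toMult a = toMult (x.left a) :=
  ext' (fun b => x.left_mul a b) (fun b => x.right_mul_eq b a)

theorem toMult_mul (x : Mult k A) (a : A) : toMult a * x = toMult (x.right a) :=
  ext' (fun b => (x.right_mul_eq a b).symm) (fun b => x.right_mul b a)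

theorem toMult_mul_toMult (a b : A) : (toMult (a * b) : Mult k A) = toMult a * toMult b :=
  (mul_toMult (toMult a) b).symm

theorem toMult_injective (hA : NondegenerateProduct A) :
    Function.Injective (toMult : A →ₗ[k] Mult k A) := by
  rw [injective_iff_map_eq_zero]
  intro a ha
  refine hA.1 a fun b => ?_
  rw [← toMult_left (k := k), ha, zero_left]

theorem left_right_comm (hA : NondegenerateProduct A) (x y : Mult k A) (a : A) :
    x.left (y.right a) = y.right (x.left a) := by
  apply toMult_injective (k := k) hA
  rw [← mul_toMult, ← toMult_mul, ← toMult_mul, ← mul_toMult, mul_assoc]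

theorem tmul_mul_tmul (x x' : Mult k A) (y y' : Mult k B) :
    Mult.tmul x y * Mult.tmul x' y' = Mult.tmul (x * x') (y * y') :=
  ext' (fun t => map_map_apply _ _ _ _ t) (fun t => map_map_apply _ _ _ _ t)

theorem tmul_one_one : Mult.tmul (1 : Mult k A) (1 : Mult k B) = 1 :=
  ext' (fun t => LinearMap.congr_fun TensorProduct.map_id t)
    (fun t => LinearMap.congr_fun TensorProduct.map_id t)

theorem tmul_toMult (a : A) (b : B) :
    Mult.tmul (toMult a : Mult k A) (toMult b) = toMult (a ⊗ₜ[k] b) := by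
  refine ext' (fun t => ?_) (fun t => ?_) <;>
  · induction t using TensorProduct.induction_on with
    | zero => simp
    | add s₁ s₂ h₁ h₂ => simp only [map_add, h₁, h₂]
    | tmul c d => simp

end Mult

theorem NondegenerateProduct.tensor (k : Type*) [Field k] [Module k A] [IsScalarTower k A A]
    [SMulCommClass k A A] [Module k B] [IsScalarTower k B B] [SMulCommClass k B B]
    (hA : NondegenerateProduct A) (hB : NondegenerateProduct B) :
    NondegenerateProduct (A ⊗[k] B) := by
  constructor
  · intro t ht
    refine eq_zero_of_map_eq_zero (fun c => (toMult c : Mult k A).right)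
      (fun d => (toMult d : Mult k B).right) hA.1 hB.1 t fun c d => ?_
    have := ht (c ⊗ₜ d)
    rw [← Mult.toMult_right (k := k), ← Mult.tmul_toMult] at this
    exact this
  · intro t ht
    refine eq_zero_of_map_eq_zero (fun c => (toMult c : Mult k A).left)
      (fun d => (toMult d : Mult k B).left) hA.2 hB.2 t fun c d => ?_
    have := ht (c ⊗ₜ d)
    rw [← Mult.toMult_left (k := k), ← Mult.tmul_toMult] at this
    exact this

/-- `f : A → M(B)` is a homomorphism with `f(A)B = B = Bf(A)`. -/
structure NondegenerateHom (f : A →ₗ[k] Mult k B) : Prop where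
  map_mul : ∀ a b, f (a * b) = f a * f b
  span_left : Submodule.span k {c | ∃ a b, c = (f a).left b} = ⊤
  span_right : Submodule.span k {c | ∃ a b, c = (f a).right b} = ⊤

namespace NondegenerateHom

variable {f : A →ₗ[k] Mult k B}

theorem hom_ext_left (hf : NondegenerateHom f) {V : Type*} [AddCommGroup V] [Module k V]
    {g h : B →ₗ[k] V} (H : ∀ a b, g ((f a).left b) = h ((f a).left b)) : g = h :=
  LinearMap.ext_on hf.span_left (by rintro _ ⟨a, b, rfl⟩; exact H a b)

theorem hom_ext_right (hf : NondegenerateHom f) {V : Type*} [AddCommGroup V] [Module k V]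
    {g h : B →ₗ[k] V} (H : ∀ a b, g ((f a).right b) = h ((f a).right b)) : g = h :=
  LinearMap.ext_on hf.span_right (by rintro _ ⟨a, b, rfl⟩; exact H a b)

theorem induction_left (hf : NondegenerateHom f) {P : B → Prop} (b : B)
    (h : ∀ a b, P ((f a).left b)) (h0 : P 0) (hadd : ∀ b c, P b → P c → P (b + c)) : P b := by
  have hb : b ∈ Submodule.span k {c | ∃ a b, c = (f a).left b} := by rw [hf.span_left]; trivial
  induction hb using Submodule.closure_induction with
  | zero => exact h0
  | add b c _ _ hb hc => exact hadd b c hb hc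
  | smul_mem r x hx =>
    obtain ⟨a, b, rfl⟩ := hx
    rw [← map_smul]
    exact h _ _

theorem induction_right (hf : NondegenerateHom f) {P : B → Prop} (b : B)
    (h : ∀ a b, P ((f a).right b)) (h0 : P 0) (hadd : ∀ b c, P b → P c → P (b + c)) : P b := by
  have hb : b ∈ Submodule.span k {c | ∃ a b, c = (f a).right b} := by rw [hf.span_right]; trivial
  induction hb using Submodule.closure_induction with
  | zero => exact h0
  | add b c _ _ hb hc => exact hadd b c hb hc
  | smul_mem r x hx =>
    obtain ⟨a, b, rfl⟩ := hx
    rw [← map_smul]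
    exact h _ _

theorem mult_ext_left (hf : NondegenerateHom f) (hB : NondegenerateProduct B) {x y : Mult k B}
    (h : ∀ a, x * f a = y * f a) : x = y := by
  refine Mult.ext_left hB fun b => LinearMap.congr_fun (hf.hom_ext_left fun a b => ?_) b
  rw [← Mult.mul_left_apply, h, Mult.mul_left_apply]

theorem mult_ext_right (hf : NondegenerateHom f) (hB : NondegenerateProduct B) {x y : Mult k B}
    (h : ∀ a, f a * x = f a * y) : x = y := by
  refine Mult.ext_right hB fun b => LinearMap.congr_fun (hf.hom_ext_right fun a b => ?_) b
  rw [← Mult.mul_right_apply, h, Mult.mul_right_apply]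

theorem extendsTo_of_left (hf : NondegenerateHom f) (hB : NondegenerateProduct B) {x : Mult k A}
    {z : Mult k B} (h : ∀ a, f (x.left a) = z * f a) : ExtendsTo f x z := by
  refine fun a => ⟨h a, hf.mult_ext_left hB fun b => ?_⟩
  rw [← hf.map_mul, Mult.right_mul_eq, hf.map_mul, h, mul_assoc]

theorem extendsTo_of_right (hf : NondegenerateHom f) (hB : NondegenerateProduct B) {x : Mult k A}
    {z : Mult k B} (h : ∀ a, f (x.right a) = f a * z) : ExtendsTo f x z := by
  refine fun a => ⟨hf.mult_ext_right hB fun b => ?_, h a⟩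
  rw [← hf.map_mul, ← Mult.right_mul_eq, hf.map_mul, h, mul_assoc]

theorem extendsTo_unique (hf : NondegenerateHom f) (hB : NondegenerateProduct B) {x : Mult k A}
    {z w : Mult k B} (hz : ExtendsTo f x z) (hw : ExtendsTo f x w) : z = w :=
  hf.mult_ext_left hB fun a => by rw [← (hz a).1, ← (hw a).1]

theorem extendsTo_toMult (hf : NondegenerateHom f) (a : A) : ExtendsTo f (toMult a) (f a) :=
  fun b => ⟨hf.map_mul a b, hf.map_mul b a⟩

/-- `a ⊗ b ↦ f(xa) b`. -/
def leftAction (f : A →ₗ[k] Mult k B) (x : Mult k A) : A ⊗[k] B →ₗ[k] B :=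
  TensorProduct.lift (LinearMap.mk₂ k (fun a b => (f (x.left a)).left b) (by simp) (by simp)
    (by simp) (by simp))

/-- `a ⊗ b ↦ b f(ax)`. -/
def rightAction (f : A →ₗ[k] Mult k B) (x : Mult k A) : A ⊗[k] B →ₗ[k] B :=
  TensorProduct.lift (LinearMap.mk₂ k (fun a b => (f (x.right a)).right b) (by simp) (by simp)
    (by simp) (by simp))

theorem leftAction_surjective (hf : NondegenerateHom f) :
    Function.Surjective (leftAction f (1 : Mult k A)) := fun b =>
  hf.induction_left (P := fun b => ∃ t, leftAction f 1 t = b) b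
    (fun a b => ⟨a ⊗ₜ b, rfl⟩) ⟨0, map_zero _⟩
    (fun b c ⟨t, ht⟩ ⟨s, hs⟩ => ⟨t + s, by rw [map_add, ht, hs]⟩)

theorem rightAction_surjective (hf : NondegenerateHom f) :
    Function.Surjective (rightAction f (1 : Mult k A)) := fun b =>
  hf.induction_right (P := fun b => ∃ t, rightAction f 1 t = b) b
    (fun a b => ⟨a ⊗ₜ b, rfl⟩) ⟨0, map_zero _⟩
    (fun b c ⟨t, ht⟩ ⟨s, hs⟩ => ⟨t + s, by rw [map_add, ht, hs]⟩)

theorem rightAction_mul_leftAction (hf : NondegenerateHom f) (x : Mult k A) (s t : A ⊗[k] B) :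
    rightAction f x s * leftAction f 1 t = rightAction f 1 s * leftAction f x t := by
  induction s using TensorProduct.induction_on with
  | zero => simp
  | add s₁ s₂ h₁ h₂ => simp only [map_add, add_mul, h₁, h₂]
  | tmul a b =>
    induction t using TensorProduct.induction_on with
    | zero => simp
    | add s₁ s₂ h₁ h₂ => simp only [map_add, mul_add, h₁, h₂]
    | tmul c d =>
      simp only [rightAction, leftAction, TensorProduct.lift.tmul, LinearMap.mk₂_apply,
        Mult.right_mul_eq, Mult.one_left, Mult.one_right, ← Mult.mul_left_apply, ← hf.map_mul]

theorem exists_extension (hf : NondegenerateHom f) (hB : NondegenerateProduct B) (x : Mult k A) :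
    ∃ z : Mult k B, ExtendsTo f x z := by
  obtain ⟨σ, hσ⟩ := (leftAction f (1 : Mult k A)).exists_rightInverse_of_surjective
    (LinearMap.range_eq_top.2 hf.leftAction_surjective)
  obtain ⟨ρ, hρ⟩ := (rightAction f (1 : Mult k A)).exists_rightInverse_of_surjective
    (LinearMap.range_eq_top.2 hf.rightAction_surjective)
  have hσ' := LinearMap.congr_fun hσ
  have hρ' := LinearMap.congr_fun hρ
  simp only [LinearMap.comp_apply, LinearMap.id_apply] at hσ' hρ'
  have compat : ∀ a b, rightAction f x (ρ a) * b = a * leftAction f x (σ b) := fun a b => by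
    conv_lhs => rw [← hσ' b]
    rw [hf.rightAction_mul_leftAction, hρ']
  have key : ∀ t, leftAction f x (σ (leftAction f 1 t)) = leftAction f x t := fun t =>
    sub_eq_zero.1 (hB.2 _ fun c => by
      rw [mul_sub, ← compat, hf.rightAction_mul_leftAction, hρ', sub_self])
  refine ⟨Mult.ofCompat hB (leftAction f x ∘ₗ σ) (rightAction f x ∘ₗ ρ) compat, ?_⟩
  refine hf.extendsTo_of_left hB fun a => Mult.ext_left hB fun b => ?_
  exact (key (a ⊗ₜ b)).symm

theorem ExtendsTo.mul {x x' : Mult k A} {z z' : Mult k B} (h : ExtendsTo f x z)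
    (h' : ExtendsTo f x' z') : ExtendsTo f (x * x') (z * z') := fun a => by
  constructor
  · rw [Mult.mul_left_apply, (h _).1, (h' _).1, mul_assoc]
  · rw [Mult.mul_right_apply, (h' _).2, (h _).2, mul_assoc]

/-- The extension of `f` to `M(A)`. -/
def extension (hf : NondegenerateHom f) (hB : NondegenerateProduct B) : Mult k A →ₐ[k] Mult k B :=
  have spec := fun x => (hf.exists_extension hB x).choose_spec
  AlgHom.ofLinearMap
    { toFun := fun x => (hf.exists_extension hB x).choose
      map_add' := fun x y => hf.extendsTo_unique hB (spec _) fun a => by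
        rw [Mult.add_left_apply, Mult.add_right_apply, map_add, map_add, add_mul, mul_add]
        exact ⟨by rw [(spec x a).1, (spec y a).1], by rw [(spec x a).2, (spec y a).2]⟩
      map_smul' := fun c x => hf.extendsTo_unique hB (spec _) fun a => by
        rw [Mult.smul_left_apply, Mult.smul_right_apply, map_smul, map_smul, (spec x a).1,
          (spec x a).2]
        exact ⟨(smul_mul_assoc _ _ _).symm, (mul_smul_comm _ _ _).symm⟩ }
    (hf.extendsTo_unique hB (spec 1) fun a => by simp)
    (fun x y => hf.extendsTo_unique hB (spec _) (ExtendsTo.mul (spec x) (spec y)))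

theorem extension_spec (hf : NondegenerateHom f) (hB : NondegenerateProduct B) (x : Mult k A) :
    ExtendsTo f x (hf.extension hB x) :=
  (hf.exists_extension hB x).choose_spec

theorem extension_eq (hf : NondegenerateHom f) (hB : NondegenerateProduct B) {x : Mult k A}
    {z : Mult k B} (h : ExtendsTo f x z) : hf.extension hB x = z :=
  hf.extendsTo_unique hB (hf.extension_spec hB x) h

theorem extension_toMult (hf : NondegenerateHom f) (hB : NondegenerateProduct B) (a : A) :
    hf.extension hB (toMult a) = f a :=
  hf.extension_eq hB (hf.extendsTo_toMult a)

end NondegenerateHom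

theorem span_map_eq_top {V W V' W' : Type*} [AddCommGroup V] [Module k V] [AddCommGroup W]
    [Module k W] [AddCommGroup V'] [Module k V'] [AddCommGroup W'] [Module k W']
    (S : Set (V →ₗ[k] V')) (T : Set (W →ₗ[k] W'))
    (hS : Submodule.span k {c | ∃ f ∈ S, ∃ b, c = f b} = ⊤)
    (hT : Submodule.span k {c | ∃ f ∈ T, ∃ b, c = f b} = ⊤) :
    Submodule.span k {c | ∃ f ∈ S, ∃ g ∈ T, ∃ t, c = TensorProduct.map f g t} = ⊤ := by
  rw [eq_top_iff]
  rintro t -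
  induction t using TensorProduct.induction_on with
  | zero => exact zero_mem _
  | add s₁ s₂ h₁ h₂ => exact add_mem h₁ h₂
  | tmul v w =>
    have hv : v ∈ Submodule.span k {c | ∃ f ∈ S, ∃ b, c = f b} := by rw [hS]; trivial
    have hw : w ∈ Submodule.span k {c | ∃ f ∈ T, ∃ b, c = f b} := by rw [hT]; trivial
    induction hv using Submodule.span_induction with
    | zero => rw [TensorProduct.zero_tmul]; exact zero_mem _
    | add x y _ _ hx hy => rw [TensorProduct.add_tmul]; exact add_mem hx hy
    | smul c x _ hx => rw [← TensorProduct.smul_tmul']; exact Submodule.smul_mem _ _ hx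
    | mem x hx =>
      obtain ⟨f, hf, b, rfl⟩ := hx
      induction hw using Submodule.span_induction with
      | zero => rw [TensorProduct.tmul_zero]; exact zero_mem _
      | add x y _ _ hx hy => rw [TensorProduct.tmul_add]; exact add_mem hx hy
      | smul c x _ hx => rw [TensorProduct.tmul_smul]; exact Submodule.smul_mem _ _ hx
      | mem x hx =>
        obtain ⟨g, hg, d, rfl⟩ := hx
        exact Submodule.subset_span ⟨f, hf, g, hg, b ⊗ₜ d, rfl⟩

@[simp] theorem tensorMap_tmul (f : A →ₗ[k] Mult k C) (g : B →ₗ[k] Mult k D) (a : A) (b : B) :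
    tensorMap f g (a ⊗ₜ b) = Mult.tmul (f a) (g b) := rfl

@[simp] theorem functionalTensorMap_tmul (χ : A →ₗ[k] k) (g : B →ₗ[k] Mult k D) (a : A) (b : B) :
    functionalTensorMap χ g (a ⊗ₜ b) = χ a • g b := rfl

theorem map_mul_of_tmul {f : A ⊗[k] B →ₗ[k] Mult k C}
    (h : ∀ a b c d, f ((a ⊗ₜ b) * (c ⊗ₜ d)) = f (a ⊗ₜ b) * f (c ⊗ₜ d)) (s t : A ⊗[k] B) :
    f (s * t) = f s * f t := by
  induction s using TensorProduct.induction_on with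
  | zero => simp
  | add s₁ s₂ h₁ h₂ => simp only [map_add, add_mul, h₁, h₂]
  | tmul a b =>
    induction t using TensorProduct.induction_on with
    | zero => simp
    | add s₁ s₂ h₁ h₂ => simp only [map_add, mul_add, h₁, h₂]
    | tmul c d => exact h a b c d

theorem NondegenerateHom.tensor {f : A →ₗ[k] Mult k C} {g : B →ₗ[k] Mult k D}
    (hf : NondegenerateHom f) (hg : NondegenerateHom g) : NondegenerateHom (tensorMap f g) where
  map_mul := map_mul_of_tmul fun a b c d => by
    rw [Algebra.TensorProduct.tmul_mul_tmul, tensorMap_tmul, tensorMap_tmul, tensorMap_tmul,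
      Mult.tmul_mul_tmul, hf.map_mul, hg.map_mul]
  span_left := by
    rw [eq_top_iff, ← span_map_eq_top (Set.range fun a => (f a).left) (Set.range fun b => (g b).left)
      (by simpa using hf.span_left) (by simpa using hg.span_left)]
    apply Submodule.span_mono
    rintro _ ⟨_, ⟨a, rfl⟩, _, ⟨b, rfl⟩, t, rfl⟩
    exact ⟨a ⊗ₜ b, t, rfl⟩
  span_right := by
    rw [eq_top_iff, ← span_map_eq_top (Set.range fun a => (f a).right)
      (Set.range fun b => (g b).right) (by simpa using hf.span_right) (by simpa using hg.span_right)]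
    apply Submodule.span_mono
    rintro _ ⟨_, ⟨a, rfl⟩, _, ⟨b, rfl⟩, t, rfl⟩
    exact ⟨a ⊗ₜ b, t, rfl⟩

theorem NondegenerateHom.functional_tensor {χ : A →ₙₐ[k] k} (hχ : χ ≠ 0) {g : B →ₗ[k] Mult k D}
    (hg : NondegenerateHom g) :
    NondegenerateHom (functionalTensorMap (χ : A →ₗ[k] k) g) := by
  obtain ⟨a, ha⟩ : ∃ a, χ a = 1 := by
    obtain ⟨a, ha⟩ : ∃ a, χ a ≠ 0 := by
      by_contra! h
      exact hχ (NonUnitalAlgHom.ext h)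
    exact ⟨(χ a)⁻¹ • a, by rw [map_smul, smul_eq_mul, inv_mul_cancel₀ ha]⟩
  refine ⟨map_mul_of_tmul fun a b c d => ?_, ?_, ?_⟩
  · rw [Algebra.TensorProduct.tmul_mul_tmul, functionalTensorMap_tmul, functionalTensorMap_tmul,
      functionalTensorMap_tmul, hg.map_mul, smul_mul_smul_comm]
    simp
  · rw [eq_top_iff, ← hg.span_left]
    apply Submodule.span_mono
    rintro _ ⟨b, c, rfl⟩
    exact ⟨a ⊗ₜ b, c, by simp [ha]⟩
  · rw [eq_top_iff, ← hg.span_right]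
    apply Submodule.span_mono
    rintro _ ⟨b, c, rfl⟩
    exact ⟨a ⊗ₜ b, c, by simp [ha]⟩

/-- If `F(g(s)w) = G(s)F(w)`, then the value of the extension of `G` at `x` can be computed in two
steps, through the extension `u` of `g` at `x`. -/
theorem map_left_iff_of_intertwine {g : A →ₗ[k] Mult k B} (hg : NondegenerateHom g)
    {F : B →ₗ[k] Mult k C} (hF : NondegenerateHom F) (hC : NondegenerateProduct C)
    {G : A →ₗ[k] Mult k C} (hG : ∀ s w, F ((g s).left w) = G s * F w) {x : Mult k A} {u : Mult k B}
    (hu : ExtendsTo g x u) (z : Mult k C) :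
    (∀ w, F (u.left w) = z * F w) ↔ ∀ s, G (x.left s) = z * G s := by
  have key : ∀ s w, F (u.left ((g s).left w)) = G (x.left s) * F w := fun s w => by
    rw [← hG, (hu s).1, Mult.mul_left_apply]
  constructor
  · intro h s
    refine hF.mult_ext_left hC fun w => ?_
    rw [← key, h, hG, mul_assoc]
  · intro h w
    refine LinearMap.congr_fun (hg.hom_ext_left (g := F ∘ₗ u.left)
      (h := LinearMap.mulLeft k z ∘ₗ F) fun s w => ?_) w
    simp only [LinearMap.comp_apply, LinearMap.mulLeft_apply]
    rw [key, h, hG, mul_assoc]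

/-- The value of the extension of a `T`-derivation `d` at `x` is determined by its left action. -/
theorem derivationExtendsTo_iff (hB : NondegenerateProduct B) {T d : B →ₗ[k] B}
    (hT : NondegenerateHom (toMult ∘ₗ T))
    (hd : ∀ s t, d (s * t) = d s * t + T s * d t) {x z w : Mult k B}
    (hw : ∀ t, T (x.left t) = w.left (T t)) :
    DerivationExtendsTo T d x z ↔ ∀ t, d (x.left t) = z.left t + w.left (d t) := by
  have hw' : ExtendsTo (toMult ∘ₗ T) x w := hT.extendsTo_of_left hB fun t => by
    simp only [LinearMap.comp_apply, hw, Mult.mul_toMult]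
  constructor
  · rintro ⟨w', hw'', h⟩ t
    rw [hT.extendsTo_unique hB hw' hw'']
    exact (h t).1
  · refine fun h => ⟨w, hw', fun t => ⟨h t, sub_eq_zero.1 (hB.1 _ fun s => ?_)⟩⟩
    have h₁ : d (x.right t * s) = d (t * x.left s) := by rw [Mult.right_mul_eq]
    have h₂ : T (x.right t) = w.right (T t) := Mult.toMult_injective (k := k) hB (by
      simpa [Mult.toMult_mul] using (hw' t).2)
    rw [hd, hd, h₂, h] at h₁
    rw [sub_mul, add_mul, Mult.right_mul_eq, Mult.right_mul_eq]
    rw [Mult.right_mul_eq, mul_add] at h₁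
    rw [eq_sub_of_add_eq h₁]
    abel

theorem exists_derivation_extension (hB : NondegenerateProduct B) {T d : B →ₗ[k] B}
    (hTs : Function.Surjective T) (hTm : ∀ s t, T (s * t) = T s * T t)
    (hd : ∀ s t, d (s * t) = d s * t + T s * d t) {x w : Mult k B}
    (hw : ∀ t, T (x.left t) = w.left (T t)) :
    ∃ z : Mult k B, ∀ t, d (x.left t) = z.left t + w.left (d t) := by
  obtain ⟨σ, hσ⟩ := T.exists_rightInverse_of_surjective (LinearMap.range_eq_top.2 hTs)
  have hσ' := LinearMap.congr_fun hσ
  simp only [LinearMap.comp_apply, LinearMap.id_apply] at hσ'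
  have hwr : ∀ t, T (x.right t) = w.right (T t) := fun t => sub_eq_zero.1 (hB.1 _ fun s => by
    obtain ⟨s, rfl⟩ := hTs s
    rw [sub_mul, ← hTm, Mult.right_mul_eq, Mult.right_mul_eq, hTm, hw, sub_self])
  refine ⟨Mult.ofCompat hB (d ∘ₗ x.left - w.left ∘ₗ d) ((d ∘ₗ x.right - x.right ∘ₗ d) ∘ₗ σ)
    fun a b => ?_, fun t => by simp [Mult.ofCompat]⟩
  simp only [LinearMap.comp_apply, LinearMap.sub_apply]
  have h₁ : d (x.right (σ a) * b) = d (σ a * x.left b) := by rw [Mult.right_mul_eq]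
  rw [hd, hd, hwr, hσ', Mult.right_mul_eq] at h₁
  rw [sub_mul, mul_sub, Mult.right_mul_eq, eq_sub_of_add_eq h₁]
  abel

end Multipliers

end

end MHC

namespace MHC

noncomputable section

section Galois

set_option linter.unusedSectionVars false

variable {k : Type*} [Field k]
variable {A : Type*} [NonUnitalRing A] [Module k A] [IsScalarTower k A A] [SMulCommClass k A A]
variable {B : Type*} [NonUnitalRing B] [Module k B] [IsScalarTower k B B] [SMulCommClass k B B]

local notation "tmul₂" => Mult.tmul (k := k) (A := A) (B := A)

theorem nondegenerateHom_toMult_comp_of_surjective (hB : NondegenerateHom (toMult : B →ₗ[k] Mult k B))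
    {f : A →ₗ[k] B} (hf : Function.Surjective f) (hm : ∀ a b, f (a * b) = f a * f b) :
    NondegenerateHom (toMult ∘ₗ f) where
  map_mul a b := by
    rw [LinearMap.comp_apply, hm, Mult.toMult_mul_toMult]
    rfl
  span_left := by
    rw [eq_top_iff, ← hB.span_left]
    apply Submodule.span_mono
    rintro _ ⟨b, c, rfl⟩
    obtain ⟨a, rfl⟩ := hf b
    exact ⟨a, c, rfl⟩
  span_right := by
    rw [eq_top_iff, ← hB.span_right]
    apply Submodule.span_mono
    rintro _ ⟨b, c, rfl⟩
    obtain ⟨a, rfl⟩ := hf b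
    exact ⟨a, c, rfl⟩

/-- `χ ⊗ ι : A ⊗ B → B`. -/
def leftSlice (χ : A →ₗ[k] k) : A ⊗[k] B →ₗ[k] B :=
  (TensorProduct.lid k B).toLinearMap ∘ₗ TensorProduct.map χ LinearMap.id

/-- `ι ⊗ χ : A ⊗ B → A`. -/
def rightSlice (χ : B →ₗ[k] k) : A ⊗[k] B →ₗ[k] A :=
  (TensorProduct.rid k A).toLinearMap ∘ₗ TensorProduct.map LinearMap.id χ

@[simp] theorem leftSlice_tmul (χ : A →ₗ[k] k) (a : A) (b : B) :
    leftSlice χ (a ⊗ₜ[k] b) = χ a • b := by simp [leftSlice]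

@[simp] theorem rightSlice_tmul (χ : B →ₗ[k] k) (a : A) (b : B) :
    rightSlice χ (a ⊗ₜ[k] b) = χ b • a := by simp [rightSlice]

theorem functionalTensorMap_toMult (χ : A →ₗ[k] k) :
    functionalTensorMap χ (toMult : B →ₗ[k] Mult k B) = toMult ∘ₗ leftSlice χ :=
  TensorProduct.ext' fun a b => by simp

theorem leftSlice_mul (χ : A →ₙₐ[k] k) (s t : A ⊗[k] B) :
    leftSlice (χ : A →ₗ[k] k) (s * t) =
      leftSlice (χ : A →ₗ[k] k) s * leftSlice (χ : A →ₗ[k] k) t := by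
  induction s using TensorProduct.induction_on with
  | zero => simp
  | add s₁ s₂ h₁ h₂ => simp only [map_add, add_mul, h₁, h₂]
  | tmul a b =>
    induction t using TensorProduct.induction_on with
    | zero => simp
    | add s₁ s₂ h₁ h₂ => simp only [map_add, mul_add, h₁, h₂]
    | tmul c d => simp [smul_mul_smul_comm]

theorem rightSlice_mul (χ : B →ₙₐ[k] k) (s t : A ⊗[k] B) :
    rightSlice (χ : B →ₗ[k] k) (s * t) =
      rightSlice (χ : B →ₗ[k] k) s * rightSlice (χ : B →ₗ[k] k) t := by
  induction s using TensorProduct.induction_on with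
  | zero => simp
  | add s₁ s₂ h₁ h₂ => simp only [map_add, add_mul, h₁, h₂]
  | tmul a b =>
    induction t using TensorProduct.induction_on with
    | zero => simp
    | add s₁ s₂ h₁ h₂ => simp only [map_add, mul_add, h₁, h₂]
    | tmul c d => simp [smul_mul_smul_comm]

theorem exists_eq_one {χ : A →ₙₐ[k] k} (hχ : χ ≠ 0) : ∃ a, χ a = 1 := by
  obtain ⟨a, ha⟩ : ∃ a, χ a ≠ 0 := by
    by_contra! h
    exact hχ (NonUnitalAlgHom.ext h)
  exact ⟨(χ a)⁻¹ • a, by rw [map_smul, smul_eq_mul, inv_mul_cancel₀ ha]⟩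

theorem leftSlice_surjective {χ : A →ₙₐ[k] k} (hχ : χ ≠ 0) :
    Function.Surjective (leftSlice (χ : A →ₗ[k] k) : A ⊗[k] B →ₗ[k] B) := fun b => by
  obtain ⟨a, ha⟩ := exists_eq_one hχ
  exact ⟨a ⊗ₜ b, by simp [ha]⟩

theorem rightSlice_surjective {χ : B →ₙₐ[k] k} (hχ : χ ≠ 0) :
    Function.Surjective (rightSlice (χ : B →ₗ[k] k) : A ⊗[k] B →ₗ[k] A) := fun a => by
  obtain ⟨b, hb⟩ := exists_eq_one hχ
  exact ⟨a ⊗ₜ b, by simp [hb]⟩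

/-! The maps `T₁, …, T₄` of an arbitrary linear map `Δ : A → M(A ⊗ A)` are equivariant. -/

variable {Δ : A →ₗ[k] Mult k (A ⊗[k] A)} {T : A ⊗[k] A →ₗ[k] A ⊗[k] A}

theorem galois₁_map_right (hA : NondegenerateProduct A)
    (hT : ∀ a b, toMult (T (a ⊗ₜ[k] b)) = Δ a * tmul₂ (1 : Mult k A) (toMult b))
    (x : Mult k A) (t : A ⊗[k] A) :
    T (TensorProduct.map LinearMap.id x.right t) = TensorProduct.map LinearMap.id x.right (T t) := by
  induction t using TensorProduct.induction_on with
  | zero => simp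
  | add s₁ s₂ h₁ h₂ => simp only [map_add, h₁, h₂]
  | tmul a b =>
    apply Mult.toMult_injective (k := k) (hA.tensor k hA)
    have : TensorProduct.map LinearMap.id x.right (T (a ⊗ₜ[k] b)) =
      (tmul₂ 1 x).right (T (a ⊗ₜ[k] b)) := rfl
    rw [this, ← Mult.toMult_mul, TensorProduct.map_tmul, hT, hT, mul_assoc, Mult.tmul_mul_tmul,
      Mult.toMult_mul, mul_one, LinearMap.id_apply]

theorem galois₃_map_right (hA : NondegenerateProduct A)
    (hT : ∀ a b, toMult (T (a ⊗ₜ[k] b)) = Δ a * tmul₂ (toMult b) (1 : Mult k A))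
    (x : Mult k A) (t : A ⊗[k] A) :
    T (TensorProduct.map LinearMap.id x.right t) = TensorProduct.map x.right LinearMap.id (T t) := by
  induction t using TensorProduct.induction_on with
  | zero => simp
  | add s₁ s₂ h₁ h₂ => simp only [map_add, h₁, h₂]
  | tmul a b =>
    apply Mult.toMult_injective (k := k) (hA.tensor k hA)
    have : TensorProduct.map x.right LinearMap.id (T (a ⊗ₜ[k] b)) =
      (tmul₂ x 1).right (T (a ⊗ₜ[k] b)) := rfl
    rw [this, ← Mult.toMult_mul, TensorProduct.map_tmul, hT, hT, mul_assoc, Mult.tmul_mul_tmul,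
      Mult.toMult_mul, mul_one, LinearMap.id_apply]

theorem galois₂_map_left (hA : NondegenerateProduct A)
    (hT : ∀ a b, toMult (T (a ⊗ₜ[k] b)) = tmul₂ (toMult a) (1 : Mult k A) * Δ b)
    (x : Mult k A) (t : A ⊗[k] A) :
    T (TensorProduct.map x.left LinearMap.id t) = TensorProduct.map x.left LinearMap.id (T t) := by
  induction t using TensorProduct.induction_on with
  | zero => simp
  | add s₁ s₂ h₁ h₂ => simp only [map_add, h₁, h₂]
  | tmul a b =>
    apply Mult.toMult_injective (k := k) (hA.tensor k hA)
    have : TensorProduct.map x.left LinearMap.id (T (a ⊗ₜ[k] b)) =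
      (tmul₂ x 1).left (T (a ⊗ₜ[k] b)) := rfl
    rw [this, ← Mult.mul_toMult, TensorProduct.map_tmul, hT, hT, ← mul_assoc, Mult.tmul_mul_tmul,
      Mult.mul_toMult, mul_one, LinearMap.id_apply]

theorem galois₄_map_left (hA : NondegenerateProduct A)
    (hT : ∀ a b, toMult (T (a ⊗ₜ[k] b)) = tmul₂ (1 : Mult k A) (toMult a) * Δ b)
    (x : Mult k A) (t : A ⊗[k] A) :
    T (TensorProduct.map x.left LinearMap.id t) = TensorProduct.map LinearMap.id x.left (T t) := by
  induction t using TensorProduct.induction_on with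
  | zero => simp
  | add s₁ s₂ h₁ h₂ => simp only [map_add, h₁, h₂]
  | tmul a b =>
    apply Mult.toMult_injective (k := k) (hA.tensor k hA)
    have : TensorProduct.map LinearMap.id x.left (T (a ⊗ₜ[k] b)) =
      (tmul₂ 1 x).left (T (a ⊗ₜ[k] b)) := rfl
    rw [this, ← Mult.mul_toMult, TensorProduct.map_tmul, hT, hT, ← mul_assoc, Mult.tmul_mul_tmul,
      Mult.mul_toMult, mul_one, LinearMap.id_apply]

/-- `Δ(a)(p ⊗ q) = T₁(a ⊗ q)(p ⊗ 1)` -/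
theorem galois₁_left (hA : NondegenerateProduct A)
    (hT : ∀ a b, toMult (T (a ⊗ₜ[k] b)) = Δ a * tmul₂ (1 : Mult k A) (toMult b)) (a p q : A) :
    (Δ a).left (p ⊗ₜ q) =
      TensorProduct.map (toMult p : Mult k A).right LinearMap.id (T (a ⊗ₜ[k] q)) := by
  apply Mult.toMult_injective (k := k) (hA.tensor k hA)
  have : TensorProduct.map (toMult p : Mult k A).right LinearMap.id (T (a ⊗ₜ[k] q)) =
      (tmul₂ (toMult p) 1).right (T (a ⊗ₜ[k] q)) := rfl
  rw [this, ← Mult.toMult_mul, hT, mul_assoc, Mult.tmul_mul_tmul, one_mul, mul_one,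
    Mult.tmul_toMult, Mult.mul_toMult]

/-- `Δ(a)(p ⊗ q) = T₃(a ⊗ p)(1 ⊗ q)` -/
theorem galois₃_left (hA : NondegenerateProduct A)
    (hT : ∀ a b, toMult (T (a ⊗ₜ[k] b)) = Δ a * tmul₂ (toMult b) (1 : Mult k A)) (a p q : A) :
    (Δ a).left (p ⊗ₜ q) =
      TensorProduct.map LinearMap.id (toMult q : Mult k A).right (T (a ⊗ₜ[k] p)) := by
  apply Mult.toMult_injective (k := k) (hA.tensor k hA)
  have : TensorProduct.map LinearMap.id (toMult q : Mult k A).right (T (a ⊗ₜ[k] p)) =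
      (tmul₂ 1 (toMult q)).right (T (a ⊗ₜ[k] p)) := rfl
  rw [this, ← Mult.toMult_mul, hT, mul_assoc, Mult.tmul_mul_tmul, one_mul, mul_one,
    Mult.tmul_toMult, Mult.mul_toMult]

/-- `(p ⊗ q)Δ(a) = (1 ⊗ q)T₂(p ⊗ a)` -/
theorem galois₂_right (hA : NondegenerateProduct A)
    (hT : ∀ a b, toMult (T (a ⊗ₜ[k] b)) = tmul₂ (toMult a) (1 : Mult k A) * Δ b) (a p q : A) :
    (Δ a).right (p ⊗ₜ q) =
      TensorProduct.map LinearMap.id (toMult q : Mult k A).left (T (p ⊗ₜ[k] a)) := by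
  apply Mult.toMult_injective (k := k) (hA.tensor k hA)
  have : TensorProduct.map LinearMap.id (toMult q : Mult k A).left (T (p ⊗ₜ[k] a)) =
      (tmul₂ 1 (toMult q)).left (T (p ⊗ₜ[k] a)) := rfl
  rw [this, ← Mult.mul_toMult, hT, ← mul_assoc, Mult.tmul_mul_tmul, one_mul, mul_one,
    Mult.tmul_toMult, Mult.toMult_mul]

/-- `(p ⊗ q)Δ(a) = (p ⊗ 1)T₄(q ⊗ a)` -/
theorem galois₄_right (hA : NondegenerateProduct A)
    (hT : ∀ a b, toMult (T (a ⊗ₜ[k] b)) = tmul₂ (1 : Mult k A) (toMult a) * Δ b) (a p q : A) :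
    (Δ a).right (p ⊗ₜ q) =
      TensorProduct.map (toMult p : Mult k A).left LinearMap.id (T (q ⊗ₜ[k] a)) := by
  apply Mult.toMult_injective (k := k) (hA.tensor k hA)
  have : TensorProduct.map (toMult p : Mult k A).left LinearMap.id (T (q ⊗ₜ[k] a)) =
      (tmul₂ (toMult p) 1).left (T (q ⊗ₜ[k] a)) := rfl
  rw [this, ← Mult.mul_toMult, hT, ← mul_assoc, Mult.tmul_mul_tmul, one_mul, mul_one,
    Mult.tmul_toMult, Mult.toMult_mul]

end Galois

namespace RegularMHC

set_option linter.unusedSectionVars false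

variable {k : Type*} [Field k]
variable {A : Type*} [NonUnitalRing A] [Module k A] [IsScalarTower k A A] [SMulCommClass k A A]
variable (H : RegularMHC k A)

local notation "tmul₂" => Mult.tmul (k := k) (A := A) (B := A)

theorem nondegenerate_tensor (H : RegularMHC k A) : NondegenerateProduct (A ⊗[k] A) :=
  H.nondegenerate.tensor k H.nondegenerate

theorem T₁_surjective : Function.Surjective H.T₁ := fun t => by
  induction t using TensorProduct.induction_on with
  | zero => exact ⟨0, map_zero _⟩
  | add s₁ s₂ h₁ h₂ =>
    obtain ⟨x, hx⟩ := h₁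
    obtain ⟨y, hy⟩ := h₂
    exact ⟨x + y, by rw [map_add, hx, hy]⟩
  | tmul a b => exact ⟨_, (H.antipode₃ a (H.S.symm b)).trans (by rw [LinearEquiv.apply_symm_apply])⟩

theorem T₂_surjective : Function.Surjective H.T₂ := fun t => by
  induction t using TensorProduct.induction_on with
  | zero => exact ⟨0, map_zero _⟩
  | add s₁ s₂ h₁ h₂ =>
    obtain ⟨x, hx⟩ := h₁
    obtain ⟨y, hy⟩ := h₂
    exact ⟨x + y, by rw [map_add, hx, hy]⟩
  | tmul a b => exact ⟨_, (H.antipode₁ b (H.S.symm a)).trans (by rw [LinearEquiv.apply_symm_apply])⟩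

/-- `c ⊗ d ↦ c S(d₁) ⊗ d₂`, the inverse of `T₂`. -/
def invT₂ : A ⊗[k] A →ₗ[k] A ⊗[k] A :=
  TensorProduct.map H.S.toLinearMap LinearMap.id ∘ₗ H.T₃ ∘ₗ (TensorProduct.comm k A A).toLinearMap ∘ₗ
    TensorProduct.map H.S.symm.toLinearMap LinearMap.id

theorem invT₂_tmul (c d : A) : H.invT₂ (c ⊗ₜ d) =
    TensorProduct.map H.S.toLinearMap LinearMap.id (H.T₃ (d ⊗ₜ H.S.symm c)) := by
  simp [invT₂]

theorem invT₂_T₂ (t : A ⊗[k] A) : H.invT₂ (H.T₂ t) = t := by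
  have : H.invT₂ ∘ₗ H.T₂ = LinearMap.id := TensorProduct.ext' fun b a => H.antipode₂ a b
  exact LinearMap.congr_fun this t

theorem T₂_injective : Function.Injective H.T₂ := Function.LeftInverse.injective H.invT₂_T₂

section

variable [Nontrivial A]

theorem counit_ne_zero (H : RegularMHC k A) : H.ε ≠ 0 := by
  intro h
  obtain ⟨a, ha⟩ := exists_ne (0 : A)
  refine ha (H.nondegenerate.1 a fun b => ?_)
  have h' : (H.ε : A →ₗ[k] k) = 0 := LinearMap.ext fun c => by
    simpa using NonUnitalAlgHom.congr_fun h c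
  rw [← H.counit_left, h']
  simp

theorem nondegenerateHom_toMult (H : RegularMHC k A) : NondegenerateHom (toMult : A →ₗ[k] Mult k A) := by
  have key : ∀ b : A, b ∈ Submodule.span k {c : A | ∃ a b, c = a * b} := fun b => by
    obtain ⟨t, rfl⟩ := leftSlice_surjective H.counit_ne_zero b
    obtain ⟨s, rfl⟩ := H.T₁_surjective t
    induction s using TensorProduct.induction_on with
    | zero => simp
    | add s₁ s₂ h₁ h₂ => rw [map_add, map_add]; exact add_mem h₁ h₂
    | tmul a b => exact Submodule.subset_span ⟨a, b, H.counit_left a b⟩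
  refine ⟨Mult.toMult_mul_toMult, ?_, ?_⟩ <;> rw [eq_top_iff] <;> rintro b -
  · exact key b
  · refine Submodule.span_mono ?_ (key b)
    rintro _ ⟨a, b, rfl⟩
    exact ⟨b, a, rfl⟩

theorem nondegenerateHom_toMult_tensor (H : RegularMHC k A) :
    NondegenerateHom (toMult : A ⊗[k] A →ₗ[k] Mult k (A ⊗[k] A)) := by
  convert H.nondegenerateHom_toMult.tensor H.nondegenerateHom_toMult
  exact TensorProduct.ext' fun a b => (Mult.tmul_toMult a b).symm

theorem nondegenerateHom_comul : NondegenerateHom H.comul where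
  map_mul := map_mul H.Δ
  span_left := by
    rw [eq_top_iff]
    rintro t -
    refine (H.nondegenerateHom_toMult.tensor H.nondegenerateHom_toMult).induction_right t
      (fun w t => ?_) (zero_mem _) fun _ _ => add_mem
    obtain ⟨s, rfl⟩ := H.T₁_surjective t
    induction w using TensorProduct.induction_on with
    | zero => simp
    | add s₁ s₂ h₁ h₂ => rw [map_add, Mult.add_right_apply]; exact add_mem h₁ h₂
    | tmul p q =>
      induction s using TensorProduct.induction_on with
      | zero => simp
      | add s₁ s₂ h₁ h₂ => rw [map_add, map_add]; exact add_mem h₁ h₂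
      | tmul a b =>
        refine Submodule.subset_span ⟨a, p ⊗ₜ (b * q), ?_⟩
        refine Eq.trans ?_ (galois₁_left (Δ := H.comul) H.nondegenerate H.T₁_spec a p (b * q)).symm
        have := galois₁_map_right (Δ := H.comul) H.nondegenerate H.T₁_spec (toMult q) (a ⊗ₜ b)
        rw [TensorProduct.map_tmul, LinearMap.id_apply, Mult.toMult_right] at this
        rw [this, map_map_apply]
        rfl
  span_right := by
    rw [eq_top_iff]
    rintro t -
    refine (H.nondegenerateHom_toMult.tensor H.nondegenerateHom_toMult).induction_left t
      (fun w t => ?_) (zero_mem _) fun _ _ => add_mem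
    obtain ⟨s, rfl⟩ := H.T₂_surjective t
    induction w using TensorProduct.induction_on with
    | zero => simp
    | add s₁ s₂ h₁ h₂ => rw [map_add, Mult.add_left_apply]; exact add_mem h₁ h₂
    | tmul p q =>
      induction s using TensorProduct.induction_on with
      | zero => simp
      | add s₁ s₂ h₁ h₂ => rw [map_add, map_add]; exact add_mem h₁ h₂
      | tmul a b =>
        refine Submodule.subset_span ⟨b, (p * a) ⊗ₜ q, ?_⟩
        refine Eq.trans ?_ (galois₂_right (Δ := H.comul) H.nondegenerate H.T₂_spec b (p * a) q).symm
        have := galois₂_map_left (Δ := H.comul) H.nondegenerate H.T₂_spec (toMult p) (a ⊗ₜ b)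
        rw [TensorProduct.map_tmul, LinearMap.id_apply, Mult.toMult_left] at this
        rw [this, map_map_apply]
        rfl

/-- `(ε ⊗ ι)(Δ(a)t) = a (ε ⊗ ι)(t)` -/
theorem leftSlice_comul_left (a : A) (t : A ⊗[k] A) :
    leftSlice (H.ε : A →ₗ[k] k) ((H.Δ a).left t) = a * leftSlice (H.ε : A →ₗ[k] k) t := by
  induction t using TensorProduct.induction_on with
  | zero => simp
  | add s₁ s₂ h₁ h₂ => simp only [map_add, mul_add, h₁, h₂]
  | tmul p q =>
    have h : ∀ s : A ⊗[k] A, leftSlice (H.ε : A →ₗ[k] k)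
        (TensorProduct.map (toMult p : Mult k A).right LinearMap.id s) =
        H.ε p • leftSlice (H.ε : A →ₗ[k] k) s := fun s => by
      induction s using TensorProduct.induction_on with
      | zero => simp
      | add s₁ s₂ h₁ h₂ => simp only [map_add, smul_add, h₁, h₂]
      | tmul c d => simp [mul_smul, smul_comm (H.ε p)]
    refine (congrArg _ (galois₁_left (Δ := H.comul) H.nondegenerate H.T₁_spec a p q)).trans ?_
    rw [h, leftSlice_tmul]
    exact (congrArg _ (H.counit_left a q)).trans (mul_smul_comm _ _ _).symm

theorem rightSlice_comul_right (a : A) (t : A ⊗[k] A) :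
    rightSlice (H.ε : A →ₗ[k] k) ((H.Δ a).right t) = rightSlice (H.ε : A →ₗ[k] k) t * a := by
  induction t using TensorProduct.induction_on with
  | zero => simp
  | add s₁ s₂ h₁ h₂ => simp only [map_add, add_mul, h₁, h₂]
  | tmul p q =>
    have h : ∀ s : A ⊗[k] A, rightSlice (H.ε : A →ₗ[k] k)
        (TensorProduct.map LinearMap.id (toMult q : Mult k A).left s) =
        H.ε q • rightSlice (H.ε : A →ₗ[k] k) s := fun s => by
      induction s using TensorProduct.induction_on with
      | zero => simp
      | add s₁ s₂ h₁ h₂ => simp only [map_add, smul_add, h₁, h₂]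
      | tmul c d => simp [mul_smul]
    refine (congrArg _ (galois₂_right (Δ := H.comul) H.nondegenerate H.T₂_spec a p q)).trans ?_
    rw [h, rightSlice_tmul]
    exact (congrArg _ (H.counit_right p a)).trans (smul_mul_assoc _ _ _).symm

/-- `(ι ⊗ ε)(Δ(a)t) = a (ι ⊗ ε)(t)` -/
theorem rightSlice_comul_left (a : A) (t : A ⊗[k] A) :
    rightSlice (H.ε : A →ₗ[k] k) ((H.Δ a).left t) = a * rightSlice (H.ε : A →ₗ[k] k) t := by
  have hn := nondegenerateHom_toMult_comp_of_surjective H.nondegenerateHom_toMult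
    (rightSlice_surjective (A := A) H.counit_ne_zero) (rightSlice_mul (A := A) H.ε)
  have := (hn.extendsTo_of_right H.nondegenerate (x := H.Δ a) (z := toMult a) fun t => by
    rw [LinearMap.comp_apply, rightSlice_comul_right, Mult.toMult_mul_toMult]
    rfl) t
  apply Mult.toMult_injective (k := k) H.nondegenerate
  rw [Mult.toMult_mul_toMult]
  exact this.1

end

namespace IsGroupLike

variable {H} {r : Mult k A} (hr : H.IsGroupLike r)

include hr

theorem comul_left (a : A) : H.Δ (r.left a) = tmul₂ r r * H.Δ a := (hr.2 a).1

theorem comul_right (a : A) : H.Δ (r.right a) = H.Δ a * tmul₂ r r := (hr.2 a).2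

theorem exists_left_ne_zero : ∃ a, r.left a ≠ 0 := by
  by_contra! h
  exact hr.1 (Mult.ext_left H.nondegenerate h)

theorem counit_left [Nontrivial A] (a : A) : H.ε (r.left a) = H.ε a := by
  obtain ⟨e, he⟩ := exists_eq_one H.counit_ne_zero
  have h₁ : ∀ a, H.ε (r.left a) = H.ε (r.right e) * H.ε a := fun a => by
    rw [← map_mul, Mult.right_mul_eq, map_mul, he, one_mul]
  have h₂ : ∀ t : A ⊗[k] A, leftSlice (H.ε : A →ₗ[k] k) ((tmul₂ r r).left t) =
      H.ε (r.right e) • r.left (leftSlice (H.ε : A →ₗ[k] k) t) := fun t => by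
    induction t using TensorProduct.induction_on with
    | zero => simp
    | add s₁ s₂ h₁ h₂ => simp only [map_add, smul_add, h₁, h₂]
    | tmul p q => simp [h₁, mul_smul]
  have h₃ : ∀ a b, r.left (a * b) = H.ε (r.right e) • r.left (a * b) := fun a b => by
    obtain ⟨t, rfl⟩ := leftSlice_surjective (B := A) H.counit_ne_zero b
    conv_lhs => rw [Mult.left_mul, ← leftSlice_comul_left, hr.comul_left, Mult.mul_left_apply, h₂,
      leftSlice_comul_left]
  have h₄ : r = H.ε (r.right e) • r := Mult.ext_left H.nondegenerate fun a =>
    H.nondegenerateHom_toMult.induction_left (P := fun a => r.left a = (H.ε (r.right e) • r).left a)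
      a h₃ (by simp) fun b c hb hc => by rw [map_add, map_add, hb, hc]
  have h₅ : (1 - H.ε (r.right e)) • r = 0 := by rw [sub_smul, one_smul, ← h₄, sub_self]
  rw [h₁, ← sub_eq_zero.1 ((smul_eq_zero.1 h₅).resolve_right hr.1), one_mul]

theorem counit_right [Nontrivial A] (a : A) : H.ε (r.right a) = H.ε a := by
  obtain ⟨e, he⟩ := exists_eq_one H.counit_ne_zero
  have : H.ε (r.right a * e) = H.ε (a * r.left e) := by rw [Mult.right_mul_eq]
  rwa [map_mul, map_mul, hr.counit_left, he, mul_one, mul_one] at this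

omit hr in
variable (H r) in
/-- `S(r)` -/
def antipode : Mult k A :=
  Mult.ofCompat H.nondegenerate (H.S.toLinearMap ∘ₗ r.right ∘ₗ H.S.symm.toLinearMap)
    (H.S.toLinearMap ∘ₗ r.left ∘ₗ H.S.symm.toLinearMap) fun a b => by
      obtain ⟨a, rfl⟩ := H.S.surjective a
      obtain ⟨b, rfl⟩ := H.S.surjective b
      simp [← H.S_mul, Mult.right_mul_eq]

omit hr in
theorem antipode_left (a : A) : H.S (r.left a) = (antipode H r).right (H.S a) := by
  simp [antipode, Mult.ofCompat]

omit hr in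
theorem antipode_right (a : A) : H.S (r.right a) = (antipode H r).left (H.S a) := by
  simp [antipode, Mult.ofCompat]

theorem T₂_left (b a : A) : H.T₂ (b ⊗ₜ r.left a) =
    TensorProduct.map LinearMap.id r.left (H.T₂ (r.right b ⊗ₜ a)) := by
  apply Mult.toMult_injective (k := k) H.nondegenerate_tensor
  have : TensorProduct.map LinearMap.id r.left (H.T₂ (r.right b ⊗ₜ[k] a)) =
      (tmul₂ 1 r).left (H.T₂ (r.right b ⊗ₜ[k] a)) := rfl
  rw [this, ← Mult.mul_toMult, H.T₂_spec, H.T₂_spec, hr.comul_left, ← mul_assoc, ← mul_assoc,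
    Mult.tmul_mul_tmul, Mult.tmul_mul_tmul, Mult.toMult_mul]
  simp

theorem T₃_left (a b : A) : H.T₃ (r.left a ⊗ₜ b) =
    TensorProduct.map r.left r.left (H.T₃ (a ⊗ₜ b)) := by
  apply Mult.toMult_injective (k := k) H.nondegenerate_tensor
  have : TensorProduct.map r.left r.left (H.T₃ (a ⊗ₜ b)) =
      (tmul₂ r r).left (H.T₃ (a ⊗ₜ b)) := rfl
  rw [this, ← Mult.mul_toMult, H.T₃_spec, H.T₃_spec, hr.comul_left, mul_assoc]

theorem mul_antipode : r * antipode H r = 1 := by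
  obtain ⟨a, ha⟩ := hr.exists_left_ne_zero
  refine Mult.ext_right H.nondegenerate fun b => sub_eq_zero.1 (eq_zero_of_tmul_eq_zero (k := k) ha ?_)
  have key : ∀ t : A ⊗[k] A, H.invT₂ (TensorProduct.map LinearMap.id r.left t) =
      TensorProduct.map (antipode H r).right r.left (H.invT₂ t) := fun t => by
    induction t using TensorProduct.induction_on with
    | zero => simp
    | add s₁ s₂ h₁ h₂ => simp only [map_add, h₁, h₂]
    | tmul c d =>
      rw [TensorProduct.map_tmul, invT₂_tmul, invT₂_tmul, hr.T₃_left, map_map_apply, map_map_apply]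
      congr 2
      exact LinearMap.ext fun x => antipode_left x
  rw [TensorProduct.sub_tmul, sub_eq_zero, ← H.invT₂_T₂ ((1 : Mult k A).right b ⊗ₜ r.left a),
    hr.T₂_left, key, H.invT₂_T₂]
  rfl

theorem antipode_mul : antipode H r * r = 1 := by
  obtain ⟨a, ha⟩ := hr.exists_left_ne_zero
  have : Nontrivial A := ⟨_, _, ha⟩
  have key : ∀ t : A ⊗[k] A, H.T₂ (TensorProduct.map (antipode H r).right r.left t) =
      TensorProduct.map LinearMap.id r.left
        (H.T₂ (TensorProduct.map (antipode H r * r).right LinearMap.id t)) := fun t => by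
    induction t using TensorProduct.induction_on with
    | zero => simp
    | add s₁ s₂ h₁ h₂ => simp only [map_add, h₁, h₂]
    | tmul c d => simp [hr.T₂_left]
  have key' : ∀ t : A ⊗[k] A, H.T₂ (TensorProduct.map (antipode H r).right r.left t) =
      TensorProduct.map LinearMap.id r.left (H.T₂ t) := fun t => by
    rw [← H.invT₂_T₂ t]
    generalize H.T₂ t = s
    simp only [invT₂, LinearMap.comp_apply]
    generalize (TensorProduct.comm k A A).toLinearMap _ = s
    induction s using TensorProduct.induction_on with
    | zero => simp
    | add s₁ s₂ h₁ h₂ => simp only [map_add, h₁, h₂]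
    | tmul c d =>
      have : TensorProduct.map (antipode H r).right r.left
          (TensorProduct.map H.S.toLinearMap LinearMap.id (H.T₃ (c ⊗ₜ d))) =
          TensorProduct.map H.S.toLinearMap LinearMap.id (H.T₃ (r.left c ⊗ₜ d)) := by
        rw [hr.T₃_left, map_map_apply, map_map_apply]
        congr 2
        exact LinearMap.ext fun x => (antipode_left x).symm
      rw [this, H.antipode₁, H.antipode₁]
      rfl
  refine Mult.ext_right H.nondegenerate fun c => sub_eq_zero.1 ?_
  set x := (antipode H r * r).right c - (1 : Mult k A).right c with hx
  have h₀ : ∀ d, TensorProduct.map LinearMap.id r.left (H.T₂ (x ⊗ₜ[k] d)) = 0 := fun d => by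
    have := (key (c ⊗ₜ d)).symm.trans (key' (c ⊗ₜ d))
    rw [hx, TensorProduct.sub_tmul, map_sub, map_sub, sub_eq_zero]
    exact this
  have h₁ : tmul₂ (toMult x) r = 0 := by
    refine H.nondegenerateHom_comul.mult_ext_left H.nondegenerate_tensor fun d => ?_
    have := congrArg (toMult (k := k)) (h₀ d)
    rw [map_zero] at this
    rw [zero_mul, ← this]
    have h₂ : TensorProduct.map LinearMap.id r.left (H.T₂ (x ⊗ₜ[k] d)) =
      (tmul₂ 1 r).left (H.T₂ (x ⊗ₜ[k] d)) := rfl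
    rw [h₂, ← Mult.mul_toMult, H.T₂_spec, ← mul_assoc, Mult.tmul_mul_tmul, one_mul, mul_one]
    rfl
  refine H.nondegenerate.1 _ fun p => eq_zero_of_tmul_eq_zero (k := k) ha ?_
  have := congrArg (fun z => Mult.left z (p ⊗ₜ[k] a)) h₁
  simpa using this

/-- `r` as a unit of `M(A)`. -/
def unit : (Mult k A)ˣ := ⟨r, antipode H r, hr.mul_antipode, hr.antipode_mul⟩

theorem inverse_eq : Ring.inverse r = antipode H r := Ring.inverse_unit hr.unit

theorem left_antipode_left (a : A) : r.left ((antipode H r).left a) = a := by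
  rw [← Mult.mul_left_apply, hr.mul_antipode, Mult.one_left]

theorem antipode_left_left (a : A) : (antipode H r).left (r.left a) = a := by
  rw [← Mult.mul_left_apply, hr.antipode_mul, Mult.one_left]

theorem antipode_right_right (a : A) : (antipode H r).right (r.right a) = a := by
  rw [← Mult.mul_right_apply, hr.mul_antipode, Mult.one_right]

theorem right_antipode_right (a : A) : r.right ((antipode H r).right a) = a := by
  rw [← Mult.mul_right_apply, hr.antipode_mul, Mult.one_right]

end IsGroupLike

end RegularMHC

end

end MHC

namespace MHC

noncomputable section

section Intertwine

set_option linter.unusedSectionVars false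

variable {k : Type*} [Field k]
variable {A : Type*} [NonUnitalRing A] [Module k A] [IsScalarTower k A A] [SMulCommClass k A A]
variable {B : Type*} [NonUnitalRing B] [Module k B] [IsScalarTower k B B] [SMulCommClass k B B]
variable {C : Type*} [NonUnitalRing C] [Module k C] [IsScalarTower k C C] [SMulCommClass k C C]
variable {D : Type*} [NonUnitalRing D] [Module k D] [IsScalarTower k D D] [SMulCommClass k D D]
variable {E : Type*} [NonUnitalRing E] [Module k E] [IsScalarTower k E E] [SMulCommClass k E E]

theorem intertwine_of_tmul {g : A ⊗[k] B →ₗ[k] Mult k (C ⊗[k] D)} {F : C ⊗[k] D →ₗ[k] Mult k E}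
    {G : A ⊗[k] B →ₗ[k] Mult k E}
    (h : ∀ (a : A) (b : B) c d, F ((g (a ⊗ₜ b)).left (c ⊗ₜ d)) = G (a ⊗ₜ b) * F (c ⊗ₜ d)) (s : A ⊗[k] B)
    (w : C ⊗[k] D) : F ((g s).left w) = G s * F w := by
  induction s using TensorProduct.induction_on with
  | zero => simp
  | add s₁ s₂ h₁ h₂ => simp only [map_add, Mult.add_left_apply, add_mul, h₁, h₂]
  | tmul a b =>
    induction w using TensorProduct.induction_on with
    | zero => simp
    | add s₁ s₂ h₁ h₂ => simp only [map_add, mul_add, h₁, h₂]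
    | tmul c d => exact h a b c d

theorem tensorMap_toMult_comp (f : A →ₗ[k] C) (g : B →ₗ[k] D) :
    tensorMap (toMult ∘ₗ f) (toMult ∘ₗ g) = toMult ∘ₗ TensorProduct.map f g :=
  TensorProduct.ext' fun _ _ => Mult.tmul_toMult _ _

theorem tensorMap_toMult_comp_left (f : A →ₗ[k] C) :
    tensorMap (toMult ∘ₗ f) (toMult : B →ₗ[k] Mult k B) =
      toMult ∘ₗ TensorProduct.map f LinearMap.id :=
  TensorProduct.ext' fun _ _ => Mult.tmul_toMult _ _

theorem map_map_mul {f : A →ₗ[k] C} {g : B →ₗ[k] D} (hf : ∀ a b, f (a * b) = f a * f b)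
    (hg : ∀ a b, g (a * b) = g a * g b) (s t : A ⊗[k] B) :
    TensorProduct.map f g (s * t) = TensorProduct.map f g s * TensorProduct.map f g t := by
  induction s using TensorProduct.induction_on with
  | zero => simp
  | add s₁ s₂ h₁ h₂ => simp only [map_add, add_mul, h₁, h₂]
  | tmul a b =>
    induction t using TensorProduct.induction_on with
    | zero => simp
    | add s₁ s₂ h₁ h₂ => simp only [map_add, mul_add, h₁, h₂]
    | tmul c d => simp [hf, hg]

theorem map_leibniz_left {T d : A →ₗ[k] A} (h : ∀ a b, d (a * b) = d a * b + T a * d b)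
    (s t : A ⊗[k] B) : TensorProduct.map d LinearMap.id (s * t) =
      TensorProduct.map d LinearMap.id s * t +
        TensorProduct.map T LinearMap.id s * TensorProduct.map d LinearMap.id t := by
  induction s using TensorProduct.induction_on with
  | zero => simp
  | add s₁ s₂ h₁ h₂ => simp only [map_add, add_mul, h₁, h₂]; abel
  | tmul a b =>
    induction t using TensorProduct.induction_on with
    | zero => simp
    | add s₁ s₂ h₁ h₂ => simp only [map_add, mul_add, h₁, h₂]; abel
    | tmul c d => simp [h, TensorProduct.add_tmul]

theorem map_leibniz_right {T d : B →ₗ[k] B} (h : ∀ a b, d (a * b) = d a * b + T a * d b)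
    (s t : A ⊗[k] B) : TensorProduct.map LinearMap.id d (s * t) =
      TensorProduct.map LinearMap.id d s * t +
        TensorProduct.map LinearMap.id T s * TensorProduct.map LinearMap.id d t := by
  induction s using TensorProduct.induction_on with
  | zero => simp
  | add s₁ s₂ h₁ h₂ => simp only [map_add, add_mul, h₁, h₂]; abel
  | tmul a b =>
    induction t using TensorProduct.induction_on with
    | zero => simp
    | add s₁ s₂ h₁ h₂ => simp only [map_add, mul_add, h₁, h₂]; abel
    | tmul c d => simp [h, TensorProduct.tmul_add]

end Intertwine

namespace RegularMHC

set_option linter.unusedSectionVars false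

variable {k : Type*} [Field k]
variable {A : Type*} [NonUnitalRing A] [Module k A] [IsScalarTower k A A] [SMulCommClass k A A]

/-- The relation `(y ⊗ 1 + r ⊗ y)Δ(a) = Δ(τ(a))(y ⊗ 1 + r ⊗ y) + Δ(δ(a))`, spelled out by comparing
the coefficients of `y ⊗ 1`, `1 ⊗ y` and `1` in its action on `A ⊗ A`. -/
structure OreCompatible (H : RegularMHC k A) {τ : A →ₙₐ[k] A} (δ : TwistedDerivation τ)
    (r : Mult k A) : Prop where
  twist_left : ∀ a t, TensorProduct.map (τ : A →ₗ[k] A) LinearMap.id ((H.Δ a).left t) =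
    (H.Δ (τ a)).left (TensorProduct.map (τ : A →ₗ[k] A) LinearMap.id t)
  twist_right : ∀ a t, TensorProduct.map r.left (τ : A →ₗ[k] A) ((H.Δ a).left t) =
    (H.Δ (τ a)).left (TensorProduct.map r.left (τ : A →ₗ[k] A) t)
  deriv : ∀ a t, TensorProduct.map δ.toLinearMap LinearMap.id ((H.Δ a).left t) +
      TensorProduct.map r.left δ.toLinearMap ((H.Δ a).left t) =
    (H.Δ (δ.toLinearMap a)).left t +
      (H.Δ (τ a)).left (TensorProduct.map δ.toLinearMap LinearMap.id t +
        TensorProduct.map r.left δ.toLinearMap t)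

variable {H : RegularMHC k A}

local notation "tmul₂" => Mult.tmul (k := k) (A := A) (B := A)

theorem characterCondition_iff [Nontrivial A] {τ : A →ₙₐ[k] A} {χ : A →ₙₐ[k] k} (hχ : χ ≠ 0) :
    H.CharacterCondition τ χ ↔ ∀ a t, leftSlice (χ : A →ₗ[k] k) ((H.Δ a).left t) =
      τ a * leftSlice (χ : A →ₗ[k] k) t := by
  have hF := NondegenerateHom.functional_tensor hχ H.nondegenerateHom_toMult
  constructor
  · intro h a t
    have := (h a t).1
    rw [functionalTensorMap_toMult, LinearMap.comp_apply, LinearMap.comp_apply,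
      ← Mult.toMult_mul_toMult] at this
    exact Mult.toMult_injective H.nondegenerate this
  · intro h a
    refine hF.extendsTo_of_left H.nondegenerate fun t => ?_
    rw [functionalTensorMap_toMult, LinearMap.comp_apply, LinearMap.comp_apply,
      ← Mult.toMult_mul_toMult, h]

namespace IsGroupLike

variable {r : Mult k A} (hr : H.IsGroupLike r)

variable (H r) in
/-- `Ad_r` as a map `A → A` -/
def ad : A →ₗ[k] A := r.left ∘ₗ (antipode H r).right

include hr

theorem right_ad (a : A) : r.right (ad H r a) = r.left a := by
  rw [ad, LinearMap.comp_apply, ← Mult.left_right_comm H.nondegenerate, hr.right_antipode_right]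

theorem adMap_eq : adMap r = toMult ∘ₗ ad H r := LinearMap.ext fun a => by
  change r * toMult a * Ring.inverse r = _
  rw [hr.inverse_eq, Mult.mul_toMult, Mult.toMult_mul, ← Mult.left_right_comm H.nondegenerate]
  rfl

theorem ad_mul (a b : A) : ad H r (a * b) = ad H r a * ad H r b := by
  change r.left ((antipode H r).right (a * b)) = ad H r a * r.left ((antipode H r).right b)
  rw [← Mult.right_mul_eq, hr.right_ad, Mult.right_mul, Mult.left_mul]

theorem ad_surjective : Function.Surjective (ad H r) := fun a =>
  ⟨(antipode H r).left (r.right a), by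
    rw [ad, LinearMap.comp_apply, ← Mult.left_right_comm H.nondegenerate, hr.antipode_right_right,
      hr.left_antipode_left]⟩

theorem map_left_eq (f : A →ₗ[k] A) (t : A ⊗[k] A) : TensorProduct.map r.left f t =
    (tmul₂ r 1).right (TensorProduct.map (ad H r) f t) := by
  rw [Mult.tmul_right, map_map_apply]
  congr 2
  exact LinearMap.ext fun a => (hr.right_ad a).symm

theorem map_left_eq' (f : A →ₗ[k] A) (t : A ⊗[k] A) : TensorProduct.map r.left f t =
    (tmul₂ r 1).left (TensorProduct.map LinearMap.id f t) := by
  rw [Mult.tmul_left, map_map_apply]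
  rfl

theorem tmul_antipode_left_left (t : A ⊗[k] A) :
    (tmul₂ (antipode H r) (1 : Mult k A)).left ((tmul₂ r 1).left t) = t := by
  rw [← Mult.mul_left_apply, Mult.tmul_mul_tmul, hr.antipode_mul, mul_one, Mult.tmul_one_one,
    Mult.one_left]

theorem tmul_left_antipode_left (t : A ⊗[k] A) :
    (tmul₂ r (1 : Mult k A)).left ((tmul₂ (antipode H r) 1).left t) = t := by
  rw [← Mult.mul_left_apply, Mult.tmul_mul_tmul, hr.mul_antipode, mul_one, Mult.tmul_one_one,
    Mult.one_left]

theorem tmul_antipode_right_right (t : A ⊗[k] A) :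
    (tmul₂ (antipode H r) (1 : Mult k A)).right ((tmul₂ r 1).right t) = t := by
  rw [← Mult.mul_right_apply, Mult.tmul_mul_tmul, hr.mul_antipode, mul_one, Mult.tmul_one_one,
    Mult.one_right]

theorem twist_right_iff {τ : A →ₙₐ[k] A} (a : A) :
    (∀ t, TensorProduct.map r.left (τ : A →ₗ[k] A) ((H.Δ a).left t) =
      (H.Δ (τ a)).left (TensorProduct.map r.left (τ : A →ₗ[k] A) t)) ↔
    ∀ t, TensorProduct.map (ad H r) (τ : A →ₗ[k] A) ((H.Δ a).left t) =
      (H.Δ (τ a)).left (TensorProduct.map (ad H r) (τ : A →ₗ[k] A) t) := by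
  refine forall_congr' fun t => ?_
  rw [hr.map_left_eq, hr.map_left_eq, Mult.left_right_comm H.nondegenerate_tensor]
  refine ⟨fun h => ?_, fun h => by rw [h]⟩
  have := congrArg (tmul₂ (antipode H r) (1 : Mult k A)).right h
  rwa [hr.tmul_antipode_right_right, hr.tmul_antipode_right_right] at this

variable [Nontrivial A] {τ : A →ₙₐ[k] A} {δ : TwistedDerivation τ} {χ : A →ₙₐ[k] k}

theorem nondegenerateHom_adMap : NondegenerateHom (adMap r) := by
  rw [hr.adMap_eq]
  exact nondegenerateHom_toMult_comp_of_surjective H.nondegenerateHom_toMult hr.ad_surjective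
    hr.ad_mul

theorem adCondition_iff (hχ : χ ≠ 0) (h : H.CharacterCondition τ χ) :
    H.AdCondition χ r ↔
      (∀ a t, TensorProduct.map (τ : A →ₗ[k] A) LinearMap.id ((H.Δ a).left t) =
        (H.Δ (τ a)).left (TensorProduct.map (τ : A →ₗ[k] A) LinearMap.id t)) ∧
      ∀ a t, TensorProduct.map r.left (τ : A →ₗ[k] A) ((H.Δ a).left t) =
        (H.Δ (τ a)).left (TensorProduct.map r.left (τ : A →ₗ[k] A) t) := by
  have hA := H.nondegenerate
  have hAA := H.nondegenerate_tensor
  rw [characterCondition_iff hχ] at h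
  have g₁ := H.nondegenerateHom_toMult.tensor H.nondegenerateHom_comul
  have g₂ := H.nondegenerateHom_comul.tensor H.nondegenerateHom_toMult
  have hF := NondegenerateHom.functional_tensor hχ H.nondegenerateHom_toMult
  have F₁ := NondegenerateHom.functional_tensor hχ H.nondegenerateHom_toMult_tensor
  have F₂ := hr.nondegenerateHom_adMap.tensor hF
  have F₃ := hF.tensor H.nondegenerateHom_toMult
  have i₁ := intertwine_of_tmul (g := tensorMap toMult H.comul)
    (F := functionalTensorMap (χ : A →ₗ[k] k) (toMult : A ⊗[k] A →ₗ[k] _))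
    (G := H.comul ∘ₗ leftSlice (χ : A →ₗ[k] k)) fun a b c d => by
      simp [comul, mul_smul, smul_comm (χ a), Mult.mul_toMult]
  have i₂ := intertwine_of_tmul (g := tensorMap toMult H.comul)
    (F := tensorMap (adMap r) (functionalTensorMap (χ : A →ₗ[k] k) (toMult : A →ₗ[k] _)))
    (G := toMult ∘ₗ TensorProduct.map (ad H r) (τ : A →ₗ[k] A)) fun a b c d => by
      rw [hr.adMap_eq, functionalTensorMap_toMult, tensorMap_toMult_comp, tensorMap_tmul,
        Mult.tmul_left, TensorProduct.map_tmul, LinearMap.comp_apply, LinearMap.comp_apply,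
        LinearMap.comp_apply, TensorProduct.map_tmul, TensorProduct.map_tmul, TensorProduct.map_tmul,
        ← Mult.toMult_mul_toMult, Mult.toMult_left, hr.ad_mul, Algebra.TensorProduct.tmul_mul_tmul]
      congr 2
      exact h _ _
  have i₃ := intertwine_of_tmul (g := tensorMap H.comul (toMult : A →ₗ[k] Mult k A))
    (F := tensorMap (functionalTensorMap (χ : A →ₗ[k] k) (toMult : A →ₗ[k] Mult k A))
      (toMult : A →ₗ[k] Mult k A))
    (G := toMult ∘ₗ TensorProduct.map (τ : A →ₗ[k] A) LinearMap.id) fun a b c d => by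
      rw [functionalTensorMap_toMult, tensorMap_toMult_comp_left, tensorMap_tmul,
        Mult.tmul_left, TensorProduct.map_tmul, LinearMap.comp_apply, LinearMap.comp_apply,
        LinearMap.comp_apply, TensorProduct.map_tmul, TensorProduct.map_tmul, TensorProduct.map_tmul,
        ← Mult.toMult_mul_toMult, Mult.toMult_left, Algebra.TensorProduct.tmul_mul_tmul]
      congr 2
      exact h _ _
  have eq_iff : ∀ (f : A ⊗[k] A →ₗ[k] A ⊗[k] A) a, (∀ s, (toMult ∘ₗ f) ((H.Δ a).left s) =
      H.Δ (τ a) * (toMult ∘ₗ f) s) ↔ ∀ s, f ((H.Δ a).left s) = (H.Δ (τ a)).left (f s) :=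
    fun f a => forall_congr' fun s => by
      rw [LinearMap.comp_apply, LinearMap.comp_apply, Mult.mul_toMult]
      exact (Mult.toMult_injective (k := k) hAA).eq_iff
  have i₁' : ∀ a s, (H.comul ∘ₗ leftSlice (χ : A →ₗ[k] k)) ((H.Δ a).left s) =
      H.Δ (τ a) * (H.comul ∘ₗ leftSlice (χ : A →ₗ[k] k)) s := fun a s => by
    rw [LinearMap.comp_apply, h]
    exact map_mul H.Δ _ _
  simp only [hr.twist_right_iff]
  rw [← forall_and]
  refine forall_congr' fun a => ?_
  constructor
  · rintro ⟨u, v, z, hu, hv, h₁, h₂, h₃⟩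
    have e₁ := (map_left_iff_of_intertwine g₁ F₁ hAA i₁ hu z).1 fun w => (h₁ w).1
    have e₂ := (map_left_iff_of_intertwine g₁ F₂ hAA i₂ hu z).1 fun w => (h₂ w).1
    have e₃ := (map_left_iff_of_intertwine g₂ F₃ hAA i₃ hv z).1 fun w => (h₃ w).1
    have hz : z = H.Δ (τ a) := by
      refine H.nondegenerateHom_comul.mult_ext_left hAA fun b => ?_
      obtain ⟨s, rfl⟩ := leftSlice_surjective hχ b
      exact (e₁ s).symm.trans (i₁' a s)
    subst hz
    exact ⟨(eq_iff _ a).1 e₃, (eq_iff _ a).1 e₂⟩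
  · rintro ⟨h₁, h₂⟩
    obtain ⟨u, hu⟩ := g₁.exists_extension (H.nondegenerate.tensor k hAA) (H.Δ a)
    obtain ⟨v, hv⟩ := g₂.exists_extension (hAA.tensor k H.nondegenerate) (H.Δ a)
    exact ⟨u, v, H.Δ (τ a), hu, hv,
      F₁.extendsTo_of_left hAA ((map_left_iff_of_intertwine g₁ F₁ hAA i₁ hu _).2 (i₁' a)),
      F₂.extendsTo_of_left hAA ((map_left_iff_of_intertwine g₁ F₂ hAA i₂ hu _).2 ((eq_iff _ a).2 h₂)),
      F₃.extendsTo_of_left hAA ((map_left_iff_of_intertwine g₂ F₃ hAA i₃ hv _).2 ((eq_iff _ a).2 h₁))⟩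

set_option maxHeartbeats 1000000 in
theorem derivationCondition_iff (hτ : Function.Surjective τ)
    (h₁ : ∀ a t, TensorProduct.map (τ : A →ₗ[k] A) LinearMap.id ((H.Δ a).left t) =
        (H.Δ (τ a)).left (TensorProduct.map (τ : A →ₗ[k] A) LinearMap.id t))
    (h₂ : ∀ a t, TensorProduct.map r.left (τ : A →ₗ[k] A) ((H.Δ a).left t) =
        (H.Δ (τ a)).left (TensorProduct.map r.left (τ : A →ₗ[k] A) t)) :
    H.DerivationCondition δ r ↔ ∀ a t,
      TensorProduct.map δ.toLinearMap LinearMap.id ((H.Δ a).left t) +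
        TensorProduct.map r.left δ.toLinearMap ((H.Δ a).left t) =
      (H.Δ (δ.toLinearMap a)).left t +
        (H.Δ (τ a)).left (TensorProduct.map δ.toLinearMap LinearMap.id t +
          TensorProduct.map r.left δ.toLinearMap t) := by
  have hAA := H.nondegenerate_tensor
  have hT₁s : Function.Surjective
      (TensorProduct.map (τ : A →ₗ[k] A) (LinearMap.id : A →ₗ[k] A)) :=
    TensorProduct.map_surjective hτ Function.surjective_id
  have hT₂s : Function.Surjective
      (TensorProduct.map (LinearMap.id : A →ₗ[k] A) (τ : A →ₗ[k] A)) :=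
    TensorProduct.map_surjective Function.surjective_id hτ
  have hT₁m := map_map_mul (f := (τ : A →ₗ[k] A)) (g := (LinearMap.id : A →ₗ[k] A))
    (map_mul τ) fun _ _ => rfl
  have hT₂m := map_map_mul (f := (LinearMap.id : A →ₗ[k] A)) (g := (τ : A →ₗ[k] A))
    (fun _ _ => rfl) (map_mul τ)
  have hT₁ := nondegenerateHom_toMult_comp_of_surjective H.nondegenerateHom_toMult_tensor hT₁s hT₁m
  have hT₂ := nondegenerateHom_toMult_comp_of_surjective H.nondegenerateHom_toMult_tensor hT₂s hT₂m
  have hd₁ := map_leibniz_left (B := A) (T := (τ : A →ₗ[k] A)) δ.leibniz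
  have hd₂ := map_leibniz_right (A := A) (T := (τ : A →ₗ[k] A)) δ.leibniz
  have hw₂ : ∀ a t, TensorProduct.map LinearMap.id (τ : A →ₗ[k] A) ((H.Δ a).left t) =
      (tmul₂ (antipode H r) 1 * H.Δ (τ a) * tmul₂ r 1).left
        (TensorProduct.map LinearMap.id (τ : A →ₗ[k] A) t) := fun a t => by
    have := congrArg (tmul₂ (antipode H r) 1).left (h₂ a t)
    rw [hr.map_left_eq', hr.map_left_eq', hr.tmul_antipode_left_left] at this
    exact this
  refine forall_congr' fun a => ?_
  constructor
  · rintro ⟨u, v, hu, hv, huv⟩ t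
    rw [derivationExtendsTo_iff hAA hT₁ hd₁ (h₁ a)] at hu
    rw [derivationExtendsTo_iff hAA hT₂ hd₂ (hw₂ a)] at hv
    rw [huv, hr.map_left_eq', hr.map_left_eq', hu, hv, map_add, map_add, Mult.mul_left_apply,
      Mult.mul_left_apply, hr.tmul_left_antipode_left, Mult.add_left_apply, Mult.mul_left_apply]
    abel
  · intro h
    obtain ⟨u, hu⟩ : ∃ u : Mult k (A ⊗[k] A), ∀ t,
        TensorProduct.map δ.toLinearMap LinearMap.id ((H.Δ a).left t) =
          u.left t + (H.Δ (τ a)).left (TensorProduct.map δ.toLinearMap LinearMap.id t) :=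
      exists_derivation_extension hAA hT₁s hT₁m hd₁ (h₁ a)
    refine ⟨u, tmul₂ (antipode H r) (1 : Mult k A) * (H.Δ (δ.toLinearMap a) - u), ?_, ?_, ?_⟩
    · exact (derivationExtendsTo_iff hAA hT₁ hd₁ (h₁ a)).2 hu
    · refine (derivationExtendsTo_iff hAA hT₂ hd₂ (hw₂ a)).2 fun t => ?_
      have := h t
      rw [hr.map_left_eq', hr.map_left_eq', hu, map_add] at this
      rw [← hr.tmul_antipode_left_left (TensorProduct.map LinearMap.id δ.toLinearMap
        ((H.Δ a).left t)), eq_sub_of_add_eq' this, Mult.mul_left_apply, Mult.mul_left_apply,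
        Mult.mul_left_apply]
      refine (congrArg _ ?_).trans (map_add _ _ _)
      rw [Mult.sub_left_apply]
      abel
    · rw [← mul_assoc, Mult.tmul_mul_tmul, hr.mul_antipode, mul_one, Mult.tmul_one_one, one_mul]
      exact (add_sub_cancel u (H.Δ _)).symm

theorem conditions_iff (hτ : Function.Surjective τ) :
    ((∃ χ : A →ₙₐ[k] k, χ ≠ 0 ∧ H.CharacterCondition τ χ ∧ H.AdCondition χ r) ∧
        H.DerivationCondition δ r) ↔ H.OreCompatible δ r := by
  constructor
  · rintro ⟨⟨χ, hχ, h, had⟩, hd⟩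
    obtain ⟨h₁, h₂⟩ := (hr.adCondition_iff hχ h).1 had
    exact ⟨h₁, h₂, (hr.derivationCondition_iff hτ h₁ h₂).1 hd⟩
  · rintro ⟨h₁, h₂, h₃⟩
    have hχ : H.ε.comp τ ≠ 0 := fun h => H.counit_ne_zero <| NonUnitalAlgHom.ext fun a => by
      obtain ⟨b, rfl⟩ := hτ a
      exact NonUnitalAlgHom.congr_fun h b
    have e : ∀ t : A ⊗[k] A, leftSlice (H.ε.comp τ : A →ₗ[k] k) t =
        leftSlice (H.ε : A →ₗ[k] k) (TensorProduct.map (τ : A →ₗ[k] A) LinearMap.id t) := fun t => by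
      rw [leftSlice, leftSlice, LinearMap.comp_apply, LinearMap.comp_apply, map_map_apply]
      rfl
    have h : H.CharacterCondition τ (H.ε.comp τ) := (characterCondition_iff hχ).2 fun a t => by
      rw [e, e, h₁, leftSlice_comul_left]
    exact ⟨⟨_, hχ, h, (hr.adCondition_iff hχ h).2 ⟨h₁, h₂⟩⟩,
      (hr.derivationCondition_iff hτ h₁ h₂).2 h₃⟩

end IsGroupLike

end RegularMHC

end

end MHC

namespace MHC

noncomputable section

namespace RegularMHC

set_option linter.unusedSectionVars false

variable {k : Type*} [Field k]
variable {A : Type*} [NonUnitalRing A] [Module k A] [IsScalarTower k A A] [SMulCommClass k A A]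
variable (H : RegularMHC k A)

local notation "tmul₂" => Mult.tmul (k := k) (A := A) (B := A)

theorem T₁_mul (a b : A) (t : A ⊗[k] A) : H.T₁ (a ⊗ₜ b) * t =
    (H.Δ a).left (TensorProduct.map LinearMap.id (toMult b : Mult k A).left t) := by
  rw [← Mult.toMult_left (k := k), H.T₁_spec]
  rfl

theorem T₂_mul (a b : A) (t : A ⊗[k] A) : H.T₂ (a ⊗ₜ b) * t =
    TensorProduct.map (toMult a : Mult k A).left LinearMap.id ((H.Δ b).left t) := by
  rw [← Mult.toMult_left (k := k), H.T₂_spec]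
  rfl

theorem T₃_mul (a b : A) (t : A ⊗[k] A) : H.T₃ (a ⊗ₜ b) * t =
    (H.Δ a).left (TensorProduct.map (toMult b : Mult k A).left LinearMap.id t) := by
  rw [← Mult.toMult_left (k := k), H.T₃_spec]
  rfl

theorem T₂_map_right (q : A) (t : A ⊗[k] A) :
    H.T₂ (TensorProduct.map LinearMap.id (toMult q : Mult k A).right t) =
      (H.Δ q).right (H.T₂ t) := by
  induction t using TensorProduct.induction_on with
  | zero => simp
  | add s₁ s₂ h₁ h₂ => simp only [map_add, h₁, h₂]
  | tmul a b =>
    apply Mult.toMult_injective (k := k) H.nondegenerate_tensor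
    rw [TensorProduct.map_tmul, LinearMap.id_apply, H.T₂_spec, Mult.toMult_right, map_mul,
      ← mul_assoc, ← H.T₂_spec, Mult.toMult_mul]

theorem leftSlice_map_toMult_left (χ : A →ₙₐ[k] k) (a : A) (t : A ⊗[k] A) :
    leftSlice (χ : A →ₗ[k] k) (TensorProduct.map (toMult a : Mult k A).left LinearMap.id t) =
      χ a • leftSlice (χ : A →ₗ[k] k) t := by
  induction t using TensorProduct.induction_on with
  | zero => simp
  | add s₁ s₂ h₁ h₂ => simp only [map_add, smul_add, h₁, h₂]
  | tmul p q => simp [mul_smul]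

theorem rightSlice_map_left (χ : A →ₗ[k] k) (f : A →ₗ[k] A) (t : A ⊗[k] A) :
    rightSlice χ (TensorProduct.map f LinearMap.id t) = f (rightSlice χ t) := by
  induction t using TensorProduct.induction_on with
  | zero => simp
  | add s₁ s₂ h₁ h₂ => simp only [map_add, h₁, h₂]
  | tmul p q => simp

section

variable [Nontrivial A]

theorem leftSlice_T₂ (b a : A) : leftSlice (H.ε : A →ₗ[k] k) (H.T₂ (b ⊗ₜ a)) = H.ε b • a := by
  refine sub_eq_zero.1 (H.nondegenerate.1 _ fun c => ?_)
  obtain ⟨s, rfl⟩ := leftSlice_surjective (B := A) H.counit_ne_zero c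
  rw [sub_mul, ← leftSlice_mul, T₂_mul, leftSlice_map_toMult_left, leftSlice_comul_left,
    smul_mul_assoc, sub_self]

theorem rightSlice_T₃ (a b : A) : rightSlice (H.ε : A →ₗ[k] k) (H.T₃ (a ⊗ₜ b)) = a * b := by
  refine sub_eq_zero.1 (H.nondegenerate.1 _ fun c => ?_)
  obtain ⟨s, rfl⟩ := rightSlice_surjective (A := A) H.counit_ne_zero c
  rw [sub_mul, ← rightSlice_mul, T₃_mul, rightSlice_comul_left, rightSlice_map_left,
    Mult.toMult_left, mul_assoc, sub_self]

theorem rightSlice_invT₂_tmul (c d : A) :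
    rightSlice (H.ε : A →ₗ[k] k) (H.invT₂ (c ⊗ₜ d)) = c * H.S d := by
  rw [invT₂_tmul, rightSlice_map_left, rightSlice_T₃]
  change H.S _ = _
  rw [H.S_mul, LinearEquiv.apply_symm_apply]

end

/-- `ψ(p) q₁ ⊗ q₂` -/
def cover (ψ : A →ₗ[k] A) : A ⊗[k] A →ₗ[k] A ⊗[k] A :=
  H.T₂ ∘ₗ TensorProduct.map ψ LinearMap.id

theorem cover_tmul_mul (ψ : A →ₗ[k] A) (p q : A) (t : A ⊗[k] A) : H.cover ψ (p ⊗ₜ q) * t =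
    TensorProduct.map (toMult (ψ p) : Mult k A).left LinearMap.id ((H.Δ q).left t) := by
  rw [cover, LinearMap.comp_apply, TensorProduct.map_tmul, LinearMap.id_apply, T₂_mul]

theorem cover_map_left (ψ φ : A →ₗ[k] A) (t : A ⊗[k] A) :
    H.cover ψ (TensorProduct.map φ LinearMap.id t) = H.cover (ψ ∘ₗ φ) t := by
  rw [cover, cover, LinearMap.comp_apply, map_map_apply]
  rfl

theorem cover_comp_toMult_left (ψ : A →ₗ[k] A) (p : A) (t : A ⊗[k] A) :
    H.cover ((toMult p : Mult k A).left ∘ₗ ψ) t =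
      TensorProduct.map (toMult p : Mult k A).left LinearMap.id (H.cover ψ t) := by
  rw [cover, cover, LinearMap.comp_apply, LinearMap.comp_apply,
    ← galois₂_map_left (Δ := H.comul) H.nondegenerate H.T₂_spec, map_map_apply]
  rfl

/-- `(x ⊗ 1) T₄(a ⊗ q) = (1 ⊗ a) T₂(x ⊗ q)` -/
theorem map_T₄ (x a q : A) :
    TensorProduct.map (toMult x : Mult k A).left LinearMap.id (H.T₄ (a ⊗ₜ q)) =
      TensorProduct.map LinearMap.id (toMult a : Mult k A).left (H.T₂ (x ⊗ₜ q)) :=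
  (galois₄_right (Δ := H.comul) H.nondegenerate H.T₄_spec q x a).symm.trans
    (galois₂_right (Δ := H.comul) H.nondegenerate H.T₂_spec q x a)

/-- `S(a₁ p) a₂₁ q₁ ⊗ a₂₂ q₂ = S(p) q₁ ⊗ a q₂` -/
theorem cover_antipode_comul (a : A) (t : A ⊗[k] A) :
    H.cover H.S.toLinearMap ((H.Δ a).left t) =
      TensorProduct.map LinearMap.id (toMult a : Mult k A).left (H.cover H.S.toLinearMap t) := by
  induction t using TensorProduct.induction_on with
  | zero => simp
  | add s₁ s₂ h₁ h₂ => simp only [map_add, h₁, h₂]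
  | tmul p q =>
    have h₁ : (H.Δ a).left (p ⊗ₜ q) =
        TensorProduct.map LinearMap.id (toMult q : Mult k A).right (H.T₃ (a ⊗ₜ[k] p)) :=
      galois₃_left (Δ := H.comul) H.nondegenerate H.T₃_spec a p q
    have h₂ : (H.Δ q).right (H.S p ⊗ₜ a) = TensorProduct.map LinearMap.id
        (toMult a : Mult k A).left (H.T₂ (H.S p ⊗ₜ[k] q)) :=
      galois₂_right (Δ := H.comul) H.nondegenerate H.T₂_spec q (H.S p) a
    have h₃ : TensorProduct.map H.S.toLinearMap LinearMap.id
        (TensorProduct.map LinearMap.id (toMult q : Mult k A).right (H.T₃ (a ⊗ₜ[k] p))) =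
        TensorProduct.map LinearMap.id (toMult q : Mult k A).right
          (TensorProduct.map H.S.toLinearMap LinearMap.id (H.T₃ (a ⊗ₜ[k] p))) := by
      rw [map_map_apply, map_map_apply]
      rfl
    rw [cover, LinearMap.comp_apply, LinearMap.comp_apply, h₁, h₃, T₂_map_right, H.antipode₁, h₂]
    rfl

theorem cover_antipode_T₁ (a q : A) :
    H.cover H.S.toLinearMap (H.T₁ (a ⊗ₜ q)) = H.T₄ (a ⊗ₜ q) := by
  refine sub_eq_zero.1 (eq_zero_of_map_left_eq_zero
    (fun p => (toMult (H.S p) : Mult k A).left) (fun x hx => H.nondegenerate.2 x fun b => ?_) _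
    fun p => ?_)
  · simpa using hx (H.S.symm b)
  · rw [map_sub, sub_eq_zero, map_T₄]
    have h₁ : (H.Δ a).left (p ⊗ₜ q) =
        TensorProduct.map (toMult p : Mult k A).right LinearMap.id (H.T₁ (a ⊗ₜ[k] q)) :=
      galois₁_left (Δ := H.comul) H.nondegenerate H.T₁_spec a p q
    have h₂ := H.cover_antipode_comul a (p ⊗ₜ q)
    rw [h₁, cover_map_left] at h₂
    have h₃ : H.S.toLinearMap ∘ₗ (toMult p : Mult k A).right =
        (toMult (H.S p) : Mult k A).left ∘ₗ H.S.toLinearMap :=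
      LinearMap.ext fun x => H.S_mul x p
    rw [h₃, cover_comp_toMult_left] at h₂
    exact h₂

namespace OreCompatible

variable {H} {r : Mult k A} {τ : A →ₙₐ[k] A} {δ : TwistedDerivation τ}
  (hc : H.OreCompatible δ r)

include hc

theorem map_T₁ (hτ : Function.Surjective τ) (a q : A) :
    TensorProduct.map (τ : A →ₗ[k] A) LinearMap.id (H.T₁ (a ⊗ₜ q)) = H.T₁ (τ a ⊗ₜ q) := by
  refine sub_eq_zero.1 (H.nondegenerate_tensor.1 _ fun t => ?_)
  obtain ⟨t, rfl⟩ := TensorProduct.map_surjective (g := (τ : A →ₗ[k] A))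
    (g' := (LinearMap.id : A →ₗ[k] A)) hτ Function.surjective_id t
  rw [sub_mul, ← map_map_mul (map_mul τ) fun _ _ => rfl, T₁_mul, T₁_mul, hc.twist_left,
    map_map_apply, map_map_apply]
  exact sub_self _

theorem map_T₂ (hτ : Function.Surjective τ) (a q : A) :
    TensorProduct.map (τ : A →ₗ[k] A) LinearMap.id (H.T₂ (a ⊗ₜ q)) = H.T₂ (τ a ⊗ₜ τ q) := by
  refine sub_eq_zero.1 (H.nondegenerate_tensor.1 _ fun t => ?_)
  obtain ⟨t, rfl⟩ := TensorProduct.map_surjective (g := (τ : A →ₗ[k] A))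
    (g' := (LinearMap.id : A →ₗ[k] A)) hτ Function.surjective_id t
  have : (τ : A →ₗ[k] A) ∘ₗ (toMult a : Mult k A).left =
      (toMult (τ a) : Mult k A).left ∘ₗ (τ : A →ₗ[k] A) := LinearMap.ext fun x => map_mul τ a x
  rw [sub_mul, ← map_map_mul (map_mul τ) fun _ _ => rfl, T₂_mul, T₂_mul, ← hc.twist_left,
    map_map_apply, map_map_apply, this]
  exact sub_self _

variable [Nontrivial A]

theorem counit_deriv (hr : H.IsGroupLike r) (a : A) : H.ε (δ.toLinearMap a) = 0 := by
  have h₁ : ∀ t, leftSlice (H.ε : A →ₗ[k] k) (TensorProduct.map r.left δ.toLinearMap t) =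
      δ.toLinearMap (leftSlice (H.ε : A →ₗ[k] k) t) := fun t => by
    induction t using TensorProduct.induction_on with
    | zero => simp
    | add s₁ s₂ h₁ h₂ => simp only [map_add, h₁, h₂]
    | tmul p q => simp [hr.counit_left]
  have h₂ : ∀ t : A ⊗[k] A, H.ε (leftSlice (H.ε : A →ₗ[k] k)
      (TensorProduct.map δ.toLinearMap LinearMap.id t)) =
      H.ε (δ.toLinearMap (rightSlice (H.ε : A →ₗ[k] k) t)) := fun t => by
    induction t using TensorProduct.induction_on with
    | zero => simp
    | add s₁ s₂ h₁ h₂ => simp only [map_add, h₁, h₂]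
    | tmul p q => simp [mul_comm]
  obtain ⟨e, he⟩ := exists_eq_one H.counit_ne_zero
  obtain ⟨t, rfl⟩ := rightSlice_surjective (A := A) H.counit_ne_zero e
  have h₃ := congrArg H.ε (congrArg (leftSlice (H.ε : A →ₗ[k] k)) (hc.deriv a t))
  simp only [map_add, h₁, leftSlice_comul_left, δ.leibniz, h₂, rightSlice_comul_left, map_mul,
    he, mul_one] at h₃
  linear_combination h₃

theorem counit_twist_antipode_twist (hτ : Function.Surjective τ) (a : A) :
    H.ε (τ (H.S (τ a))) = H.ε a := by
  have h₁ : ∀ t, H.ε (τ (rightSlice (H.ε : A →ₗ[k] k) (H.invT₂ t))) =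
      H.ε (τ (H.S (leftSlice (H.ε : A →ₗ[k] k)
        (TensorProduct.map (τ : A →ₗ[k] A) LinearMap.id t)))) := fun t => by
    induction t using TensorProduct.induction_on with
    | zero => simp
    | add s₁ s₂ h₁ h₂ => simp only [map_add, h₁, h₂]
    | tmul p q => simp [rightSlice_invT₂_tmul]
  obtain ⟨e, he⟩ := exists_eq_one H.counit_ne_zero
  obtain ⟨b, rfl⟩ := hτ e
  have := h₁ (H.T₂ (b ⊗ₜ a))
  rw [invT₂_T₂, hc.map_T₂ hτ, leftSlice_T₂] at this
  simpa [he] using this.symm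

theorem twist_antipode_twist (hr : H.IsGroupLike r) (hτ : Function.Surjective τ) (a : A) :
    τ (H.S (τ a)) = IsGroupLike.ad H r (H.S a) := by
  have hS : ∀ p, H.S (IsGroupLike.ad H r p) = IsGroupLike.ad H r (H.S p) := fun p => by
    have h₁ : H.S ((IsGroupLike.antipode H r).right p) = r.left (H.S p) := by
      conv_rhs => rw [← hr.right_antipode_right p, IsGroupLike.antipode_right,
        hr.left_antipode_left]
    rw [IsGroupLike.ad, LinearMap.comp_apply, IsGroupLike.antipode_left, h₁,
      ← Mult.left_right_comm H.nondegenerate]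
    rfl
  have hw := (hr.twist_right_iff a).1 (hc.twist_right a)
  have hn := nondegenerateHom_toMult_comp_of_surjective H.nondegenerateHom_toMult_tensor
    (f := TensorProduct.map (IsGroupLike.ad H r) (τ : A →ₗ[k] A))
    (TensorProduct.map_surjective hr.ad_surjective hτ) (map_map_mul hr.ad_mul (map_mul τ))
  have hw' : ∀ t, TensorProduct.map (IsGroupLike.ad H r) (τ : A →ₗ[k] A) ((H.Δ a).right t) =
      (H.Δ (τ a)).right (TensorProduct.map (IsGroupLike.ad H r) (τ : A →ₗ[k] A) t) := fun t =>
    Mult.toMult_injective (k := k) H.nondegenerate_tensor <| by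
      rw [← Mult.toMult_mul]
      exact (hn.extendsTo_of_left H.nondegenerate_tensor (x := H.Δ a) (z := H.Δ (τ a))
        (fun t => by rw [LinearMap.comp_apply, hw, LinearMap.comp_apply, Mult.mul_toMult]) t).2
  have hf : ∀ x t, τ x * leftSlice (H.ε : A →ₗ[k] k)
      (TensorProduct.map (τ : A →ₗ[k] A) LinearMap.id t) =
      leftSlice (H.ε : A →ₗ[k] k)
        (TensorProduct.map (τ : A →ₗ[k] A) LinearMap.id ((H.Δ x).left t)) := fun x t => by
    rw [hc.twist_left, leftSlice_comul_left]
  have hσ : ∀ t, leftSlice (H.ε : A →ₗ[k] k) (TensorProduct.map (τ : A →ₗ[k] A) LinearMap.id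
      (TensorProduct.comm k A A (TensorProduct.congr H.S H.S
        (TensorProduct.map (IsGroupLike.ad H r) (τ : A →ₗ[k] A) t)))) =
      IsGroupLike.ad H r (H.S (rightSlice (H.ε : A →ₗ[k] k) t)) := fun t => by
    induction t using TensorProduct.induction_on with
    | zero => simp
    | add s₁ s₂ h₁ h₂ => simp only [map_add, h₁, h₂]
    | tmul p q => simp [hS, hc.counit_twist_antipode_twist hτ]
  refine sub_eq_zero.1 (H.nondegenerate.1 _ fun c => ?_)
  obtain ⟨c, rfl⟩ := hr.ad_surjective c
  obtain ⟨c, rfl⟩ := H.S.surjective c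
  obtain ⟨t, rfl⟩ := rightSlice_surjective (A := A) H.counit_ne_zero c
  rw [sub_mul, sub_eq_zero]
  conv_lhs => rw [← hσ, hf, (H.S_comul _ _).1, ← hw', hσ, rightSlice_comul_right, H.S_mul,
    hr.ad_mul]

/-- The obstruction to `δ(S(τ(a))) = r S(δ(a))`. -/
def defect (H : RegularMHC k A) (r : Mult k A) (δ : TwistedDerivation τ) : A →ₗ[k] A :=
  δ.toLinearMap ∘ₗ H.S.toLinearMap ∘ₗ (τ : A →ₗ[k] A) - r.left ∘ₗ H.S.toLinearMap ∘ₗ δ.toLinearMap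

omit hc in
theorem defect_apply (a : A) : defect H r δ a =
    δ.toLinearMap (H.S (τ a)) - r.left (H.S (δ.toLinearMap a)) := rfl

theorem defect_mul (hr : H.IsGroupLike r) (hτ : Function.Surjective τ) (u p : A) :
    defect H r δ (u * p) = defect H r δ p * H.S (τ u) +
      IsGroupLike.ad H r (H.S p) * defect H r δ u := by
  have h : IsGroupLike.ad H r (H.S p) * r.left (H.S (δ.toLinearMap u)) =
      r.left (H.S p) * H.S (δ.toLinearMap u) := by
    rw [← Mult.right_mul_eq, hr.right_ad]
  rw [defect_apply, defect_apply, defect_apply, map_mul, H.S_mul, δ.leibniz, δ.leibniz, map_add,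
    map_add, H.S_mul, H.S_mul, hc.twist_antipode_twist hr hτ, Mult.left_mul, Mult.left_mul, mul_sub,
    sub_mul, h]
  abel

theorem cover_defect_mul (hr : H.IsGroupLike r) (hτ : Function.Surjective τ) (s t : A ⊗[k] A) :
    H.cover (defect H r δ) s * t =
      TensorProduct.map δ.toLinearMap LinearMap.id (H.cover H.S.toLinearMap
          (TensorProduct.map (τ : A →ₗ[k] A) LinearMap.id s) * t) +
        TensorProduct.map r.left δ.toLinearMap (H.cover H.S.toLinearMap s * t) -
      (TensorProduct.map r.left LinearMap.id (H.cover H.S.toLinearMap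
          (TensorProduct.map δ.toLinearMap LinearMap.id s +
            TensorProduct.map r.left δ.toLinearMap s) * t) +
        TensorProduct.map r.left LinearMap.id (H.cover H.S.toLinearMap
          (TensorProduct.map r.left (τ : A →ₗ[k] A) s) *
            (TensorProduct.map δ.toLinearMap LinearMap.id t +
              TensorProduct.map r.left δ.toLinearMap t))) := by
  induction s using TensorProduct.induction_on with
  | zero => simp
  | add s₁ s₂ h₁ h₂ => simp only [map_add, add_mul, h₁, h₂] at *; abel
  | tmul p q =>
    have e₁ : (toMult (defect H r δ p) : Mult k A).left +
        r.left ∘ₗ (toMult (H.S (δ.toLinearMap p)) : Mult k A).left =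
        (toMult (δ.toLinearMap (H.S (τ p))) : Mult k A).left := LinearMap.ext fun x => by
      rw [LinearMap.add_apply, LinearMap.comp_apply, Mult.toMult_left, Mult.toMult_left,
        Mult.toMult_left, Mult.left_mul, defect_apply, sub_mul, sub_add_cancel]
    have e₁' : ∀ w : A ⊗[k] A,
        TensorProduct.map (toMult (defect H r δ p) : Mult k A).left LinearMap.id w =
        TensorProduct.map (toMult (δ.toLinearMap (H.S (τ p))) : Mult k A).left LinearMap.id w -
        TensorProduct.map (r.left ∘ₗ (toMult (H.S (δ.toLinearMap p)) : Mult k A).left)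
          LinearMap.id w := fun w => by
      rw [← e₁, TensorProduct.map_add_left, LinearMap.add_apply, add_sub_cancel_right]
    have hcoe : ∀ x, (τ : A →ₗ[k] A) x = τ x := fun _ => rfl
    have e₂ : δ.toLinearMap ∘ₗ (toMult (H.S (τ p)) : Mult k A).left =
        (toMult (δ.toLinearMap (H.S (τ p))) : Mult k A).left +
          (toMult (IsGroupLike.ad H r (H.S p)) : Mult k A).left ∘ₗ δ.toLinearMap :=
      LinearMap.ext fun x => by
        rw [LinearMap.add_apply, LinearMap.comp_apply, LinearMap.comp_apply, Mult.toMult_left,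
          Mult.toMult_left, Mult.toMult_left, δ.leibniz, hc.twist_antipode_twist hr hτ]
    have e₃ : r.left ∘ₗ (toMult (H.S (r.left p)) : Mult k A).left =
        (toMult (IsGroupLike.ad H r (H.S p)) : Mult k A).left := LinearMap.ext fun x => by
      rw [LinearMap.comp_apply, Mult.toMult_left, Mult.toMult_left, Mult.left_mul,
        IsGroupLike.antipode_left]
      rfl
    have e₄ : (toMult (IsGroupLike.ad H r (H.S p)) : Mult k A).left ∘ₗ r.left =
        r.left ∘ₗ (toMult (H.S p) : Mult k A).left := LinearMap.ext fun x => by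
      rw [LinearMap.comp_apply, LinearMap.comp_apply, Mult.toMult_left, Mult.toMult_left,
        Mult.left_mul, ← Mult.right_mul_eq, hr.right_ad]
    have key := congrArg (TensorProduct.map
      (toMult (IsGroupLike.ad H r (H.S p)) : Mult k A).left LinearMap.id) (hc.deriv q t)
    rw [map_add, map_add, map_map_apply, map_map_apply, e₄] at key
    simp only [TensorProduct.map_tmul, LinearMap.id_apply, map_add (H.cover H.S.toLinearMap),
      add_mul, cover_tmul_mul, LinearEquiv.coe_coe, hcoe]
    rw [map_add (TensorProduct.map r.left LinearMap.id)]
    simp only [map_map_apply, e₁', e₂, e₃, LinearMap.id_comp,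
      LinearMap.comp_id, TensorProduct.map_add_left, LinearMap.add_apply] at key ⊢
    rw [← sub_eq_zero] at key
    rw [← sub_eq_zero, ← neg_eq_zero, ← key]
    abel

theorem cover_defect_comul (hr : H.IsGroupLike r) (hτ : Function.Surjective τ) (a : A)
    (s : A ⊗[k] A) : H.cover (defect H r δ) ((H.Δ a).left s) =
      TensorProduct.map LinearMap.id (toMult (τ a) : Mult k A).left
        (H.cover (defect H r δ) s) := by
  have hm : ∀ (a : A) (x t : A ⊗[k] A),
      TensorProduct.map LinearMap.id (toMult a : Mult k A).left x * t =
      TensorProduct.map LinearMap.id (toMult a : Mult k A).left (x * t) := fun a x t =>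
    ((tmul₂ 1 (toMult a)).left_mul x t).symm
  have hl : ∀ (f g : A →ₗ[k] A) (t : A ⊗[k] A), TensorProduct.map f LinearMap.id
      (TensorProduct.map LinearMap.id g t) =
        TensorProduct.map LinearMap.id g (TensorProduct.map f LinearMap.id t) := fun f g t => by
    rw [map_map_apply, map_map_apply]
    rfl
  have hd : ∀ t : A ⊗[k] A, TensorProduct.map r.left δ.toLinearMap
      (TensorProduct.map LinearMap.id (toMult a : Mult k A).left t) =
      TensorProduct.map LinearMap.id (toMult (δ.toLinearMap a) : Mult k A).left
        (TensorProduct.map r.left LinearMap.id t) +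
      TensorProduct.map LinearMap.id (toMult (τ a) : Mult k A).left
        (TensorProduct.map r.left δ.toLinearMap t) := fun t => by
    rw [map_map_apply, map_map_apply, map_map_apply, ← LinearMap.add_apply, ← LinearMap.comp_id r.left,
      LinearMap.id_comp, ← TensorProduct.map_add_right]
    congr 2
    exact LinearMap.ext fun x => δ.leibniz a x
  refine sub_eq_zero.1 (H.nondegenerate_tensor.1 _ fun t => ?_)
  rw [sub_mul, hm, hc.cover_defect_mul hr hτ, hc.cover_defect_mul hr hτ, hc.deriv, hc.twist_left,
    hc.twist_right, map_add (H.cover H.S.toLinearMap), cover_antipode_comul, cover_antipode_comul,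
    cover_antipode_comul, cover_antipode_comul, cover_antipode_comul, hm, add_mul, hm, hm, hm, hm,
    hl, hd, hl, map_add (TensorProduct.map r.left LinearMap.id), hl, hl]
  simp only [map_sub, map_add]
  abel

theorem deriv_antipode_twist (hr : H.IsGroupLike r) (hτ : Function.Surjective τ) (a : A) :
    δ.toLinearMap (H.S (τ a)) = r.left (H.S (δ.toLinearMap a)) := by
  have h₁ : ∀ a q, H.cover (defect H r δ) (H.T₁ (a ⊗ₜ q)) = 0 := fun a q => by
    refine eq_zero_of_map_left_eq_zero
      (fun p => (toMult (IsGroupLike.ad H r (H.S p)) : Mult k A).left)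
      (fun x hx => H.nondegenerate.2 x fun b => ?_) _ fun p => ?_
    · obtain ⟨b, rfl⟩ := hr.ad_surjective b
      simpa using hx (H.S.symm b)
    · have g₁ : (H.Δ a).left (p ⊗ₜ q) =
          TensorProduct.map (toMult p : Mult k A).right LinearMap.id (H.T₁ (a ⊗ₜ[k] q)) :=
        galois₁_left (Δ := H.comul) H.nondegenerate H.T₁_spec a p q
      have h₂ := hc.cover_defect_comul hr hτ a (p ⊗ₜ q)
      have h₃ : defect H r δ ∘ₗ (toMult p : Mult k A).right =
          (toMult (defect H r δ p) : Mult k A).left ∘ₗ H.S.toLinearMap ∘ₗ (τ : A →ₗ[k] A) +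
            (toMult (IsGroupLike.ad H r (H.S p)) : Mult k A).left ∘ₗ defect H r δ :=
        LinearMap.ext fun x => hc.defect_mul hr hτ x p
      have h₄ : ∀ (ψ φ : A →ₗ[k] A) t, H.cover (ψ + φ) t = H.cover ψ t + H.cover φ t :=
        fun ψ φ t => by
          simp only [cover, LinearMap.comp_apply, TensorProduct.map_add_left, LinearMap.add_apply,
            map_add]
      rw [g₁, cover_map_left, h₃, h₄, cover_comp_toMult_left, cover_comp_toMult_left,
        ← cover_map_left, hc.map_T₁ hτ, cover_antipode_T₁, map_T₄] at h₂
      exact add_eq_left.1 h₂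
  have h₂ : ∀ t, TensorProduct.map (defect H r δ) LinearMap.id t = 0 := fun t => by
    obtain ⟨t, rfl⟩ := H.T₁_surjective t
    induction t using TensorProduct.induction_on with
    | zero => simp
    | add s₁ s₂ h₁ h₂ => rw [map_add, map_add, h₁, h₂, add_zero]
    | tmul a q => exact (map_eq_zero_iff H.T₂ H.T₂_injective).1 (h₁ a q)
  obtain ⟨b, hb⟩ := exists_ne (0 : A)
  exact sub_eq_zero.1 (eq_zero_of_tmul_eq_zero hb (h₂ (a ⊗ₜ b)))

end OreCompatible

end RegularMHC

end

end MHC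

namespace MHC

noncomputable section

section SkewComul

variable {k : Type*} [Field k]
variable {B : Type*} [NonUnitalRing B] [Module k B] [IsScalarTower k B B] [SMulCommClass k B B]

/-- `y ⊗ 1 + r ⊗ y` -/
def skewComul (y r : Mult k B) : Mult k (B ⊗[k] B) := Mult.tmul y 1 + Mult.tmul r y

theorem skewComul_left (y r : Mult k B) (t : B ⊗[k] B) : (skewComul y r).left t =
    TensorProduct.map y.left LinearMap.id t + TensorProduct.map r.left y.left t := rfl

theorem skewComul_right (y r : Mult k B) (t : B ⊗[k] B) : (skewComul y r).right t =
    TensorProduct.map y.right LinearMap.id t + TensorProduct.map r.right y.right t := rfl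

end SkewComul

namespace OreExt

set_option linter.unusedSectionVars false

variable {k : Type*} [Field k]
variable {A : Type*} [NonUnitalRing A] [Module k A] [IsScalarTower k A A] [SMulCommClass k A A]
variable {τ : A →ₙₐ[k] A} (δ : TwistedDerivation τ)

/-- The coefficient of `yⁿ`. -/
def coeff (n : ℕ) : OreExt δ →ₗ[k] A := Finsupp.lapply n

variable {δ}

theorem coeff_monomial (m n : ℕ) (a : A) : coeff δ m (monomial δ n a) = if n = m then a else 0 :=
  Finsupp.single_apply

@[simp] theorem coeff_monomial_self (n : ℕ) (a : A) : coeff δ n (monomial δ n a) = a := by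
  rw [coeff_monomial, if_pos rfl]

theorem coeff_monomial_of_ne {m n : ℕ} (h : n ≠ m) (a : A) : coeff δ m (monomial δ n a) = 0 := by
  rw [coeff_monomial, if_neg h]

theorem ext_coeff {f g : OreExt δ} (h : ∀ n, coeff δ n f = coeff δ n g) : f = g :=
  Finsupp.ext h

theorem induction_monomial {P : OreExt δ → Prop} (f : OreExt δ) (h0 : P 0)
    (hadd : ∀ f g, P f → P g → P (f + g)) (h : ∀ n a, P (monomial δ n a)) : P f :=
  Finsupp.induction_linear f h0 hadd h

theorem yRight_incl (a : A) : yRight δ (incl δ a) = monomial δ 1 a := yRight_monomial 0 a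

theorem yLeft_incl (a : A) :
    yLeft δ (incl δ a) = yRight δ (incl δ (τ a)) + incl δ (δ.toLinearMap a) := by
  rw [yRight_incl]
  exact yLeft_monomial 0 a

theorem induction_yRight {P : OreExt δ → Prop} (f : OreExt δ) (h0 : P 0)
    (hadd : ∀ f g, P f → P g → P (f + g)) (h : ∀ a, P (incl δ a))
    (hy : ∀ f, P f → P (yRight δ f)) : P f := by
  refine induction_monomial f h0 hadd fun n a => ?_
  induction n with
  | zero => exact h a
  | succ n ih => rw [← yRight_monomial]; exact hy _ ih

theorem induction_yLeft (hτ : Function.Surjective τ) {P : OreExt δ → Prop} (f : OreExt δ) (h0 : P 0)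
    (hadd : ∀ f g, P f → P g → P (f + g)) (h : ∀ a, P (incl δ a))
    (hy : ∀ f, P f → P (yLeft δ f)) : P f := by
  refine induction_monomial f h0 hadd fun n => ?_
  induction n with
  | zero => exact h
  | succ n ih =>
    intro a
    obtain ⟨a, rfl⟩ := hτ a
    have : monomial δ (n + 1) (τ a) =
        yLeft δ (monomial δ n a) + monomial δ n (-δ.toLinearMap a) := by
      rw [yLeft_monomial, map_neg, add_neg_cancel_right]
    rw [this]
    exact hadd _ _ (hy _ (ih a)) (ih _)

theorem incl_mul (a : A) (f : OreExt δ) : incl δ a * f = coeffMul δ a f := monomial_mul 0 a f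

theorem incl_mul_monomial (a : A) (n : ℕ) (b : A) :
    incl δ a * monomial δ n b = monomial δ n (a * b) := by
  rw [incl_mul, coeffMul_monomial]

theorem incl_mul_incl (a b : A) : incl δ a * incl δ b = incl δ (a * b) := incl_mul_monomial a 0 b

theorem coeff_coeffMul (n : ℕ) (a : A) (f : OreExt δ) :
    coeff δ n (coeffMul δ a f) = a * coeff δ n f := by
  induction f using induction_monomial with
  | h0 => simp
  | hadd f g hf hg => simp only [map_add, mul_add, hf, hg]
  | h m b => rw [coeffMul_monomial, coeff_monomial, coeff_monomial, mul_ite, mul_zero]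

theorem coeff_succ_yLeft (n : ℕ) (f : OreExt δ) : coeff δ (n + 1) (yLeft δ f) =
    τ (coeff δ n f) + δ.toLinearMap (coeff δ (n + 1) f) := by
  induction f using induction_monomial with
  | h0 => simp
  | hadd f g hf hg => simp only [map_add, hf, hg]; abel
  | h m b =>
    rw [yLeft_monomial, map_add, coeff_monomial, coeff_monomial, coeff_monomial, coeff_monomial]
    simp only [Nat.add_right_cancel_iff]
    split_ifs <;> simp

/-- If `F` does not raise degrees, the leading coefficient of `F(f)` comes from that of `f`. -/
theorem coeff_map_of_forall_lt {F : OreExt δ →ₗ[k] OreExt δ}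
    (hF : ∀ m n a, n < m → coeff δ m (F (monomial δ n a)) = 0) (N : ℕ) (f : OreExt δ)
    (hf : ∀ m, N < m → coeff δ m f = 0) :
    coeff δ N (F f) = coeff δ N (F (monomial δ N (coeff δ N f))) := by
  have key : ∀ f : ℕ →₀ A, f = f.sum fun n a => monomial δ n a := fun f => f.sum_single.symm
  have hs : coeff δ N (F f) = Finset.sum (Finsupp.support (show ℕ →₀ A from f)) fun n =>
      coeff δ N (F (monomial δ n (coeff δ n f))) := by
    conv_lhs => rw [key f]
    exact (map_sum (coeff δ N ∘ₗ F) _ _)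
  rw [hs]
  refine Finset.sum_eq_single N (fun n _ hn => ?_) fun hN => ?_
  · rcases lt_or_gt_of_ne hn with h | h
    · exact hF _ _ _ h
    · rw [hf n h, map_zero, map_zero, map_zero]
  · have : coeff δ N f = 0 := Finsupp.notMem_support_iff.1 hN
    rw [this, map_zero, map_zero, map_zero]

theorem exists_leading_coeff {f : OreExt δ} (hf : f ≠ 0) :
    ∃ N, coeff δ N f ≠ 0 ∧ ∀ m, N < m → coeff δ m f = 0 := by
  classical
  let g : ℕ →₀ A := f
  have hg : g.support.Nonempty := Finsupp.support_nonempty_iff.2 hf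
  refine ⟨g.support.max' hg, Finsupp.mem_support_iff.1 (g.support.max'_mem hg), fun m hm => ?_⟩
  by_contra h
  exact absurd (g.support.le_max' m (Finsupp.mem_support_iff.2 h)) (not_le.2 hm)

theorem coeff_yLeft_pow_incl (n : ℕ) (c : A) :
    coeff δ n ((yLeft δ ^ n) (incl δ c)) = τ^[n] c ∧
      ∀ m, n < m → coeff δ m ((yLeft δ ^ n) (incl δ c)) = 0 := by
  induction n with
  | zero => exact ⟨coeff_monomial_self 0 c, fun m hm => coeff_monomial_of_ne hm.ne c⟩
  | succ n ih =>
    rw [pow_succ', Module.End.mul_apply]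
    refine ⟨?_, fun m hm => ?_⟩
    · rw [coeff_succ_yLeft, ih.1, ih.2 _ n.lt_succ_self, map_zero, add_zero,
        Function.iterate_succ_apply']
    · obtain ⟨m, rfl⟩ := Nat.exists_eq_succ_of_ne_zero (Nat.ne_zero_of_lt hm)
      rw [coeff_succ_yLeft, ih.2 _ (Nat.lt_of_succ_lt_succ hm), ih.2 _ (Nat.lt_of_succ_lt hm),
        map_zero, map_zero, add_zero]

theorem nondegenerateProduct (hA : NondegenerateProduct A) (hτ : Function.Surjective τ) :
    NondegenerateProduct (OreExt δ) := by
  constructor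
  · intro f hf
    by_contra hne
    obtain ⟨N, hN, hN'⟩ := exists_leading_coeff hne
    refine hN (hA.1 _ fun c => ?_)
    obtain ⟨c, rfl⟩ := (hτ.iterate N) c
    have hF : ∀ m n a, n < m →
        coeff δ m (((mulMap δ).flip (incl δ c)) (monomial δ n a)) = 0 := fun m n a hmn => by
      rw [LinearMap.flip_apply, ← mul_def, monomial_mul, coeff_coeffMul,
        (coeff_yLeft_pow_incl n c).2 m hmn, mul_zero]
    have := coeff_map_of_forall_lt hF N f hN'
    rw [LinearMap.flip_apply, ← mul_def, hf, LinearMap.flip_apply, ← mul_def, monomial_mul,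
      coeff_coeffMul, (coeff_yLeft_pow_incl N c).1, map_zero] at this
    exact this.symm
  · intro f hf
    refine ext_coeff fun n => hA.2 _ fun a => ?_
    rw [← coeff_coeffMul, ← incl_mul, hf, map_zero]

theorem nondegenerateHom_incl (hA : NondegenerateHom (toMult : A →ₗ[k] Mult k A))
    (hτ : Function.Surjective τ) : NondegenerateHom (toMult ∘ₗ incl δ) where
  map_mul a b := by
    rw [LinearMap.comp_apply, ← incl_mul_incl, Mult.toMult_mul_toMult]
    rfl
  span_left := by
    rw [eq_top_iff]
    rintro f -
    induction f using induction_monomial with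
    | h0 => exact zero_mem _
    | hadd f g hf hg => exact add_mem hf hg
    | h n a =>
      refine hA.induction_left (P := fun a => monomial δ n a ∈ Submodule.span k
        {c | ∃ a b, c = ((toMult ∘ₗ incl δ : A →ₗ[k] _) a).left b}) a (fun a b => ?_) (by rw [map_zero]; exact zero_mem _)
        fun b c hb hc => by rw [map_add]; exact add_mem hb hc
      exact Submodule.subset_span ⟨a, monomial δ n b, (incl_mul_monomial a n b).symm⟩
  span_right := by
    rw [eq_top_iff]
    rintro f -
    induction f using induction_yLeft hτ with
    | h0 => exact zero_mem _
    | hadd f g hf hg => exact add_mem hf hg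
    | h a =>
      refine hA.induction_left (P := fun a => incl δ a ∈ Submodule.span k
        {c | ∃ a b, c = ((toMult ∘ₗ incl δ : A →ₗ[k] _) a).right b}) a (fun a b => ?_) (by rw [map_zero]; exact zero_mem _)
        fun b c hb hc => by rw [map_add]; exact add_mem hb hc
      exact Submodule.subset_span ⟨b, incl δ a, (incl_mul_incl a b).symm⟩
    | hy f hf =>
      induction hf using Submodule.span_induction with
      | zero => rw [map_zero]; exact zero_mem _
      | add x y _ _ hx hy => rw [map_add]; exact add_mem hx hy
      | smul c x _ hx => rw [map_smul]; exact Submodule.smul_mem _ _ hx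
      | mem x hx =>
        obtain ⟨a, g, rfl⟩ := hx
        refine Submodule.subset_span ⟨a, yLeft δ g, ?_⟩
        exact yLeft_mul g (incl δ a)

/-- `A ⊗ A → A[y; τ, δ] ⊗ A[y; τ, δ]` -/
abbrev inclTensor (δ : TwistedDerivation τ) : A ⊗[k] A →ₗ[k] OreExt δ ⊗[k] OreExt δ :=
  TensorProduct.map (incl δ) (incl δ)

theorem nondegenerateHom_inclTensor (hA : NondegenerateHom (toMult : A →ₗ[k] Mult k A))
    (hτ : Function.Surjective τ) : NondegenerateHom (toMult ∘ₗ inclTensor δ) := by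
  rw [← tensorMap_toMult_comp]
  exact (nondegenerateHom_incl hA hτ).tensor (nondegenerateHom_incl hA hτ)

@[simp] theorem y_left : (y δ).left = yLeft δ := rfl

@[simp] theorem y_right : (y δ).right = yRight δ := rfl

/-- `y ⊗ 1 + r ⊗ y` -/
def yComul (r' : Mult k (OreExt δ)) : Mult k (OreExt δ ⊗[k] OreExt δ) := skewComul (y δ) r'

theorem yComul_left (r' : Mult k (OreExt δ)) (t : OreExt δ ⊗[k] OreExt δ) :
    (yComul r').left t = TensorProduct.map (yLeft δ) LinearMap.id t +
      TensorProduct.map r'.left (yLeft δ) t := rfl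

theorem yComul_left_inclTensor {r : Mult k A} {r' : Mult k (OreExt δ)}
    (hr : ∀ a, r'.left (incl δ a) = incl δ (r.left a)) (t : A ⊗[k] A) :
    (yComul r').left (inclTensor δ t) =
      TensorProduct.map (yRight δ) LinearMap.id
        (inclTensor δ (TensorProduct.map (τ : A →ₗ[k] A) LinearMap.id t)) +
      TensorProduct.map LinearMap.id (yRight δ)
        (inclTensor δ (TensorProduct.map r.left (τ : A →ₗ[k] A) t)) +
      inclTensor δ (TensorProduct.map δ.toLinearMap LinearMap.id t +
        TensorProduct.map r.left δ.toLinearMap t) := by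
  rw [yComul_left]
  induction t using TensorProduct.induction_on with
  | zero => simp
  | add s₁ s₂ h₁ h₂ =>
    have e : ∀ a b c d e f : OreExt δ ⊗[k] OreExt δ,
      (a + b) + (c + d) = e + f ↔ (a + c) + (b + d) = e + f := fun a b c d e f => by
        rw [add_add_add_comm]
    simp only [map_add] at h₁ h₂ ⊢
    rw [e, h₁, h₂]
    abel
  | tmul p q =>
    have hcoe : ∀ x, (τ : A →ₗ[k] A) x = τ x := fun _ => rfl
    simp only [TensorProduct.map_tmul, LinearMap.id_apply, hr, yLeft_incl, map_add, hcoe,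
      TensorProduct.add_tmul, TensorProduct.tmul_add]
    abel

variable {H : RegularMHC k A} {z : A → Mult k (OreExt δ ⊗[k] OreExt δ)}

theorem yComul_mul_left (hz : ∀ a t, (z a).left (inclTensor δ t) = inclTensor δ ((H.Δ a).left t))
    {r : Mult k A} {r' : Mult k (OreExt δ)}
    (hr : ∀ a, r'.left (incl δ a) = incl δ (r.left a)) (a : A) (t : A ⊗[k] A) :
    (yComul r' * z a).left (inclTensor δ t) =
      TensorProduct.map (yRight δ) LinearMap.id
        (inclTensor δ (TensorProduct.map (τ : A →ₗ[k] A) LinearMap.id ((H.Δ a).left t))) +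
      TensorProduct.map LinearMap.id (yRight δ)
        (inclTensor δ (TensorProduct.map r.left (τ : A →ₗ[k] A) ((H.Δ a).left t))) +
      inclTensor δ (TensorProduct.map δ.toLinearMap LinearMap.id ((H.Δ a).left t) +
        TensorProduct.map r.left δ.toLinearMap ((H.Δ a).left t)) := by
  rw [Mult.mul_left_apply, hz, yComul_left_inclTensor hr]

theorem mul_yComul_left (hBB : NondegenerateProduct (OreExt δ ⊗[k] OreExt δ))
    (hz : ∀ a t, (z a).left (inclTensor δ t) = inclTensor δ ((H.Δ a).left t))
    {r : Mult k A} {r' : Mult k (OreExt δ)}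
    (hr : ∀ a, r'.left (incl δ a) = incl δ (r.left a)) (a : A) (t : A ⊗[k] A) :
    (z (τ a) * yComul r' + z (δ.toLinearMap a)).left (inclTensor δ t) =
      TensorProduct.map (yRight δ) LinearMap.id
        (inclTensor δ ((H.Δ (τ a)).left (TensorProduct.map (τ : A →ₗ[k] A) LinearMap.id t))) +
      TensorProduct.map LinearMap.id (yRight δ)
        (inclTensor δ ((H.Δ (τ a)).left (TensorProduct.map r.left (τ : A →ₗ[k] A) t))) +
      inclTensor δ ((H.Δ (δ.toLinearMap a)).left t +
        (H.Δ (τ a)).left (TensorProduct.map δ.toLinearMap LinearMap.id t +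
          TensorProduct.map r.left δ.toLinearMap t)) := by
  have h₁ : ∀ s, (z (τ a)).left (TensorProduct.map (yRight δ) LinearMap.id (inclTensor δ s)) =
      TensorProduct.map (yRight δ) LinearMap.id (inclTensor δ ((H.Δ (τ a)).left s)) := fun s =>
    (Mult.left_right_comm hBB (z (τ a)) (Mult.tmul (y δ) 1) (inclTensor δ s)).trans
      (congrArg _ (hz _ _))
  have h₂ : ∀ s, (z (τ a)).left (TensorProduct.map LinearMap.id (yRight δ) (inclTensor δ s)) =
      TensorProduct.map LinearMap.id (yRight δ) (inclTensor δ ((H.Δ (τ a)).left s)) := fun s =>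
    (Mult.left_right_comm hBB (z (τ a)) (Mult.tmul 1 (y δ)) (inclTensor δ s)).trans
      (congrArg _ (hz _ _))
  rw [Mult.add_left_apply, Mult.mul_left_apply, hz, yComul_left_inclTensor hr,
    map_add (z (τ a)).left, map_add (z (τ a)).left, h₁, h₂, hz, map_add (inclTensor δ) _
      ((H.Δ (τ a)).left _)]
  abel

theorem map_coeff_inclTensor (i j : ℕ) (m n : ℕ) (s : A ⊗[k] A) :
    TensorProduct.map (coeff δ i) (coeff δ j) (TensorProduct.map (monomial δ m) (monomial δ n) s) =
      if m = i ∧ n = j then s else 0 := by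
  induction s using TensorProduct.induction_on with
  | zero => simp
  | add s₁ s₂ h₁ h₂ =>
    simp only [map_add, h₁, h₂]
    split_ifs <;> simp
  | tmul p q =>
    simp only [TensorProduct.map_tmul, coeff_monomial]
    split_ifs <;> simp_all

theorem oreCompatible_iff (hBB : NondegenerateProduct (OreExt δ ⊗[k] OreExt δ))
    (hz : ∀ a t, (z a).left (inclTensor δ t) = inclTensor δ ((H.Δ a).left t))
    {r : Mult k A} {r' : Mult k (OreExt δ)}
    (hr : ∀ a, r'.left (incl δ a) = incl δ (r.left a)) :
    H.OreCompatible δ r ↔ ∀ a t, (yComul r' * z a).left (inclTensor δ t) =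
      (z (τ a) * yComul r' + z (δ.toLinearMap a)).left (inclTensor δ t) := by
  have e₁ : ∀ s, TensorProduct.map (yRight δ) LinearMap.id (inclTensor δ s) =
      TensorProduct.map (monomial δ 1) (monomial δ 0) s := fun s => by
    rw [map_map_apply]
    congr 2
    exact LinearMap.ext yRight_incl
  have e₂ : ∀ s, TensorProduct.map LinearMap.id (yRight δ) (inclTensor δ s) =
      TensorProduct.map (monomial δ 0) (monomial δ 1) s := fun s => by
    rw [map_map_apply]
    congr 2
    exact LinearMap.ext yRight_incl
  have e₃ : ∀ s, inclTensor δ s = TensorProduct.map (monomial δ 0) (monomial δ 0) s := fun s => rfl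
  constructor
  · intro h a t
    rw [yComul_mul_left hz hr, mul_yComul_left hBB hz hr, h.twist_left, h.twist_right, h.deriv]
  · intro h
    have e₄ : ∀ i j (X Y Z : A ⊗[k] A), TensorProduct.map (coeff δ i) (coeff δ j)
        (TensorProduct.map (monomial δ 1) (monomial δ 0) X +
          TensorProduct.map (monomial δ 0) (monomial δ 1) Y +
          TensorProduct.map (monomial δ 0) (monomial δ 0) Z) =
        (if 1 = i ∧ 0 = j then X else 0) + (if 0 = i ∧ 1 = j then Y else 0) +
          if 0 = i ∧ 0 = j then Z else 0 := fun i j X Y Z => by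
      rw [map_add, map_add, map_coeff_inclTensor, map_coeff_inclTensor, map_coeff_inclTensor]
    have key : ∀ a t i j, _ := fun a t i j => congrArg (TensorProduct.map (coeff δ i) (coeff δ j))
      (((yComul_mul_left hz hr a t).symm.trans (h a t)).trans (mul_yComul_left hBB hz hr a t))
    simp only [e₁, e₂] at key
    simp only [e₃, e₄] at key
    exact ⟨fun a t => by simpa using key a t 1 0, fun a t => by simpa using key a t 0 1,
      fun a t => by simpa [-map_add] using key a t 0 0⟩

end OreExt

theorem RegularMHC.IsOreExtensionWith.oreCompatible {k : Type*} [Field k] {A : Type*}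
    [NonUnitalRing A] [Module k A] [IsScalarTower k A A] [SMulCommClass k A A]
    {H : RegularMHC k A} {τ : A →ₙₐ[k] A} {δ : TwistedDerivation τ} {r : Mult k A}
    (h : H.IsOreExtensionWith δ r) : H.OreCompatible δ r := by
  obtain ⟨H', hΔ, r', hr', hy⟩ := h
  have hBB := H'.nondegenerate_tensor
  refine (OreExt.oreCompatible_iff hBB (z := fun a => H'.Δ (OreExt.incl δ a)) (r' := r')
    (fun a t => ?_) fun a => ?_).2 fun a t => congrArg (fun w : Mult k _ => w.left _) ?_
  · apply Mult.toMult_injective (k := k) hBB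
    rw [← Mult.mul_toMult]
    exact (hΔ a t).1.symm
  · apply Mult.toMult_injective (k := k) H'.nondegenerate
    rw [← Mult.mul_toMult]
    exact (hr' a).1.symm
  · have h₁ := (hy (OreExt.incl δ a)).1
    have h₂ := (hy (OreExt.incl δ (τ a))).2
    rw [OreExt.y_left, OreExt.yLeft_incl, map_add] at h₁
    rw [OreExt.y_right] at h₂
    rw [h₂] at h₁
    exact h₁.symm

end

end MHC

namespace MHC

noncomputable section

set_option linter.unusedSectionVars false

variable {k : Type*} [Field k]
variable {B : Type*} [NonUnitalRing B] [Module k B] [IsScalarTower k B B] [SMulCommClass k B B]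

local notation "tmul₂" => Mult.tmul (k := k) (A := B) (B := B)

/-- `T₁(a ⊗ b) = Δ(a)(1 ⊗ b)` -/
abbrev IsGalois₁ (Δ : B →ₗ[k] Mult k (B ⊗[k] B)) (T : B ⊗[k] B →ₗ[k] B ⊗[k] B) : Prop :=
  ∀ a b, toMult (T (a ⊗ₜ[k] b)) = Δ a * tmul₂ (1 : Mult k B) (toMult b)

/-- `T₂(a ⊗ b) = (a ⊗ 1)Δ(b)` -/
abbrev IsGalois₂ (Δ : B →ₗ[k] Mult k (B ⊗[k] B)) (T : B ⊗[k] B →ₗ[k] B ⊗[k] B) : Prop :=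
  ∀ a b, toMult (T (a ⊗ₜ[k] b)) = tmul₂ (toMult a) (1 : Mult k B) * Δ b

/-- `T₃(a ⊗ b) = Δ(a)(b ⊗ 1)` -/
abbrev IsGalois₃ (Δ : B →ₗ[k] Mult k (B ⊗[k] B)) (T : B ⊗[k] B →ₗ[k] B ⊗[k] B) : Prop :=
  ∀ a b, toMult (T (a ⊗ₜ[k] b)) = Δ a * tmul₂ (toMult b) (1 : Mult k B)

/-- `T₄(a ⊗ b) = (1 ⊗ a)Δ(b)` -/
abbrev IsGalois₄ (Δ : B →ₗ[k] Mult k (B ⊗[k] B)) (T : B ⊗[k] B →ₗ[k] B ⊗[k] B) : Prop :=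
  ∀ a b, toMult (T (a ⊗ₜ[k] b)) = tmul₂ (1 : Mult k B) (toMult a) * Δ b

/-- The antiautomorphism `a ⊗ b ↦ S(b) ⊗ S(a)`. -/
def flipTensor (S : B ≃ₗ[k] B) : B ⊗[k] B ≃ₗ[k] B ⊗[k] B :=
  TensorProduct.congr S S ≪≫ₗ TensorProduct.comm k B B

theorem flipTensor_tmul (S : B ≃ₗ[k] B) (p q : B) : flipTensor S (p ⊗ₜ[k] q) = S q ⊗ₜ[k] S p := rfl

/-- The element `y ∈ M(B)` is `(1, r)`-primitive for the comultiplication `Δ`, `r` is group-like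
with inverse `R`, and the antihomomorphism `S` takes the corresponding values at `y` and `r`. -/
structure SkewPrimitive (Δ : B →ₗ[k] Mult k (B ⊗[k] B)) (S : B ≃ₗ[k] B) (y r R : Mult k B) :
    Prop where
  mul_inv : r * R = 1
  inv_mul : R * r = 1
  comul_left : ∀ f, Δ (y.left f) = skewComul y r * Δ f
  comul_right : ∀ f, Δ (y.right f) = Δ f * skewComul y r
  comul_inv_left : ∀ f, Δ (R.left f) = tmul₂ R R * Δ f
  comul_unit_right : ∀ f, Δ (r.right f) = Δ f * tmul₂ r r
  antipode_left : ∀ f, S (y.left f) = -y.right (R.right (S f))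
  antipode_right : ∀ f, S (y.right f) = -R.left (y.left (S f))
  antipode_unit_left : ∀ f, S (r.left f) = R.right (S f)
  antipode_unit_right : ∀ f, S (r.right f) = R.left (S f)

namespace SkewPrimitive

variable {Δ : B →ₗ[k] Mult k (B ⊗[k] B)} {S : B ≃ₗ[k] B} {y r R : Mult k B}
  (h : SkewPrimitive Δ S y r R)

include h

theorem unit_left_inv_left (f : B) : r.left (R.left f) = f := by
  rw [← Mult.mul_left_apply, h.mul_inv, Mult.one_left]

theorem inv_left_unit_left (f : B) : R.left (r.left f) = f := by
  rw [← Mult.mul_left_apply, h.inv_mul, Mult.one_left]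

theorem inv_right_unit_right (f : B) : R.right (r.right f) = f := by
  rw [← Mult.mul_right_apply, h.mul_inv, Mult.one_right]

theorem unit_right_inv_right (f : B) : r.right (R.right f) = f := by
  rw [← Mult.mul_right_apply, h.inv_mul, Mult.one_right]

theorem antipode_inv_left (f : B) : S (R.left f) = r.right (S f) := by
  rw [← h.unit_right_inv_right (S (R.left f)), ← h.antipode_unit_left, h.unit_left_inv_left]

theorem antipode_inv_right (f : B) : S (R.right f) = r.left (S f) := by
  rw [← h.unit_left_inv_left (S (R.right f)), ← h.antipode_unit_right, h.unit_right_inv_right]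

/-- `S(-y r⁻¹ f) = S(f) y` -/
theorem antipode_left_inv_left (f : B) : S (y.left (R.left f)) = -y.right (S f) := by
  rw [h.antipode_left, h.antipode_inv_left, h.inv_right_unit_right]

/-- `S(-f y r⁻¹) = y S(f)` -/
theorem antipode_right_inv_right (f : B) : S (R.right (y.right f)) = -y.left (S f) := by
  rw [h.antipode_inv_right, h.antipode_right, map_neg, h.unit_left_inv_left]

theorem antipode_symm_right (f : B) : S.symm (y.right f) = -y.left (R.left (S.symm f)) := by
  rw [LinearEquiv.symm_apply_eq, map_neg, h.antipode_left_inv_left, neg_neg,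
    LinearEquiv.apply_symm_apply]

theorem antipode_symm_left (f : B) : S.symm (y.left f) = -R.right (y.right (S.symm f)) := by
  rw [LinearEquiv.symm_apply_eq, map_neg, h.antipode_right_inv_right, neg_neg,
    LinearEquiv.apply_symm_apply]

variable (hB : NondegenerateProduct B) {T₁ T₂ T₃ T₄ : B ⊗[k] B →ₗ[k] B ⊗[k] B}

section T₁₄

variable (hT₁ : IsGalois₁ Δ T₁) (hT₄ : IsGalois₄ Δ T₄)

theorem map_antipode_yComul_right (t : B ⊗[k] B) :
    TensorProduct.map LinearMap.id S.toLinearMap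
      ((skewComul y r).right t) =
    TensorProduct.map y.right LinearMap.id (TensorProduct.map LinearMap.id S.toLinearMap t) -
      TensorProduct.map r.right (R * y).left
        (TensorProduct.map LinearMap.id S.toLinearMap t) := by
  rw [skewComul_right]
  induction t using TensorProduct.induction_on with
  | zero => simp only [map_zero, add_zero, sub_zero]
  | add s₁ s₂ h₁ h₂ =>
    rw [map_add] at h₁ h₂ ⊢
    simp only [map_add]
    rw [add_add_add_comm, h₁, h₂]
    abel
  | tmul p q =>
    have e : S.toLinearMap (y.right q) = -(R * y).left (S.toLinearMap q) := h.antipode_right q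
    simp only [map_add, TensorProduct.map_tmul, LinearMap.id_apply, e, TensorProduct.tmul_neg,
      sub_eq_add_neg]

include hB

include hT₄ in
theorem T₄_right (g f : B) :
    T₄ (g ⊗ₜ y.right f) = (skewComul y r).right (T₄ (g ⊗ₜ f)) := by
  apply Mult.toMult_injective (k := k) (hB.tensor k hB)
  rw [hT₄, h.comul_right, ← mul_assoc, ← hT₄, Mult.toMult_mul]

include hT₁ in
theorem T₁_skew (t : B ⊗[k] B) :
    T₁ (TensorProduct.map y.right LinearMap.id t - TensorProduct.map r.right (R * y).left t) =
      TensorProduct.map y.right LinearMap.id (T₁ t) := by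
  induction t using TensorProduct.induction_on with
  | zero => simp
  | add s₁ s₂ h₁ h₂ =>
    have e : ∀ a b c d : B ⊗[k] B, (a + b) - (c + d) = (a - c) + (b - d) := fun a b c d => by abel
    rw [map_add, map_add, e, map_add, h₁, h₂, map_add, map_add]
  | tmul p q =>
    apply Mult.toMult_injective (k := k) (hB.tensor k hB)
    have e : TensorProduct.map y.right LinearMap.id (T₁ (p ⊗ₜ[k] q)) =
      (tmul₂ y 1).right (T₁ (p ⊗ₜ[k] q)) := rfl
    rw [e, TensorProduct.map_tmul, TensorProduct.map_tmul, map_sub, map_sub, ← Mult.toMult_mul, hT₁,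
      hT₁, hT₁, h.comul_right, h.comul_unit_right, skewComul, LinearMap.id_apply, ← Mult.mul_toMult, mul_assoc,
      mul_assoc, mul_assoc, add_mul, Mult.tmul_mul_tmul, Mult.tmul_mul_tmul, 
      Mult.tmul_mul_tmul, ← mul_assoc r R, h.mul_inv, one_mul, one_mul, mul_one, mul_one, mul_add,
      mul_assoc (Δ p), Mult.tmul_mul_tmul, one_mul, mul_one]
    exact add_sub_cancel_right (Δ p * tmul₂ y (toMult q)) _

include hT₁ in
theorem T₁_right (f g : B) : T₁ (y.right f ⊗ₜ g) =
    TensorProduct.map y.right LinearMap.id (T₁ (f ⊗ₜ g)) +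
      TensorProduct.map r.right LinearMap.id (T₁ (f ⊗ₜ y.left g)) := by
  apply Mult.toMult_injective (k := k) (hB.tensor k hB)
  have e₁ : TensorProduct.map y.right LinearMap.id (T₁ (f ⊗ₜ[k] g)) =
    (tmul₂ y 1).right (T₁ (f ⊗ₜ[k] g)) := rfl
  have e₂ : TensorProduct.map r.right LinearMap.id (T₁ (f ⊗ₜ[k] y.left g)) =
    (tmul₂ r 1).right (T₁ (f ⊗ₜ[k] y.left g)) := rfl
  rw [map_add, e₁, e₂, ← Mult.toMult_mul, ← Mult.toMult_mul, hT₁, hT₁, hT₁, h.comul_right, skewComul,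
    ← Mult.mul_toMult, mul_assoc, mul_assoc, mul_assoc, Mult.tmul_mul_tmul, Mult.tmul_mul_tmul,
    add_mul, Mult.tmul_mul_tmul, Mult.tmul_mul_tmul, one_mul, one_mul, one_mul, mul_one, mul_one,
    mul_one, mul_one, mul_add]

include hT₁ hT₄

theorem antipode₃_right {f : B}
    (hf : ∀ g, T₁ (TensorProduct.map LinearMap.id S.toLinearMap (T₄ (g ⊗ₜ f))) = f ⊗ₜ S g) (g : B) :
    T₁ (TensorProduct.map LinearMap.id S.toLinearMap (T₄ (g ⊗ₜ y.right f))) =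
      y.right f ⊗ₜ S g := by
  rw [h.T₄_right hB hT₄, h.map_antipode_yComul_right, h.T₁_skew hB hT₁, hf]
  rfl

theorem antipode₃_left {f g : B}
    (hf : T₁ (TensorProduct.map LinearMap.id S.toLinearMap (T₄ (g ⊗ₜ f))) = f ⊗ₜ S g) :
    T₁ (TensorProduct.map LinearMap.id S.toLinearMap (T₄ (y.left g ⊗ₜ f))) =
      f ⊗ₜ S (y.left g) := by
  have e₁ := galois₄_map_left hB hT₄ y (g ⊗ₜ f)
  rw [TensorProduct.map_tmul, LinearMap.id_apply] at e₁
  have e₂ : S.toLinearMap ∘ₗ y.left = (-(R * y)).right ∘ₗ S.toLinearMap :=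
    LinearMap.ext h.antipode_left
  rw [e₁, map_map_apply, e₂, TensorProduct.map_comp, LinearMap.comp_apply, galois₁_map_right hB hT₁,
    hf, h.antipode_left]
  rfl

omit hT₁ in
theorem antipode₄_map_right (t : B ⊗[k] B) :
    TensorProduct.map LinearMap.id S.toLinearMap (T₄ (TensorProduct.comm k B B
      (TensorProduct.map LinearMap.id S.symm.toLinearMap
        (TensorProduct.map y.right LinearMap.id t)))) =
    TensorProduct.map y.right LinearMap.id (TensorProduct.map LinearMap.id S.toLinearMap
      (T₄ (TensorProduct.comm k B B (TensorProduct.map LinearMap.id S.symm.toLinearMap t)))) -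
    TensorProduct.map r.right (R * y).left (TensorProduct.map LinearMap.id S.toLinearMap
      (T₄ (TensorProduct.comm k B B
        (TensorProduct.map LinearMap.id S.symm.toLinearMap t)))) := by
  induction t using TensorProduct.induction_on with
  | zero => simp
  | add s₁ s₂ h₁ h₂ => simp only [map_add, h₁, h₂]; abel
  | tmul p q =>
    simp only [TensorProduct.map_tmul, LinearMap.id_apply, TensorProduct.comm_tmul]
    rw [h.T₄_right hB hT₄, h.map_antipode_yComul_right]

omit hT₁ in
theorem antipode₄_map_unit_right (t : B ⊗[k] B) :
    TensorProduct.map LinearMap.id S.toLinearMap (T₄ (TensorProduct.comm k B B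
      (TensorProduct.map LinearMap.id S.symm.toLinearMap
        (TensorProduct.map r.right LinearMap.id t)))) =
    TensorProduct.map r.right R.left (TensorProduct.map LinearMap.id S.toLinearMap
      (T₄ (TensorProduct.comm k B B
        (TensorProduct.map LinearMap.id S.symm.toLinearMap t)))) := by
  induction t using TensorProduct.induction_on with
  | zero => simp
  | add s₁ s₂ h₁ h₂ => simp only [map_add, h₁, h₂]
  | tmul p q =>
    simp only [TensorProduct.map_tmul, LinearMap.id_apply, TensorProduct.comm_tmul]
    have e : ∀ g, T₄ (g ⊗ₜ r.right p) = TensorProduct.map r.right r.right (T₄ (g ⊗ₜ p)) :=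
      fun g => by
        have e : TensorProduct.map r.right r.right (T₄ (g ⊗ₜ[k] p)) =
          (tmul₂ r r).right (T₄ (g ⊗ₜ[k] p)) := rfl
        apply Mult.toMult_injective (k := k) (hB.tensor k hB)
        rw [e, hT₄, h.comul_unit_right, ← mul_assoc, ← hT₄, Mult.toMult_mul]
    rw [e, map_map_apply, map_map_apply]
    congr 2
    exact LinearMap.ext h.antipode_unit_right

theorem antipode₄_right {f : B} (hf : ∀ g, TensorProduct.map LinearMap.id S.toLinearMap
      (T₄ (TensorProduct.comm k B B
        (TensorProduct.map LinearMap.id S.symm.toLinearMap (T₁ (f ⊗ₜ[k] g))))) = f ⊗ₜ[k] g) (g : B) :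
    TensorProduct.map LinearMap.id S.toLinearMap (T₄ (TensorProduct.comm k B B
      (TensorProduct.map LinearMap.id S.symm.toLinearMap (T₁ (y.right f ⊗ₜ[k] g))))) =
      y.right f ⊗ₜ[k] g := by
  rw [h.T₁_right hB hT₁, map_add, map_add, map_add, map_add, h.antipode₄_map_right hB hT₄,
    h.antipode₄_map_unit_right hB hT₄, hf, hf]
  exact sub_add_cancel _ _

theorem antipode₄_left {f g : B} (hf : TensorProduct.map LinearMap.id S.toLinearMap
      (T₄ (TensorProduct.comm k B B
        (TensorProduct.map LinearMap.id S.symm.toLinearMap (T₁ (f ⊗ₜ[k] g))))) = f ⊗ₜ[k] g) :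
    TensorProduct.map LinearMap.id S.toLinearMap (T₄ (TensorProduct.comm k B B
      (TensorProduct.map LinearMap.id S.symm.toLinearMap (T₁ (f ⊗ₜ[k] y.right g))))) =
      f ⊗ₜ[k] y.right g := by
  have e₁ := galois₁_map_right hB hT₁ y (f ⊗ₜ g)
  rw [TensorProduct.map_tmul, LinearMap.id_apply] at e₁
  have e₂ : S.symm.toLinearMap ∘ₗ y.right = (-(y * R)).left ∘ₗ S.symm.toLinearMap :=
    LinearMap.ext h.antipode_symm_right
  have e₃ : S.toLinearMap ∘ₗ (-(y * R)).left = y.right ∘ₗ S.toLinearMap :=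
    LinearMap.ext fun x => (map_neg S (y.left (R.left x))).trans (by
      rw [h.antipode_left_inv_left, neg_neg]
      rfl)
  rw [e₁, map_map_apply, e₂, TensorProduct.map_comp, LinearMap.comp_apply,
    ← TensorProduct.map_comm, galois₄_map_left hB hT₄, map_map_apply, e₃, TensorProduct.map_comp,
    LinearMap.comp_apply, hf]
  rfl

end T₁₄

section T₂₃

variable (hT₂ : IsGalois₂ Δ T₂) (hT₃ : IsGalois₃ Δ T₃)

include hB

omit hB in
theorem map_antipode_skewComul_left (t : B ⊗[k] B) :
    TensorProduct.map S.toLinearMap LinearMap.id ((skewComul y r).left t) =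
    TensorProduct.map R.right y.left (TensorProduct.map S.toLinearMap LinearMap.id t) -
      TensorProduct.map (R * y).right LinearMap.id
        (TensorProduct.map S.toLinearMap LinearMap.id t) := by
  rw [skewComul_left]
  induction t using TensorProduct.induction_on with
  | zero => simp only [map_zero, add_zero, sub_zero]
  | add s₁ s₂ h₁ h₂ =>
    rw [map_add] at h₁ h₂ ⊢
    simp only [map_add]
    rw [add_add_add_comm, h₁, h₂]
    abel
  | tmul p q =>
    have e : S.toLinearMap (y.left p) = -(R * y).right (S.toLinearMap p) := h.antipode_left p
    have e' : S.toLinearMap (r.left p) = R.right (S.toLinearMap p) := h.antipode_unit_left p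
    simp only [map_add, TensorProduct.map_tmul, LinearMap.id_apply, e, e', TensorProduct.neg_tmul]
    abel

include hT₃ in
theorem T₃_left (f g : B) : T₃ (y.left f ⊗ₜ g) = (skewComul y r).left (T₃ (f ⊗ₜ g)) := by
  apply Mult.toMult_injective (k := k) (hB.tensor k hB)
  rw [hT₃, h.comul_left, mul_assoc, ← hT₃, Mult.mul_toMult]

include hT₂ in
theorem T₂_left (f g : B) : T₂ (g ⊗ₜ y.left f) =
    TensorProduct.map LinearMap.id y.left (T₂ (r.right g ⊗ₜ f)) + T₂ (y.right g ⊗ₜ f) := by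
  apply Mult.toMult_injective (k := k) (hB.tensor k hB)
  have e : TensorProduct.map LinearMap.id y.left (T₂ (r.right g ⊗ₜ[k] f)) =
    (tmul₂ 1 y).left (T₂ (r.right g ⊗ₜ[k] f)) := rfl
  rw [map_add, e, ← Mult.mul_toMult, hT₂, hT₂, hT₂, h.comul_left, skewComul, ← mul_assoc,
    ← mul_assoc, mul_add, Mult.tmul_mul_tmul, Mult.tmul_mul_tmul, Mult.tmul_mul_tmul,
    Mult.toMult_mul, Mult.toMult_mul, one_mul, one_mul, one_mul, mul_one, add_mul, add_comm]

include hT₂ in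
theorem T₂_skew (t : B ⊗[k] B) :
    T₂ (TensorProduct.map R.right y.left t - TensorProduct.map (R * y).right LinearMap.id t) =
      TensorProduct.map LinearMap.id y.left (T₂ t) := by
  induction t using TensorProduct.induction_on with
  | zero => simp
  | add s₁ s₂ h₁ h₂ =>
    have e : ∀ a b c d : B ⊗[k] B, (a + b) - (c + d) = (a - c) + (b - d) := fun a b c d => by abel
    rw [map_add, map_add, e, map_add, h₁, h₂, map_add, map_add]
  | tmul p q =>
    rw [TensorProduct.map_tmul, TensorProduct.map_tmul, map_sub, h.T₂_left hB hT₂,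
      h.unit_right_inv_right]
    exact add_sub_cancel_right _ _

include hT₂ hT₃

theorem antipode₁_left {f g : B}
    (hf : T₂ (TensorProduct.map S.toLinearMap LinearMap.id (T₃ (f ⊗ₜ[k] g))) = S g ⊗ₜ[k] f) :
    T₂ (TensorProduct.map S.toLinearMap LinearMap.id (T₃ (y.left f ⊗ₜ[k] g))) =
      S g ⊗ₜ[k] y.left f := by
  rw [h.T₃_left hB hT₃, h.map_antipode_skewComul_left, h.T₂_skew hB hT₂, hf]
  rfl

theorem antipode₁_right {f g : B}
    (hf : T₂ (TensorProduct.map S.toLinearMap LinearMap.id (T₃ (f ⊗ₜ[k] g))) = S g ⊗ₜ[k] f) :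
    T₂ (TensorProduct.map S.toLinearMap LinearMap.id (T₃ (f ⊗ₜ[k] y.right g))) =
      S (y.right g) ⊗ₜ[k] f := by
  have e₁ := galois₃_map_right hB hT₃ y (f ⊗ₜ g)
  rw [TensorProduct.map_tmul, LinearMap.id_apply] at e₁
  have e₂ : S.toLinearMap ∘ₗ y.right = (-(R * y)).left ∘ₗ S.toLinearMap :=
    LinearMap.ext h.antipode_right
  rw [e₁, map_map_apply, e₂, TensorProduct.map_comp, LinearMap.comp_apply, galois₂_map_left hB hT₂,
    hf, h.antipode_right]
  rfl

omit hT₂ in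
theorem antipode₂_map_left (t : B ⊗[k] B) :
    TensorProduct.map S.toLinearMap LinearMap.id (T₃ (TensorProduct.comm k B B
      (TensorProduct.map S.symm.toLinearMap LinearMap.id
        (TensorProduct.map LinearMap.id y.left t)))) =
    TensorProduct.map R.right y.left (TensorProduct.map S.toLinearMap LinearMap.id
      (T₃ (TensorProduct.comm k B B (TensorProduct.map S.symm.toLinearMap LinearMap.id t)))) -
    TensorProduct.map (R * y).right LinearMap.id (TensorProduct.map S.toLinearMap LinearMap.id
      (T₃ (TensorProduct.comm k B B
        (TensorProduct.map S.symm.toLinearMap LinearMap.id t)))) := by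
  induction t using TensorProduct.induction_on with
  | zero => simp
  | add s₁ s₂ h₁ h₂ => simp only [map_add, h₁, h₂]; abel
  | tmul p q =>
    simp only [TensorProduct.map_tmul, LinearMap.id_apply, TensorProduct.comm_tmul]
    rw [h.T₃_left hB hT₃, h.map_antipode_skewComul_left]

theorem antipode₂_right {f : B} (hf : ∀ g, TensorProduct.map S.toLinearMap LinearMap.id
      (T₃ (TensorProduct.comm k B B
        (TensorProduct.map S.symm.toLinearMap LinearMap.id (T₂ (g ⊗ₜ[k] f))))) = g ⊗ₜ[k] f) (g : B) :
    TensorProduct.map S.toLinearMap LinearMap.id (T₃ (TensorProduct.comm k B B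
      (TensorProduct.map S.symm.toLinearMap LinearMap.id (T₂ (g ⊗ₜ[k] y.left f))))) =
      g ⊗ₜ[k] y.left f := by
  rw [h.T₂_left hB hT₂, map_add, map_add, map_add, map_add, h.antipode₂_map_left hB hT₃, hf, hf,
    TensorProduct.map_tmul, TensorProduct.map_tmul, Mult.mul_right_apply, h.inv_right_unit_right]
  exact sub_add_cancel _ _

theorem antipode₂_left {f g : B} (hf : TensorProduct.map S.toLinearMap LinearMap.id
      (T₃ (TensorProduct.comm k B B
        (TensorProduct.map S.symm.toLinearMap LinearMap.id (T₂ (g ⊗ₜ[k] f))))) = g ⊗ₜ[k] f) :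
    TensorProduct.map S.toLinearMap LinearMap.id (T₃ (TensorProduct.comm k B B
      (TensorProduct.map S.symm.toLinearMap LinearMap.id (T₂ (y.left g ⊗ₜ[k] f))))) =
      y.left g ⊗ₜ[k] f := by
  have e₁ := galois₂_map_left hB hT₂ y (g ⊗ₜ f)
  rw [TensorProduct.map_tmul, LinearMap.id_apply] at e₁
  have e₂ : S.symm.toLinearMap ∘ₗ y.left = (-(y * R)).right ∘ₗ S.symm.toLinearMap :=
    LinearMap.ext h.antipode_symm_left
  have e₃ : S.toLinearMap ∘ₗ (-(y * R)).right = y.left ∘ₗ S.toLinearMap :=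
    LinearMap.ext fun x => (map_neg S (R.right (y.right x))).trans (by
      rw [h.antipode_right_inv_right, neg_neg]
      rfl)
  rw [e₁, map_map_apply, e₂, TensorProduct.map_comp, LinearMap.comp_apply,
    ← TensorProduct.map_comm, galois₃_map_right hB hT₃, map_map_apply, e₃, TensorProduct.map_comp,
    LinearMap.comp_apply, hf]
  rfl

end T₂₃

section

theorem flipTensor_skewComul_right (t : B ⊗[k] B) :
    (-(tmul₂ R R * skewComul y r)).left (flipTensor S t) =
      flipTensor S ((skewComul y r).right t) := by
  rw [skewComul_right, Mult.neg_left_apply, Mult.mul_left_apply, skewComul_left]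
  induction t using TensorProduct.induction_on with
  | zero => simp only [map_zero, add_zero, neg_zero]
  | add s₁ s₂ h₁ h₂ =>
    rw [map_add, map_add] at h₁ h₂ ⊢
    simp only [map_add]
    rw [add_add_add_comm ((flipTensor S) _), ← h₁, ← h₂]
    abel
  | tmul p q =>
    simp only [map_add, TensorProduct.map_tmul, LinearMap.id_apply, flipTensor_tmul,
      Mult.tmul_left, h.antipode_right, h.antipode_unit_right, h.inv_left_unit_left,
      TensorProduct.tmul_neg, TensorProduct.neg_tmul]
    abel

theorem flipTensor_skewComul_left (t : B ⊗[k] B) :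
    (-(tmul₂ R R * skewComul y r)).right (flipTensor S t) =
      flipTensor S ((skewComul y r).left t) := by
  rw [skewComul_left, Mult.neg_right_apply, Mult.mul_right_apply, skewComul_right]
  induction t using TensorProduct.induction_on with
  | zero => simp only [map_zero, add_zero, neg_zero]
  | add s₁ s₂ h₁ h₂ =>
    rw [map_add] at h₁ h₂ ⊢
    simp only [map_add]
    rw [add_add_add_comm ((flipTensor S) _), ← h₁, ← h₂]
    abel
  | tmul p q =>
    simp only [map_add, TensorProduct.map_tmul, LinearMap.id_apply, flipTensor_tmul,
      Mult.tmul_right, h.antipode_left, h.antipode_unit_left, h.unit_right_inv_right,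
      TensorProduct.tmul_neg, TensorProduct.neg_tmul]
    abel

include hB

theorem antipode_comul_right {f : B}
    (hf : ∀ t, (Δ (S f)).left (flipTensor S t) = flipTensor S ((Δ f).right t) ∧
      (Δ (S f)).right (flipTensor S t) = flipTensor S ((Δ f).left t)) (t : B ⊗[k] B) :
    (Δ (S (y.right f))).left (flipTensor S t) = flipTensor S ((Δ (y.right f)).right t) ∧
      (Δ (S (y.right f))).right (flipTensor S t) = flipTensor S ((Δ (y.right f)).left t) := by
  have e : Δ (S (y.right f)) = -(tmul₂ R R * skewComul y r) * Δ (S f) := by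
    rw [h.antipode_right, map_neg, h.comul_inv_left, h.comul_left, ← mul_assoc]
    exact Mult.ext' (fun _ => rfl) fun _ => (map_neg (Δ (S f)).right _).symm
  rw [e, h.comul_right]
  constructor
  · rw [Mult.mul_left_apply, (hf t).1, h.flipTensor_skewComul_right, Mult.mul_right_apply]
  · rw [Mult.mul_right_apply, h.flipTensor_skewComul_left, (hf _).2, Mult.mul_left_apply]

end

end SkewPrimitive

end

end MHC

namespace MHC

noncomputable section

namespace OreExt

set_option linter.unusedSectionVars false

variable {k : Type*} [Field k]
variable {A : Type*} [NonUnitalRing A] [Module k A] [IsScalarTower k A A] [SMulCommClass k A A]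
variable {τ : A →ₙₐ[k] A} {δ : TwistedDerivation τ}

section Lift

variable {R : Type*} [Ring R] [Algebra k R]

variable (δ) in
/-- The linear map `A[y; τ, δ] → R` with `a yⁿ ↦ φ(a) Yⁿ`. -/
def oreLift (φ : A →ₗ[k] R) (Y : R) : OreExt δ →ₗ[k] R :=
  lift δ fun n => LinearMap.mulRight k (Y ^ n) ∘ₗ φ

theorem oreLift_monomial (φ : A →ₗ[k] R) (Y : R) (n : ℕ) (a : A) :
    oreLift δ φ Y (monomial δ n a) = φ a * Y ^ n := by
  rw [oreLift, lift_monomial]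
  rfl

theorem oreLift_incl (φ : A →ₗ[k] R) (Y : R) (a : A) : oreLift δ φ Y (incl δ a) = φ a := by
  rw [incl, oreLift_monomial, pow_zero, mul_one]

theorem oreLift_yRight (φ : A →ₗ[k] R) (Y : R) (f : OreExt δ) :
    oreLift δ φ Y (yRight δ f) = oreLift δ φ Y f * Y := by
  induction f using induction_monomial with
  | h0 => rw [map_zero, map_zero, zero_mul]
  | hadd f g hf hg => rw [map_add, map_add, map_add, hf, hg, add_mul]
  | h n a => rw [yRight_monomial, oreLift_monomial, oreLift_monomial, pow_succ, mul_assoc]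

theorem yLeft_yRight (f : OreExt δ) : yLeft δ (yRight δ f) = yRight δ (yLeft δ f) := by
  induction f using induction_monomial with
  | h0 => simp
  | hadd f g hf hg => simp only [map_add, hf, hg]
  | h n a => simp only [yRight_monomial, yLeft_monomial, map_add]

theorem oreLift_yLeft {φ : A →ₗ[k] R} {Y : R}
    (hY : ∀ a, Y * φ a = φ (τ a) * Y + φ (δ.toLinearMap a)) (f : OreExt δ) :
    oreLift δ φ Y (yLeft δ f) = Y * oreLift δ φ Y f := by
  induction f using induction_yRight with
  | h0 => rw [map_zero, map_zero, mul_zero]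
  | hadd f g hf hg => rw [map_add, map_add, map_add, hf, hg, mul_add]
  | h a => rw [yLeft_incl, map_add, oreLift_yRight, oreLift_incl, oreLift_incl, oreLift_incl, hY]
  | hy f hf => rw [yLeft_yRight, oreLift_yRight, oreLift_yRight, hf, mul_assoc]

theorem oreLift_mul {φ : A →ₗ[k] R} {Y : R} (hφ : ∀ a b, φ (a * b) = φ a * φ b)
    (hY : ∀ a, Y * φ a = φ (τ a) * Y + φ (δ.toLinearMap a)) (f g : OreExt δ) :
    oreLift δ φ Y (f * g) = oreLift δ φ Y f * oreLift δ φ Y g := by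
  induction f using induction_yRight generalizing g with
  | h0 => rw [zero_mul, map_zero, zero_mul]
  | hadd f g hf hg => rw [add_mul, map_add, map_add, hf, hg, add_mul]
  | h a =>
    induction g using induction_monomial with
    | h0 => rw [mul_zero, map_zero, mul_zero]
    | hadd f g hf hg => rw [mul_add, map_add, map_add, hf, hg, mul_add]
    | h n b =>
      rw [incl_mul_monomial, oreLift_monomial, oreLift_monomial, oreLift_incl, hφ, mul_assoc]
  | hy f hf => rw [yRight_mul_eq, hf, oreLift_yLeft hY, oreLift_yRight, mul_assoc]

/-- `oreLift` as an algebra homomorphism. -/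
def oreLiftHom {φ : A →ₗ[k] R} {Y : R} (hφ : ∀ a b, φ (a * b) = φ a * φ b)
    (hY : ∀ a, Y * φ a = φ (τ a) * Y + φ (δ.toLinearMap a)) : OreExt δ →ₙₐ[k] R where
  toFun := oreLift δ φ Y
  map_smul' c f := map_smul _ c f
  map_zero' := map_zero _
  map_add' f g := map_add _ f g
  map_mul' := oreLift_mul hφ hY

end Lift

section Multiplier

variable [Nontrivial A] (H : RegularMHC k A) (hτ : Function.Surjective τ)

/-- The inclusion `M(A) → M(A[y; τ, δ])`. -/
def multIncl (δ : TwistedDerivation τ) : Mult k A →ₐ[k] Mult k (OreExt δ) :=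
  (nondegenerateHom_incl H.nondegenerateHom_toMult hτ).extension
    (nondegenerateProduct H.nondegenerate hτ)

/-- The inclusion `M(A ⊗ A) → M(A[y; τ, δ] ⊗ A[y; τ, δ])`. -/
def multInclTensor (δ : TwistedDerivation τ) :
    Mult k (A ⊗[k] A) →ₐ[k] Mult k (OreExt δ ⊗[k] OreExt δ) :=
  (nondegenerateHom_inclTensor H.nondegenerateHom_toMult hτ).extension
    ((nondegenerateProduct H.nondegenerate hτ).tensor k (nondegenerateProduct H.nondegenerate hτ))

include H hτ in
theorem nondegenerateProduct_tensor : NondegenerateProduct (OreExt δ ⊗[k] OreExt δ) :=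
  (nondegenerateProduct H.nondegenerate hτ).tensor k (nondegenerateProduct H.nondegenerate hτ)

theorem multIncl_extendsTo (x : Mult k A) :
    ExtendsTo (toMult ∘ₗ incl δ) x (multIncl H hτ δ x) :=
  NondegenerateHom.extension_spec _ _ x

theorem multInclTensor_extendsTo (x : Mult k (A ⊗[k] A)) :
    ExtendsTo (toMult ∘ₗ inclTensor δ) x (multInclTensor H hτ δ x) :=
  NondegenerateHom.extension_spec _ _ x

theorem multIncl_toMult (a : A) : multIncl H hτ δ (toMult a) = toMult (incl δ a) :=
  NondegenerateHom.extension_toMult _ _ a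

theorem multInclTensor_toMult (t : A ⊗[k] A) :
    multInclTensor H hτ δ (toMult t) = toMult (inclTensor δ t) :=
  NondegenerateHom.extension_toMult _ _ t

theorem multIncl_left_incl (x : Mult k A) (a : A) :
    (multIncl H hτ δ x).left (incl δ a) = incl δ (x.left a) := by
  apply Mult.toMult_injective (k := k) (nondegenerateProduct H.nondegenerate hτ)
  rw [← Mult.mul_toMult]
  exact (multIncl_extendsTo H hτ x a).1.symm

theorem multIncl_right_incl (x : Mult k A) (a : A) :
    (multIncl H hτ δ x).right (incl δ a) = incl δ (x.right a) := by
  apply Mult.toMult_injective (k := k) (nondegenerateProduct H.nondegenerate hτ)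
  rw [← Mult.toMult_mul]
  exact (multIncl_extendsTo H hτ x a).2.symm

theorem multInclTensor_left (x : Mult k (A ⊗[k] A)) (t : A ⊗[k] A) :
    (multInclTensor H hτ δ x).left (inclTensor δ t) = inclTensor δ (x.left t) := by
  apply Mult.toMult_injective (k := k) (nondegenerateProduct_tensor H hτ)
  rw [← Mult.mul_toMult]
  exact (multInclTensor_extendsTo H hτ x t).1.symm

theorem multInclTensor_right (x : Mult k (A ⊗[k] A)) (t : A ⊗[k] A) :
    (multInclTensor H hτ δ x).right (inclTensor δ t) = inclTensor δ (x.right t) := by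
  apply Mult.toMult_injective (k := k) (nondegenerateProduct_tensor H hτ)
  rw [← Mult.toMult_mul]
  exact (multInclTensor_extendsTo H hτ x t).2.symm

theorem multInclTensor_tmul (x x' : Mult k A) :
    multInclTensor H hτ δ (Mult.tmul x x') =
      Mult.tmul (multIncl H hτ δ x) (multIncl H hτ δ x') := by
  refine NondegenerateHom.extension_eq _ _ (NondegenerateHom.extendsTo_of_left
    (nondegenerateHom_inclTensor H.nondegenerateHom_toMult hτ) (nondegenerateProduct_tensor H hτ)
    fun t => ?_)
  refine Eq.trans (congrArg toMult ?_) (Mult.mul_toMult _ _).symm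
  rw [Mult.tmul_left, Mult.tmul_left, map_map_apply, map_map_apply]
  congr 2 <;> exact LinearMap.ext fun a => (multIncl_left_incl H hτ _ a).symm

theorem multIncl_left_yRight (x : Mult k A) (f : OreExt δ) :
    (multIncl H hτ δ x).left (yRight δ f) = yRight δ ((multIncl H hτ δ x).left f) :=
  Mult.left_right_comm (nondegenerateProduct H.nondegenerate hτ) _ (y δ) f

theorem multIncl_right_yLeft (x : Mult k A) (f : OreExt δ) :
    (multIncl H hτ δ x).right (yLeft δ f) = yLeft δ ((multIncl H hτ δ x).right f) :=
  (Mult.left_right_comm (nondegenerateProduct H.nondegenerate hτ) (y δ) _ f).symm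

theorem multIncl_left_monomial (x : Mult k A) (n : ℕ) (a : A) :
    (multIncl H hτ δ x).left (monomial δ n a) = monomial δ n (x.left a) := by
  induction n with
  | zero => exact multIncl_left_incl H hτ x a
  | succ n ih => rw [← yRight_monomial, multIncl_left_yRight, ih, yRight_monomial]

theorem coeff_multIncl_left (x : Mult k A) (n : ℕ) (f : OreExt δ) :
    coeff δ n ((multIncl H hτ δ x).left f) = x.left (coeff δ n f) := by
  induction f using induction_monomial with
  | h0 => simp
  | hadd f g hf hg => simp only [map_add, hf, hg]
  | h m a =>
    rw [multIncl_left_monomial, coeff_monomial, coeff_monomial]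
    split_ifs
    · rfl
    · rw [map_zero]

end Multiplier

section Antipode

variable [Nontrivial A] (H : RegularMHC k A) (hτ : Function.Surjective τ) (r : Mult k A)

/-- `S(y) = -r⁻¹y` -/
def antipodeVar (δ : TwistedDerivation τ) : Mult k (OreExt δ) :=
  -(multIncl H hτ δ (RegularMHC.IsGroupLike.antipode H r) * y δ)

/-- `a yⁿ ↦ S(y)ⁿ S(a)` -/
def antipodeMap (δ : TwistedDerivation τ) : OreExt δ →ₗ[k] OreExt δ :=
  lift δ fun n => ((antipodeVar H hτ r δ).left ^ n) ∘ₗ incl δ ∘ₗ H.S.toLinearMap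

theorem antipodeMap_monomial (n : ℕ) (a : A) : antipodeMap H hτ r δ (monomial δ n a) =
    ((antipodeVar H hτ r δ).left ^ n) (incl δ (H.S a)) := by
  rw [antipodeMap, lift_monomial]
  rfl

theorem antipodeMap_incl (a : A) : antipodeMap H hτ r δ (incl δ a) = incl δ (H.S a) :=
  antipodeMap_monomial H hτ r 0 a

theorem antipodeMap_yRight (f : OreExt δ) : antipodeMap H hτ r δ (yRight δ f) =
    (antipodeVar H hτ r δ).left (antipodeMap H hτ r δ f) := by
  induction f using induction_monomial with
  | h0 => simp
  | hadd f g hf hg => simp only [map_add, hf, hg]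
  | h m a =>
    rw [yRight_monomial, antipodeMap_monomial, antipodeMap_monomial, pow_succ',
      Module.End.mul_apply]

theorem antipodeVar_left (f : OreExt δ) : (antipodeVar H hτ r δ).left f =
    -(multIncl H hτ δ (RegularMHC.IsGroupLike.antipode H r)).left (yLeft δ f) := rfl

theorem antipodeVar_right (f : OreExt δ) : (antipodeVar H hτ r δ).right f =
    -yRight δ ((multIncl H hτ δ (RegularMHC.IsGroupLike.antipode H r)).right f) := rfl

theorem antipodeMap_unit_left (f : OreExt δ) :
    antipodeMap H hτ r δ ((multIncl H hτ δ r).left f) =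
      (multIncl H hτ δ (RegularMHC.IsGroupLike.antipode H r)).right (antipodeMap H hτ r δ f) := by
  induction f using induction_yRight with
  | h0 => simp
  | hadd f g hf hg => simp only [map_add, hf, hg]
  | h a =>
    rw [multIncl_left_incl, antipodeMap_incl, antipodeMap_incl, multIncl_right_incl,
      RegularMHC.IsGroupLike.antipode_left]
  | hy f hf =>
    rw [multIncl_left_yRight, antipodeMap_yRight, hf, antipodeMap_yRight,
      Mult.left_right_comm (nondegenerateProduct H.nondegenerate hτ)]

variable {H r} (hr : H.IsGroupLike r) (hc : H.OreCompatible δ r)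

include hr hc

theorem antipodeMap_yLeft_incl (a : A) : antipodeMap H hτ r δ (yLeft δ (incl δ a)) =
    (antipodeVar H hτ r δ).right (antipodeMap H hτ r δ (incl δ a)) := by
  rw [yLeft_incl, map_add, antipodeMap_yRight, antipodeMap_incl, antipodeMap_incl,
    antipodeMap_incl, antipodeVar_left, antipodeVar_right, yLeft_incl, hc.twist_antipode_twist hr hτ,
    hc.deriv_antipode_twist hr hτ, map_add, multIncl_left_incl, multIncl_left_yRight,
    multIncl_left_incl, hr.antipode_left_left, multIncl_right_incl]
  have e : (RegularMHC.IsGroupLike.antipode H r).left (RegularMHC.IsGroupLike.ad H r (H.S a)) =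
    (RegularMHC.IsGroupLike.antipode H r).right (H.S a) := hr.antipode_left_left _
  rw [e, neg_add, neg_add_cancel_right]

theorem antipodeMap_yLeft (f : OreExt δ) : antipodeMap H hτ r δ (yLeft δ f) =
    (antipodeVar H hτ r δ).right (antipodeMap H hτ r δ f) := by
  induction f using induction_yRight with
  | h0 => simp
  | hadd f g hf hg => simp only [map_add, hf, hg]
  | h a => exact antipodeMap_yLeft_incl hτ hr hc a
  | hy f hf =>
    rw [yLeft_yRight, antipodeMap_yRight, hf, antipodeMap_yRight,
      Mult.left_right_comm (nondegenerateProduct H.nondegenerate hτ)]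

theorem antipodeMap_mul (f g : OreExt δ) : antipodeMap H hτ r δ (f * g) =
    antipodeMap H hτ r δ g * antipodeMap H hτ r δ f := by
  induction f using induction_yRight generalizing g with
  | h0 => simp
  | hadd f g hf hg => simp only [add_mul, mul_add, map_add, hf, hg]
  | h a =>
    induction g using induction_yRight with
    | h0 => simp
    | hadd f g hf hg => simp only [add_mul, mul_add, map_add, hf, hg]
    | h b => rw [incl_mul_incl, antipodeMap_incl, antipodeMap_incl, antipodeMap_incl, H.S_mul,
        incl_mul_incl]
    | hy f hf => rw [← yRight_mul, antipodeMap_yRight, hf, antipodeMap_yRight, Mult.left_mul]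
  | hy f hf => rw [yRight_mul_eq, hf, antipodeMap_yLeft hτ hr hc, Mult.right_mul_eq,
      antipodeMap_yRight]

theorem antipodeMap_unit_right (f : OreExt δ) :
    antipodeMap H hτ r δ ((multIncl H hτ δ r).right f) =
      (multIncl H hτ δ (RegularMHC.IsGroupLike.antipode H r)).left (antipodeMap H hτ r δ f) := by
  induction f using induction_yLeft hτ with
  | h0 => simp
  | hadd f g hf hg => simp only [map_add, hf, hg]
  | h a =>
    rw [multIncl_right_incl, antipodeMap_incl, antipodeMap_incl, multIncl_left_incl,
      RegularMHC.IsGroupLike.antipode_right]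
  | hy f hf =>
    rw [multIncl_right_yLeft, antipodeMap_yLeft hτ hr hc, hf, antipodeMap_yLeft hτ hr hc,
      Mult.left_right_comm (nondegenerateProduct H.nondegenerate hτ)]

omit hc in
theorem multIncl_mul_inv : multIncl H hτ δ r *
    multIncl H hτ δ (RegularMHC.IsGroupLike.antipode H r) = 1 := by
  rw [← map_mul, hr.mul_antipode, map_one]

omit hc in
theorem multIncl_inv_mul : multIncl H hτ δ (RegularMHC.IsGroupLike.antipode H r) *
    multIncl H hτ δ r = 1 := by
  rw [← map_mul, hr.antipode_mul, map_one]

theorem antipodeMap_surjective : Function.Surjective (antipodeMap H hτ r δ) := fun g => by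
  induction g using induction_yRight with
  | h0 => exact ⟨0, map_zero _⟩
  | hadd f g hf hg =>
    obtain ⟨x, rfl⟩ := hf
    obtain ⟨y, rfl⟩ := hg
    exact ⟨x + y, map_add _ _ _⟩
  | h a => exact ⟨incl δ (H.S.symm a), by rw [antipodeMap_incl, LinearEquiv.apply_symm_apply]⟩
  | hy g hg =>
    obtain ⟨f, rfl⟩ := hg
    refine ⟨-yLeft δ ((multIncl H hτ δ (RegularMHC.IsGroupLike.antipode H r)).left f), ?_⟩
    rw [map_neg, antipodeMap_yLeft hτ hr hc, antipodeVar_right, neg_neg, ← antipodeMap_unit_left,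
      ← Mult.mul_left_apply, multIncl_mul_inv hτ hr, Mult.one_left]

omit hc in
theorem coeff_antipodeVar_pow_incl (n : ℕ) (c : A) :
    coeff δ n (((antipodeVar H hτ r δ).left ^ n) (incl δ c)) =
        (fun x => -(RegularMHC.IsGroupLike.antipode H r).left (τ x))^[n] c ∧
      ∀ m, n < m → coeff δ m (((antipodeVar H hτ r δ).left ^ n) (incl δ c)) = 0 := by
  induction n with
  | zero => exact ⟨coeff_monomial_self 0 c, fun m hm => coeff_monomial_of_ne hm.ne c⟩
  | succ n ih =>
    rw [pow_succ', Module.End.mul_apply]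
    have e : ∀ m f, coeff δ (m + 1) ((antipodeVar H hτ r δ).left f) =
        -(RegularMHC.IsGroupLike.antipode H r).left
          (τ (coeff δ m f) + δ.toLinearMap (coeff δ (m + 1) f)) := fun m f => by
      rw [antipodeVar_left, map_neg, coeff_multIncl_left, coeff_succ_yLeft]
    refine ⟨?_, fun m hm => ?_⟩
    · rw [e, ih.1, ih.2 _ n.lt_succ_self, map_zero, add_zero, Function.iterate_succ_apply']
    · obtain ⟨m, rfl⟩ := Nat.exists_eq_succ_of_ne_zero (Nat.ne_zero_of_lt hm)
      rw [e, ih.2 _ (Nat.lt_of_succ_lt_succ hm), ih.2 _ (Nat.lt_of_succ_lt hm),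
        map_zero, map_zero, add_zero, map_zero, neg_zero]

include hτ in
theorem twist_injective : Function.Injective τ := by
  refine (injective_iff_map_eq_zero τ).2 fun x hx => ?_
  obtain ⟨b, rfl⟩ := H.S.surjective x
  obtain ⟨b, rfl⟩ := hτ b
  rw [hc.twist_antipode_twist hr hτ, RegularMHC.IsGroupLike.ad, LinearMap.comp_apply] at hx
  have h₁ : H.S b = 0 := by
    rw [← hr.right_antipode_right (H.S b), ← hr.antipode_left_left
      ((RegularMHC.IsGroupLike.antipode H r).right (H.S b)), hx, map_zero, map_zero]
  rw [(LinearEquiv.map_eq_zero_iff H.S).1 h₁, map_zero, map_zero]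

theorem antipodeMap_injective : Function.Injective (antipodeMap H hτ r δ) := by
  refine (injective_iff_map_eq_zero _).2 fun f hf => ?_
  by_contra hne
  obtain ⟨N, hN, hN'⟩ := exists_leading_coeff hne
  have hF : ∀ m n a, n < m → coeff δ m (antipodeMap H hτ r δ (monomial δ n a)) = 0 :=
    fun m n a hmn => by
      rw [antipodeMap_monomial]
      exact (coeff_antipodeVar_pow_incl hτ hr n _).2 m hmn
  have key := coeff_map_of_forall_lt hF N f hN'
  rw [hf, map_zero, antipodeMap_monomial, (coeff_antipodeVar_pow_incl hτ hr N _).1] at key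
  have hinj : Function.Injective fun x => -(RegularMHC.IsGroupLike.antipode H r).left (τ x) :=
    neg_injective.comp ((Function.LeftInverse.injective hr.left_antipode_left).comp
      (twist_injective hτ hr hc))
  have h0 : (fun x => -(RegularMHC.IsGroupLike.antipode H r).left (τ x))^[N] 0 = 0 :=
    Function.iterate_fixed (by rw [map_zero, map_zero, neg_zero]) N
  have := (hinj.iterate N) (key.symm.trans h0.symm)
  exact hN ((LinearEquiv.map_eq_zero_iff H.S).1 this)

/-- The antipode of `A[y; τ, δ]`. -/
def antipodeEquiv : OreExt δ ≃ₗ[k] OreExt δ :=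
  LinearEquiv.ofBijective (antipodeMap H hτ r δ)
    ⟨antipodeMap_injective hτ hr hc, antipodeMap_surjective hτ hr hc⟩

theorem antipodeEquiv_apply (f : OreExt δ) :
    antipodeEquiv hτ hr hc f = antipodeMap H hτ r δ f := rfl

end Antipode

end OreExt

end

end MHC

namespace MHC

noncomputable section

namespace OreExt

set_option linter.unusedSectionVars false

section

variable {k : Type*} [Field k]
variable {A : Type*} [NonUnitalRing A] [Module k A] [IsScalarTower k A A] [SMulCommClass k A A]
variable {τ : A →ₙₐ[k] A} {δ : TwistedDerivation τ}

/-- Induction over elementary tensors, where the operators `Y`, `Z` together with `A` generate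
`A[y; τ, δ]`. -/
theorem induction_tmul {Y Z : OreExt δ → OreExt δ}
    (hY : ∀ (P : OreExt δ → Prop) (f : OreExt δ), P 0 → (∀ f g, P f → P g → P (f + g)) →
      (∀ a, P (incl δ a)) → (∀ f, P f → P (Y f)) → P f)
    (hZ : ∀ (P : OreExt δ → Prop) (f : OreExt δ), P 0 → (∀ f g, P f → P g → P (f + g)) →
      (∀ a, P (incl δ a)) → (∀ f, P f → P (Z f)) → P f)
    {P : OreExt δ ⊗[k] OreExt δ → Prop} (h0 : P 0) (hadd : ∀ s t, P s → P t → P (s + t))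
    (h : ∀ a b, P (incl δ a ⊗ₜ incl δ b)) (hz : ∀ f g, P (f ⊗ₜ g) → P (f ⊗ₜ Z g))
    (hy : ∀ f, (∀ g, P (f ⊗ₜ g)) → ∀ g, P (Y f ⊗ₜ g)) (f g : OreExt δ) : P (f ⊗ₜ g) := by
  refine hY (fun f => ∀ g, P (f ⊗ₜ g)) f (fun g => by rwa [TensorProduct.zero_tmul])
    (fun f f' hf hf' g => ?_) (fun a g => ?_) hy g
  · rw [TensorProduct.add_tmul]
    exact hadd _ _ (hf g) (hf' g)
  · refine hZ (fun g => P (incl δ a ⊗ₜ g)) g (by rwa [TensorProduct.tmul_zero])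
      (fun f f' hf hf' => ?_) (h a) (hz _)
    rw [TensorProduct.tmul_add]
    exact hadd _ _ hf hf'

theorem induction_tmul_right {Y Z : OreExt δ → OreExt δ}
    (hY : ∀ (P : OreExt δ → Prop) (f : OreExt δ), P 0 → (∀ f g, P f → P g → P (f + g)) →
      (∀ a, P (incl δ a)) → (∀ f, P f → P (Y f)) → P f)
    (hZ : ∀ (P : OreExt δ → Prop) (f : OreExt δ), P 0 → (∀ f g, P f → P g → P (f + g)) →
      (∀ a, P (incl δ a)) → (∀ f, P f → P (Z f)) → P f)
    {P : OreExt δ ⊗[k] OreExt δ → Prop} (h0 : P 0) (hadd : ∀ s t, P s → P t → P (s + t))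
    (h : ∀ a b, P (incl δ a ⊗ₜ incl δ b)) (hz : ∀ f g, P (g ⊗ₜ f) → P (Z g ⊗ₜ f))
    (hy : ∀ f, (∀ g, P (g ⊗ₜ f)) → ∀ g, P (g ⊗ₜ Y f)) (f g : OreExt δ) : P (g ⊗ₜ f) :=
  induction_tmul (P := fun t => P (TensorProduct.comm k _ _ t)) hY hZ
    (by rwa [map_zero]) (fun s t hs ht => by rw [map_add]; exact hadd _ _ hs ht)
    (fun a b => h b a) hz hy f g

theorem exists_lift_toMult {B C : Type*} [NonUnitalRing B] [Module k B] [IsScalarTower k B B]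
    [SMulCommClass k B B] [AddCommGroup C] [Module k C] (hB : NondegenerateProduct B)
    (F : C →ₗ[k] Mult k B) (hF : ∀ c, F c ∈ LinearMap.range (toMult : B →ₗ[k] Mult k B)) :
    ∃ T : C →ₗ[k] B, ∀ c, toMult (T c) = F c :=
  ⟨(LinearEquiv.ofInjective toMult (Mult.toMult_injective hB)).symm.toLinearMap ∘ₗ
    F.codRestrict _ hF, fun c => congrArg Subtype.val
      ((LinearEquiv.ofInjective toMult (Mult.toMult_injective hB)).apply_symm_apply
        (F.codRestrict _ hF c))⟩

end

variable {k : Type*} [Field k]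
variable {A : Type*} [NonUnitalRing A] [Module k A] [IsScalarTower k A A] [SMulCommClass k A A]
variable {τ : A →ₙₐ[k] A} {δ : TwistedDerivation τ}
variable [Nontrivial A] {H : RegularMHC k A} (hτ : Function.Surjective τ) {r : Mult k A}
  (hr : H.IsGroupLike r) (hc : H.OreCompatible δ r)

local notation "tmul₂" => Mult.tmul (k := k) (A := (OreExt δ)) (B := (OreExt δ))

variable (H r δ) in
/-- `a yⁿ ↦ Δ(a)(y ⊗ 1 + r ⊗ y)ⁿ` -/
def comulMap : OreExt δ →ₗ[k] Mult k (OreExt δ ⊗[k] OreExt δ) :=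
  oreLift δ ((multInclTensor H hτ δ).toLinearMap ∘ₗ H.comul)
    (skewComul (y δ) (multIncl H hτ δ r))

theorem comulMap_incl (a : A) :
    comulMap δ H hτ r (incl δ a) = multInclTensor H hτ δ (H.Δ a) := oreLift_incl _ _ a

include hc in
theorem skewComul_mul_comul (a : A) :
    skewComul (y δ) (multIncl H hτ δ r) * multInclTensor H hτ δ (H.Δ a) =
      multInclTensor H hτ δ (H.Δ (τ a)) * skewComul (y δ) (multIncl H hτ δ r) +
        multInclTensor H hτ δ (H.Δ (δ.toLinearMap a)) := by
  refine (nondegenerateHom_inclTensor H.nondegenerateHom_toMult hτ).mult_ext_left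
    (nondegenerateProduct_tensor H hτ) fun t => ?_
  refine (Mult.mul_toMult _ _).trans ((congrArg toMult ?_).trans (Mult.mul_toMult _ _).symm)
  exact (oreCompatible_iff (nondegenerateProduct_tensor H hτ)
    (z := fun a => multInclTensor H hτ δ (H.Δ a))
    (fun a t => multInclTensor_left H hτ _ t) (multIncl_left_incl H hτ r)).1 hc a t

/-- The comultiplication of `A[y; τ, δ]`. -/
def comulHom : OreExt δ →ₙₐ[k] Mult k (OreExt δ ⊗[k] OreExt δ) :=
  oreLiftHom (φ := (multInclTensor H hτ δ).toLinearMap ∘ₗ H.comul)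
    (Y := skewComul (y δ) (multIncl H hτ δ r))
    (fun a b => (congrArg _ (map_mul H.Δ a b)).trans (map_mul (multInclTensor H hτ δ) _ _))
    (skewComul_mul_comul hτ hc)

theorem comulMap_yRight (f : OreExt δ) : comulMap δ H hτ r (yRight δ f) =
    comulMap δ H hτ r f * skewComul (y δ) (multIncl H hτ δ r) := oreLift_yRight _ _ f

include hc in
theorem comulMap_yLeft (f : OreExt δ) : comulMap δ H hτ r (yLeft δ f) =
    skewComul (y δ) (multIncl H hτ δ r) * comulMap δ H hτ r f :=
  oreLift_yLeft (skewComul_mul_comul hτ hc) f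

include hr in
theorem comulMap_unit_left (f : OreExt δ) : comulMap δ H hτ r ((multIncl H hτ δ r).left f) =
    tmul₂ (multIncl H hτ δ r) (multIncl H hτ δ r) * comulMap δ H hτ r f := by
  induction f using induction_yRight with
  | h0 => rw [map_zero, map_zero, mul_zero]
  | hadd f g hf hg => rw [map_add, map_add, map_add, hf, hg, mul_add]
  | h a => rw [multIncl_left_incl, comulMap_incl, comulMap_incl, hr.comul_left, map_mul,
      multInclTensor_tmul]
  | hy f hf => rw [multIncl_left_yRight, comulMap_yRight, hf, comulMap_yRight, mul_assoc]

include hr hc in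
theorem comulMap_unit_right (f : OreExt δ) : comulMap δ H hτ r ((multIncl H hτ δ r).right f) =
    comulMap δ H hτ r f * tmul₂ (multIncl H hτ δ r) (multIncl H hτ δ r) := by
  induction f using induction_yLeft hτ with
  | h0 => rw [map_zero, map_zero, zero_mul]
  | hadd f g hf hg => rw [map_add, map_add, map_add, hf, hg, add_mul]
  | h a => rw [multIncl_right_incl, comulMap_incl, comulMap_incl, hr.comul_right, map_mul,
      multInclTensor_tmul]
  | hy f hf => rw [multIncl_right_yLeft, comulMap_yLeft hτ hc, hf, comulMap_yLeft hτ hc, mul_assoc]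

include hr in
theorem comulMap_inv_left (f : OreExt δ) :
    comulMap δ H hτ r ((multIncl H hτ δ (RegularMHC.IsGroupLike.antipode H r)).left f) =
      tmul₂ (multIncl H hτ δ (RegularMHC.IsGroupLike.antipode H r))
        (multIncl H hτ δ (RegularMHC.IsGroupLike.antipode H r)) * comulMap δ H hτ r f := by
  conv_rhs => rw [← Mult.one_left (k := k) f, ← multIncl_mul_inv hτ hr, Mult.mul_left_apply,
    comulMap_unit_left hτ hr, ← mul_assoc, Mult.tmul_mul_tmul, multIncl_inv_mul hτ hr,
    Mult.tmul_one_one, one_mul]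

theorem skewPrimitive : SkewPrimitive (comulMap δ H hτ r) (antipodeEquiv hτ hr hc) (y δ)
    (multIncl H hτ δ r) (multIncl H hτ δ (RegularMHC.IsGroupLike.antipode H r)) where
  mul_inv := multIncl_mul_inv hτ hr
  inv_mul := multIncl_inv_mul hτ hr
  comul_left := comulMap_yLeft hτ hc
  comul_right := comulMap_yRight hτ
  comul_inv_left := comulMap_inv_left hτ hr
  comul_unit_right := comulMap_unit_right hτ hr hc
  antipode_left := antipodeMap_yLeft hτ hr hc
  antipode_right := antipodeMap_yRight H hτ r
  antipode_unit_left := antipodeMap_unit_left H hτ r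
  antipode_unit_right := antipodeMap_unit_right hτ hr hc

section Galois

theorem mul_mem_range_toMult {B : Type*} [NonUnitalRing B] [Module k B] [IsScalarTower k B B]
    [SMulCommClass k B B] (x : Mult k B) {z : Mult k B}
    (hz : z ∈ LinearMap.range (toMult : B →ₗ[k] Mult k B)) :
    x * z ∈ LinearMap.range (toMult : B →ₗ[k] Mult k B) := by
  obtain ⟨b, rfl⟩ := hz
  exact ⟨x.left b, (Mult.mul_toMult x b).symm⟩

theorem mem_range_toMult_mul {B : Type*} [NonUnitalRing B] [Module k B] [IsScalarTower k B B]
    [SMulCommClass k B B] (x : Mult k B) {z : Mult k B}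
    (hz : z ∈ LinearMap.range (toMult : B →ₗ[k] Mult k B)) :
    z * x ∈ LinearMap.range (toMult : B →ₗ[k] Mult k B) := by
  obtain ⟨b, rfl⟩ := hz
  exact ⟨x.right b, (Mult.toMult_mul x b).symm⟩

variable (H r δ) in
/-- `f ⊗ g ↦ Δ(f)(1 ⊗ g)` -/
def galoisMap₁ : OreExt δ ⊗[k] OreExt δ →ₗ[k] Mult k (OreExt δ ⊗[k] OreExt δ) :=
  TensorProduct.lift ((LinearMap.mul k _).compl₁₂ (comulMap δ H hτ r)
    (tmul₂ (1 : Mult k (OreExt δ)) ∘ₗ toMult))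

variable (H r δ) in
/-- `f ⊗ g ↦ (f ⊗ 1)Δ(g)` -/
def galoisMap₂ : OreExt δ ⊗[k] OreExt δ →ₗ[k] Mult k (OreExt δ ⊗[k] OreExt δ) :=
  TensorProduct.lift ((LinearMap.mul k _).compl₁₂
    (Mult.tmul.flip (1 : Mult k (OreExt δ)) ∘ₗ toMult) (comulMap δ H hτ r))

variable (H r δ) in
/-- `f ⊗ g ↦ Δ(f)(g ⊗ 1)` -/
def galoisMap₃ : OreExt δ ⊗[k] OreExt δ →ₗ[k] Mult k (OreExt δ ⊗[k] OreExt δ) :=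
  TensorProduct.lift ((LinearMap.mul k _).compl₁₂ (comulMap δ H hτ r)
    (Mult.tmul.flip (1 : Mult k (OreExt δ)) ∘ₗ toMult))

variable (H r δ) in
/-- `f ⊗ g ↦ (1 ⊗ f)Δ(g)` -/
def galoisMap₄ : OreExt δ ⊗[k] OreExt δ →ₗ[k] Mult k (OreExt δ ⊗[k] OreExt δ) :=
  TensorProduct.lift ((LinearMap.mul k _).compl₁₂
    (tmul₂ (1 : Mult k (OreExt δ)) ∘ₗ toMult) (comulMap δ H hτ r))

theorem galoisMap₁_tmul (f g : OreExt δ) : galoisMap₁ δ H hτ r (f ⊗ₜ g) =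
    comulMap δ H hτ r f * tmul₂ (1 : Mult k (OreExt δ)) (toMult g) := rfl

theorem galoisMap₂_tmul (f g : OreExt δ) : galoisMap₂ δ H hτ r (f ⊗ₜ g) =
    tmul₂ (toMult f) (1 : Mult k (OreExt δ)) * comulMap δ H hτ r g := rfl

theorem galoisMap₃_tmul (f g : OreExt δ) : galoisMap₃ δ H hτ r (f ⊗ₜ g) =
    comulMap δ H hτ r f * tmul₂ (toMult g) (1 : Mult k (OreExt δ)) := rfl

theorem galoisMap₄_tmul (f g : OreExt δ) : galoisMap₄ δ H hτ r (f ⊗ₜ g) =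
    tmul₂ (1 : Mult k (OreExt δ)) (toMult f) * comulMap δ H hτ r g := rfl

theorem galoisMap₁_incl (a b : A) : galoisMap₁ δ H hτ r (incl δ a ⊗ₜ incl δ b) =
    toMult (inclTensor δ (H.T₁ (a ⊗ₜ b))) := by
  rw [galoisMap₁_tmul, comulMap_incl, ← multIncl_toMult H hτ, ← map_one (multIncl H hτ δ),
    ← multInclTensor_tmul, ← map_mul, ← H.T₁_spec, multInclTensor_toMult]

theorem galoisMap₂_incl (a b : A) : galoisMap₂ δ H hτ r (incl δ a ⊗ₜ incl δ b) =
    toMult (inclTensor δ (H.T₂ (a ⊗ₜ b))) := by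
  rw [galoisMap₂_tmul, comulMap_incl, ← multIncl_toMult H hτ, ← map_one (multIncl H hτ δ),
    ← multInclTensor_tmul, ← map_mul, ← H.T₂_spec, multInclTensor_toMult]

theorem galoisMap₃_incl (a b : A) : galoisMap₃ δ H hτ r (incl δ a ⊗ₜ incl δ b) =
    toMult (inclTensor δ (H.T₃ (a ⊗ₜ b))) := by
  rw [galoisMap₃_tmul, comulMap_incl, ← multIncl_toMult H hτ, ← map_one (multIncl H hτ δ),
    ← multInclTensor_tmul, ← map_mul, ← H.T₃_spec, multInclTensor_toMult]

theorem galoisMap₄_incl (a b : A) : galoisMap₄ δ H hτ r (incl δ a ⊗ₜ incl δ b) =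
    toMult (inclTensor δ (H.T₄ (a ⊗ₜ b))) := by
  rw [galoisMap₄_tmul, comulMap_incl, ← multIncl_toMult H hτ, ← map_one (multIncl H hτ δ),
    ← multInclTensor_tmul, ← map_mul, ← H.T₄_spec, multInclTensor_toMult]

theorem tmul_one_yLeft (f : OreExt δ) :
    tmul₂ (toMult (yLeft δ f)) (1 : Mult k (OreExt δ)) =
      tmul₂ (y δ) (1 : Mult k (OreExt δ)) * tmul₂ (toMult f) (1 : Mult k (OreExt δ)) := by
  rw [Mult.tmul_mul_tmul, Mult.mul_toMult, mul_one, y_left]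

theorem tmul_one_yRight (f : OreExt δ) :
    tmul₂ (toMult (yRight δ f)) (1 : Mult k (OreExt δ)) =
      tmul₂ (toMult f) (1 : Mult k (OreExt δ)) * tmul₂ (y δ) (1 : Mult k (OreExt δ)) := by
  rw [Mult.tmul_mul_tmul, Mult.toMult_mul, mul_one, y_right]

theorem one_tmul_yLeft (f : OreExt δ) :
    tmul₂ (1 : Mult k (OreExt δ)) (toMult (yLeft δ f)) =
      tmul₂ (1 : Mult k (OreExt δ)) (y δ) * tmul₂ (1 : Mult k (OreExt δ)) (toMult f) := by
  rw [Mult.tmul_mul_tmul, Mult.mul_toMult, mul_one, y_left]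

theorem one_tmul_yRight (f : OreExt δ) :
    tmul₂ (1 : Mult k (OreExt δ)) (toMult (yRight δ f)) =
      tmul₂ (1 : Mult k (OreExt δ)) (toMult f) * tmul₂ (1 : Mult k (OreExt δ)) (y δ) := by
  rw [Mult.tmul_mul_tmul, Mult.toMult_mul, mul_one, y_right]

theorem mem_range_of_forall_tmul {F : OreExt δ ⊗[k] OreExt δ →ₗ[k]
      Mult k (OreExt δ ⊗[k] OreExt δ)}
    (h : ∀ f g, F (f ⊗ₜ g) ∈ LinearMap.range (toMult : OreExt δ ⊗[k] OreExt δ →ₗ[k] _))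
    (t : OreExt δ ⊗[k] OreExt δ) :
    F t ∈ LinearMap.range (toMult : OreExt δ ⊗[k] OreExt δ →ₗ[k] _) := by
  induction t using TensorProduct.induction_on with
  | zero => rw [map_zero]; exact zero_mem _
  | add s₁ s₂ h₁ h₂ => rw [map_add]; exact add_mem h₁ h₂
  | tmul f g => exact h f g

include hτ in
theorem mem_range_galoisMap {F : OreExt δ ⊗[k] OreExt δ →ₗ[k] Mult k (OreExt δ ⊗[k] OreExt δ)}
    (h : ∀ a b, F (incl δ a ⊗ₜ incl δ b) ∈ LinearMap.range (toMult : OreExt δ ⊗[k] OreExt δ →ₗ[k] _))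
    {x z : Mult k (OreExt δ ⊗[k] OreExt δ)} (hx : ∀ f g, F (yLeft δ f ⊗ₜ g) = x * F (f ⊗ₜ g))
    (hz : ∀ f g, F (f ⊗ₜ yRight δ g) = F (f ⊗ₜ g) * z) (t : OreExt δ ⊗[k] OreExt δ) :
    F t ∈ LinearMap.range (toMult : OreExt δ ⊗[k] OreExt δ →ₗ[k] _) := by
  refine mem_range_of_forall_tmul (induction_tmul
    (P := fun t => F t ∈ LinearMap.range (toMult : OreExt δ ⊗[k] OreExt δ →ₗ[k] _))
    (fun _ => induction_yLeft hτ) (fun _ => induction_yRight)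
    (by rw [map_zero]; exact zero_mem _) (fun s t hs ht => by rw [map_add]; exact add_mem hs ht)
    h (fun f g hfg => ?_) fun f hf g => ?_) t
  · rw [hz]
    exact mem_range_toMult_mul z hfg
  · rw [hx]
    exact mul_mem_range_toMult x (hf g)

include hc

theorem exists_galois₁ : ∃ T, IsGalois₁ (comulMap δ H hτ r) T ∧
    ∀ t, T (inclTensor δ t) = inclTensor δ (H.T₁ t) := by
  obtain ⟨T, hT⟩ := exists_lift_toMult (nondegenerateProduct_tensor H hτ) (galoisMap₁ δ H hτ r)
    (mem_range_galoisMap hτ (fun a b => ⟨_, (galoisMap₁_incl hτ a b).symm⟩)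
      (fun f g => by rw [galoisMap₁_tmul, comulMap_yLeft hτ hc, mul_assoc, galoisMap₁_tmul])
      fun f g => by rw [galoisMap₁_tmul, one_tmul_yRight, ← mul_assoc, galoisMap₁_tmul])
  refine ⟨T, fun a b => hT _, LinearMap.congr_fun (f := T ∘ₗ inclTensor δ)
    (g := inclTensor δ ∘ₗ H.T₁) (TensorProduct.ext' fun a b => ?_)⟩
  exact Mult.toMult_injective (k := k) (nondegenerateProduct_tensor H hτ)
    ((hT _).trans (galoisMap₁_incl hτ a b))

theorem exists_galois₂ : ∃ T, IsGalois₂ (comulMap δ H hτ r) T ∧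
    ∀ t, T (inclTensor δ t) = inclTensor δ (H.T₂ t) := by
  obtain ⟨T, hT⟩ := exists_lift_toMult (nondegenerateProduct_tensor H hτ) (galoisMap₂ δ H hτ r)
    (mem_range_galoisMap hτ (fun a b => ⟨_, (galoisMap₂_incl hτ a b).symm⟩)
      (fun f g => by rw [galoisMap₂_tmul, tmul_one_yLeft, mul_assoc, galoisMap₂_tmul])
      fun f g => by rw [galoisMap₂_tmul, comulMap_yRight, ← mul_assoc, galoisMap₂_tmul])
  refine ⟨T, fun a b => hT _, LinearMap.congr_fun (f := T ∘ₗ inclTensor δ)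
    (g := inclTensor δ ∘ₗ H.T₂) (TensorProduct.ext' fun a b => ?_)⟩
  exact Mult.toMult_injective (k := k) (nondegenerateProduct_tensor H hτ)
    ((hT _).trans (galoisMap₂_incl hτ a b))

theorem exists_galois₃ : ∃ T, IsGalois₃ (comulMap δ H hτ r) T ∧
    ∀ t, T (inclTensor δ t) = inclTensor δ (H.T₃ t) := by
  obtain ⟨T, hT⟩ := exists_lift_toMult (nondegenerateProduct_tensor H hτ) (galoisMap₃ δ H hτ r)
    (mem_range_galoisMap hτ (fun a b => ⟨_, (galoisMap₃_incl hτ a b).symm⟩)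
      (fun f g => by rw [galoisMap₃_tmul, comulMap_yLeft hτ hc, mul_assoc, galoisMap₃_tmul])
      fun f g => by rw [galoisMap₃_tmul, tmul_one_yRight, ← mul_assoc, galoisMap₃_tmul])
  refine ⟨T, fun a b => hT _, LinearMap.congr_fun (f := T ∘ₗ inclTensor δ)
    (g := inclTensor δ ∘ₗ H.T₃) (TensorProduct.ext' fun a b => ?_)⟩
  exact Mult.toMult_injective (k := k) (nondegenerateProduct_tensor H hτ)
    ((hT _).trans (galoisMap₃_incl hτ a b))

theorem exists_galois₄ : ∃ T, IsGalois₄ (comulMap δ H hτ r) T ∧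
    ∀ t, T (inclTensor δ t) = inclTensor δ (H.T₄ t) := by
  obtain ⟨T, hT⟩ := exists_lift_toMult (nondegenerateProduct_tensor H hτ) (galoisMap₄ δ H hτ r)
    (mem_range_galoisMap hτ (fun a b => ⟨_, (galoisMap₄_incl hτ a b).symm⟩)
      (fun f g => by rw [galoisMap₄_tmul, one_tmul_yLeft, mul_assoc, galoisMap₄_tmul])
      fun f g => by rw [galoisMap₄_tmul, comulMap_yRight, ← mul_assoc, galoisMap₄_tmul])
  refine ⟨T, fun a b => hT _, LinearMap.congr_fun (f := T ∘ₗ inclTensor δ)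
    (g := inclTensor δ ∘ₗ H.T₄) (TensorProduct.ext' fun a b => ?_)⟩
  exact Mult.toMult_injective (k := k) (nondegenerateProduct_tensor H hτ)
    ((hT _).trans (galoisMap₄_incl hτ a b))

end Galois

end OreExt

end

end MHC

namespace MHC

noncomputable section

namespace OreExt

set_option linter.unusedSectionVars false

variable {k : Type*} [Field k]
variable {A : Type*} [NonUnitalRing A] [Module k A] [IsScalarTower k A A] [SMulCommClass k A A]
variable {τ : A →ₙₐ[k] A} {δ : TwistedDerivation τ}
variable [Nontrivial A] {H : RegularMHC k A} (hτ : Function.Surjective τ) {r : Mult k A}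
  (hr : H.IsGroupLike r) (hc : H.OreCompatible δ r)

section Counit

variable (δ H) in
/-- `ε(a yⁿ) = ε(a)` if `n = 0` and `0` otherwise. -/
def counitMap : OreExt δ →ₗ[k] k := oreLift δ (H.ε : A →ₗ[k] k) 0

include hr hc

theorem zero_mul_counit (a : A) : (0 : k) * (H.ε : A →ₗ[k] k) a =
    (H.ε : A →ₗ[k] k) (τ a) * 0 + (H.ε : A →ₗ[k] k) (δ.toLinearMap a) := by
  rw [zero_mul, mul_zero, zero_add]
  exact (hc.counit_deriv hr a).symm

/-- The counit of `A[y; τ, δ]`. -/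
def counitHom : OreExt δ →ₙₐ[k] k :=
  oreLiftHom (φ := (H.ε : A →ₗ[k] k)) (Y := 0) (map_mul H.ε) (zero_mul_counit hr hc)

theorem counitMap_yLeft (f : OreExt δ) : counitMap δ H (yLeft δ f) = 0 :=
  (oreLift_yLeft (zero_mul_counit hr hc) f).trans (zero_mul _)

omit [Nontrivial A] hr hc in
theorem counitMap_yRight (f : OreExt δ) : counitMap δ H (yRight δ f) = 0 :=
  (oreLift_yRight _ _ f).trans (mul_zero _)

omit [Nontrivial A] hr hc in
theorem counitMap_incl (a : A) : counitMap δ H (incl δ a) = H.ε a := oreLift_incl _ _ a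

omit hc in
theorem counitMap_unit_left (f : OreExt δ) :
    counitMap δ H ((multIncl H hτ δ r).left f) = counitMap δ H f := by
  induction f using induction_yRight with
  | h0 => simp
  | hadd f g hf hg => simp only [map_add, hf, hg]
  | h a => rw [multIncl_left_incl, counitMap_incl, counitMap_incl, hr.counit_left]
  | hy f hf => rw [multIncl_left_yRight, counitMap_yRight, counitMap_yRight]

theorem leftSlice_skewComul_left (t : OreExt δ ⊗[k] OreExt δ) :
    leftSlice (counitMap δ H) ((skewComul (y δ) (multIncl H hτ δ r)).left t) =
      yLeft δ (leftSlice (counitMap δ H) t) := by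
  rw [skewComul_left, map_add]
  induction t using TensorProduct.induction_on with
  | zero => simp only [map_zero, add_zero]
  | add s₁ s₂ h₁ h₂ =>
    simp only [map_add]
    rw [add_add_add_comm, h₁, h₂]
  | tmul p q =>
    rw [TensorProduct.map_tmul, TensorProduct.map_tmul, leftSlice_tmul, leftSlice_tmul,
      leftSlice_tmul, y_left, counitMap_yLeft hr hc, counitMap_unit_left hτ hr, zero_smul, zero_add,
      map_smul]

omit hr hc in
theorem rightSlice_skewComul_right (t : OreExt δ ⊗[k] OreExt δ) :
    rightSlice (counitMap δ H) ((skewComul (y δ) (multIncl H hτ δ r)).right t) =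
      yRight δ (rightSlice (counitMap δ H) t) := by
  rw [skewComul_right, map_add]
  induction t using TensorProduct.induction_on with
  | zero => simp only [map_zero, add_zero]
  | add s₁ s₂ h₁ h₂ =>
    simp only [map_add]
    rw [add_add_add_comm, h₁, h₂]
  | tmul p q =>
    rw [TensorProduct.map_tmul, TensorProduct.map_tmul, rightSlice_tmul, rightSlice_tmul,
      rightSlice_tmul, y_right, counitMap_yRight, zero_smul, add_zero, map_smul,
      LinearMap.id_apply]

omit [Nontrivial A] hr hc in
theorem leftSlice_inclTensor (t : A ⊗[k] A) : leftSlice (counitMap δ H) (inclTensor δ t) =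
    incl δ (leftSlice (H.ε : A →ₗ[k] k) t) := by
  induction t using TensorProduct.induction_on with
  | zero => simp
  | add s₁ s₂ h₁ h₂ => simp only [map_add, h₁, h₂]
  | tmul p q =>
    rw [TensorProduct.map_tmul, leftSlice_tmul, leftSlice_tmul, counitMap_incl, map_smul]
    rfl

omit [Nontrivial A] hr hc in
theorem rightSlice_inclTensor (t : A ⊗[k] A) : rightSlice (counitMap δ H) (inclTensor δ t) =
    incl δ (rightSlice (H.ε : A →ₗ[k] k) t) := by
  induction t using TensorProduct.induction_on with
  | zero => simp
  | add s₁ s₂ h₁ h₂ => simp only [map_add, h₁, h₂]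
  | tmul p q =>
    rw [TensorProduct.map_tmul, rightSlice_tmul, rightSlice_tmul, counitMap_incl, map_smul]
    rfl

variable {T₁ T₂ : OreExt δ ⊗[k] OreExt δ →ₗ[k] OreExt δ ⊗[k] OreExt δ}

theorem leftSlice_galois₁ (hT₁ : IsGalois₁ (comulMap δ H hτ r) T₁)
    (h₁ : ∀ t, T₁ (inclTensor δ t) = inclTensor δ (H.T₁ t)) (f g : OreExt δ) :
    leftSlice (counitMap δ H) (T₁ (f ⊗ₜ g)) = f * g := by
  have hB := nondegenerateProduct (δ := δ) H.nondegenerate hτ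
  refine induction_tmul (P := fun t => leftSlice (counitMap δ H) (T₁ t) = LinearMap.mul' k _ t)
    (fun _ => induction_yLeft hτ) (fun _ => induction_yRight) (by simp only [map_zero])
    (fun s t hs ht => by simp only [map_add, hs, ht]) (fun a b => ?_) (fun f g hfg => ?_)
    (fun f hf g => ?_) f g
  · refine (congrArg _ (h₁ (a ⊗ₜ b))).trans ((leftSlice_inclTensor _).trans ?_)
    exact (congrArg _ (H.counit_left a b)).trans (incl_mul_incl a b).symm
  · have e := galois₁_map_right hB hT₁ (y δ) (f ⊗ₜ g)
    rw [TensorProduct.map_tmul, LinearMap.id_apply, y_right] at e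
    have e' : ∀ t, leftSlice (counitMap δ H) (TensorProduct.map LinearMap.id (yRight δ) t) =
        yRight δ (leftSlice (counitMap δ H) t) := fun t => by
      induction t using TensorProduct.induction_on with
      | zero => simp
      | add s₁ s₂ h₁ h₂ => simp only [map_add, h₁, h₂]
      | tmul p q => simp
    rw [e, e', hfg]
    exact yRight_mul f g
  · have e : T₁ (yLeft δ f ⊗ₜ g) =
        (skewComul (y δ) (multIncl H hτ δ r)).left (T₁ (f ⊗ₜ g)) := by
      apply Mult.toMult_injective (k := k) (nondegenerateProduct_tensor H hτ)
      rw [hT₁, comulMap_yLeft hτ hc, mul_assoc, ← hT₁, Mult.mul_toMult]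
    rw [e, leftSlice_skewComul_left hτ hr hc, hf]
    exact yLeft_mul f g

omit hr hc in
theorem rightSlice_galois₂ (hT₂ : IsGalois₂ (comulMap δ H hτ r) T₂)
    (h₂ : ∀ t, T₂ (inclTensor δ t) = inclTensor δ (H.T₂ t)) (f g : OreExt δ) :
    rightSlice (counitMap δ H) (T₂ (f ⊗ₜ g)) = f * g := by
  have hB := nondegenerateProduct (δ := δ) H.nondegenerate hτ
  refine induction_tmul (P := fun t => rightSlice (counitMap δ H) (T₂ t) = LinearMap.mul' k _ t)
    (fun _ => induction_yLeft hτ) (fun _ => induction_yRight) (by simp only [map_zero])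
    (fun s t hs ht => by simp only [map_add, hs, ht]) (fun a b => ?_) (fun f g hfg => ?_)
    (fun f hf g => ?_) f g
  · refine (congrArg _ (h₂ (a ⊗ₜ b))).trans ((rightSlice_inclTensor _).trans ?_)
    exact (congrArg _ (H.counit_right a b)).trans (incl_mul_incl a b).symm
  · have e : T₂ (f ⊗ₜ yRight δ g) =
        (skewComul (y δ) (multIncl H hτ δ r)).right (T₂ (f ⊗ₜ g)) := by
      apply Mult.toMult_injective (k := k) (nondegenerateProduct_tensor H hτ)
      rw [hT₂, comulMap_yRight, ← mul_assoc, ← hT₂, Mult.toMult_mul]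
    rw [e, rightSlice_skewComul_right hτ, hfg]
    exact yRight_mul f g
  · have e := galois₂_map_left hB hT₂ (y δ) (f ⊗ₜ g)
    rw [TensorProduct.map_tmul, LinearMap.id_apply, y_left] at e
    have e' : ∀ t, rightSlice (counitMap δ H) (TensorProduct.map (yLeft δ) LinearMap.id t) =
        yLeft δ (rightSlice (counitMap δ H) t) := fun t => by
      induction t using TensorProduct.induction_on with
      | zero => simp
      | add s₁ s₂ h₁ h₂ => simp only [map_add, h₁, h₂]
      | tmul p q => simp
    rw [e, e', hf]
    exact yLeft_mul f g

end Counit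

section Antipode

theorem map_antipode_left_inclTensor (t : A ⊗[k] A) :
    TensorProduct.map (antipodeEquiv hτ hr hc).toLinearMap LinearMap.id (inclTensor δ t) =
      inclTensor δ (TensorProduct.map H.S.toLinearMap LinearMap.id t) := by
  rw [map_map_apply, map_map_apply]
  congr 2
  exact LinearMap.ext (antipodeMap_incl H hτ r)

theorem map_antipode_right_inclTensor (t : A ⊗[k] A) :
    TensorProduct.map LinearMap.id (antipodeEquiv hτ hr hc).toLinearMap (inclTensor δ t) =
      inclTensor δ (TensorProduct.map LinearMap.id H.S.toLinearMap t) := by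
  rw [map_map_apply, map_map_apply]
  congr 2
  exact LinearMap.ext (antipodeMap_incl H hτ r)

theorem antipodeEquiv_symm_incl (a : A) :
    (antipodeEquiv hτ hr hc).symm (incl δ a) = incl δ (H.S.symm a) := by
  rw [LinearEquiv.symm_apply_eq, antipodeEquiv_apply, antipodeMap_incl,
    LinearEquiv.apply_symm_apply]

theorem map_antipode_symm_left_inclTensor (t : A ⊗[k] A) :
    TensorProduct.map (antipodeEquiv hτ hr hc).symm.toLinearMap LinearMap.id (inclTensor δ t) =
      inclTensor δ (TensorProduct.map H.S.symm.toLinearMap LinearMap.id t) := by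
  rw [map_map_apply, map_map_apply]
  congr 2
  exact LinearMap.ext (antipodeEquiv_symm_incl hτ hr hc)

theorem map_antipode_symm_right_inclTensor (t : A ⊗[k] A) :
    TensorProduct.map LinearMap.id (antipodeEquiv hτ hr hc).symm.toLinearMap (inclTensor δ t) =
      inclTensor δ (TensorProduct.map LinearMap.id H.S.symm.toLinearMap t) := by
  rw [map_map_apply, map_map_apply]
  congr 2
  exact LinearMap.ext (antipodeEquiv_symm_incl hτ hr hc)

theorem comm_inclTensor (t : A ⊗[k] A) :
    TensorProduct.comm k (OreExt δ) (OreExt δ) (inclTensor δ t) =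
      inclTensor δ (TensorProduct.comm k A A t) :=
  (TensorProduct.map_comm (incl δ) (incl δ) t).symm

theorem flipTensor_inclTensor (t : A ⊗[k] A) :
    flipTensor (antipodeEquiv hτ hr hc) (inclTensor δ t) = inclTensor δ (flipTensor H.S t) := by
  induction t using TensorProduct.induction_on with
  | zero => simp
  | add s₁ s₂ h₁ h₂ => simp only [map_add, h₁, h₂]
  | tmul p q =>
    rw [TensorProduct.map_tmul, flipTensor_tmul, flipTensor_tmul, TensorProduct.map_tmul,
      antipodeEquiv_apply, antipodeEquiv_apply, antipodeMap_incl, antipodeMap_incl]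

theorem flipTensor_mul (s t : OreExt δ ⊗[k] OreExt δ) : flipTensor (antipodeEquiv hτ hr hc) (s * t) =
    flipTensor (antipodeEquiv hτ hr hc) t * flipTensor (antipodeEquiv hτ hr hc) s := by
  induction s using TensorProduct.induction_on with
  | zero => simp
  | add s₁ s₂ h₁ h₂ => simp only [map_add, add_mul, mul_add, h₁, h₂]
  | tmul a b =>
    induction t using TensorProduct.induction_on with
    | zero => simp
    | add s₁ s₂ h₁ h₂ => simp only [map_add, add_mul, mul_add, h₁, h₂]
    | tmul c d =>
      simp only [Algebra.TensorProduct.tmul_mul_tmul, flipTensor_tmul, antipodeEquiv_apply,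
        antipodeMap_mul hτ hr hc]

theorem comul_antipode_incl (a : A) (t : OreExt δ ⊗[k] OreExt δ) :
    (comulMap δ H hτ r (antipodeEquiv hτ hr hc (incl δ a))).left
        (flipTensor (antipodeEquiv hτ hr hc) t) =
      flipTensor (antipodeEquiv hτ hr hc) ((comulMap δ H hτ r (incl δ a)).right t) ∧
    (comulMap δ H hτ r (antipodeEquiv hτ hr hc (incl δ a))).right
        (flipTensor (antipodeEquiv hτ hr hc) t) =
      flipTensor (antipodeEquiv hτ hr hc) ((comulMap δ H hτ r (incl δ a)).left t) := by
  have hj := nondegenerateHom_inclTensor (δ := δ) H.nondegenerateHom_toMult hτ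
  rw [antipodeEquiv_apply, antipodeMap_incl, comulMap_incl, comulMap_incl]
  constructor
  · refine hj.induction_right (P := fun t => (multInclTensor H hτ δ (H.Δ (H.S a))).left
        (flipTensor (antipodeEquiv hτ hr hc) t) =
      flipTensor (antipodeEquiv hτ hr hc) ((multInclTensor H hτ δ (H.Δ a)).right t)) t
      (fun s u => ?_) (by simp only [map_zero]) fun s t hs ht => by simp only [map_add, hs, ht]
    rw [LinearMap.comp_apply, Mult.toMult_right, flipTensor_mul, Mult.left_mul,
      flipTensor_inclTensor, multInclTensor_left, Mult.right_mul, multInclTensor_right,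
      flipTensor_mul, flipTensor_inclTensor]
    exact congrArg (fun x => inclTensor δ x * _) (H.S_comul a s).1
  · refine hj.induction_left (P := fun t => (multInclTensor H hτ δ (H.Δ (H.S a))).right
        (flipTensor (antipodeEquiv hτ hr hc) t) =
      flipTensor (antipodeEquiv hτ hr hc) ((multInclTensor H hτ δ (H.Δ a)).left t)) t
      (fun s u => ?_) (by simp only [map_zero]) fun s t hs ht => by simp only [map_add, hs, ht]
    rw [LinearMap.comp_apply, Mult.toMult_left, flipTensor_mul, Mult.right_mul,
      flipTensor_inclTensor, multInclTensor_right, Mult.left_mul, multInclTensor_left,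
      flipTensor_mul, flipTensor_inclTensor]
    exact congrArg (fun x => _ * inclTensor δ x) (H.S_comul a s).2

theorem comul_antipode (f : OreExt δ) (t : OreExt δ ⊗[k] OreExt δ) :
    (comulMap δ H hτ r (antipodeEquiv hτ hr hc f)).left
        (flipTensor (antipodeEquiv hτ hr hc) t) =
      flipTensor (antipodeEquiv hτ hr hc) ((comulMap δ H hτ r f).right t) ∧
    (comulMap δ H hτ r (antipodeEquiv hτ hr hc f)).right
        (flipTensor (antipodeEquiv hτ hr hc) t) =
      flipTensor (antipodeEquiv hτ hr hc) ((comulMap δ H hτ r f).left t) := by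
  induction f using induction_yRight generalizing t with
  | h0 =>
    simp only [map_zero]
    exact ⟨(map_zero _).symm, (map_zero _).symm⟩
  | hadd f g hf hg =>
    simp only [map_add, Mult.add_left_apply, Mult.add_right_apply, (hf t).1, (hf t).2, (hg t).1,
      (hg t).2]
    exact ⟨trivial, trivial⟩
  | h a => exact comul_antipode_incl hτ hr hc a t
  | hy f hf =>
    exact (skewPrimitive hτ hr hc).antipode_comul_right (nondegenerateProduct H.nondegenerate hτ)
      hf t

variable {T₁ T₂ T₃ T₄ : OreExt δ ⊗[k] OreExt δ →ₗ[k] OreExt δ ⊗[k] OreExt δ}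

theorem galois₂_antipode_galois₃ (hT₂ : IsGalois₂ (comulMap δ H hτ r) T₂)
    (hT₃ : IsGalois₃ (comulMap δ H hτ r) T₃)
    (h₂ : ∀ t, T₂ (inclTensor δ t) = inclTensor δ (H.T₂ t))
    (h₃ : ∀ t, T₃ (inclTensor δ t) = inclTensor δ (H.T₃ t)) (f g : OreExt δ) :
    T₂ (TensorProduct.map (antipodeEquiv hτ hr hc).toLinearMap LinearMap.id (T₃ (f ⊗ₜ[k] g))) =
      antipodeEquiv hτ hr hc g ⊗ₜ[k] f := by
  have hB := nondegenerateProduct (δ := δ) H.nondegenerate hτ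
  have h := skewPrimitive hτ hr hc
  refine induction_tmul (P := fun t => T₂ (TensorProduct.map (antipodeEquiv hτ hr hc).toLinearMap
      LinearMap.id (T₃ t)) = TensorProduct.map (antipodeEquiv hτ hr hc).toLinearMap LinearMap.id
        (TensorProduct.comm k _ _ t))
    (fun _ => induction_yLeft hτ) (fun _ => induction_yRight) (by simp only [map_zero])
    (fun s t hs ht => by simp only [map_add, hs, ht]) (fun a b => ?_)
    (fun f g hfg => h.antipode₁_right hB hT₂ hT₃ hfg)
    (fun f hf g => h.antipode₁_left hB hT₂ hT₃ (hf g)) f g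
  have e : incl δ a ⊗ₜ[k] incl δ b = inclTensor δ (a ⊗ₜ b) := rfl
  rw [e, h₃, map_antipode_left_inclTensor, h₂, H.antipode₁, comm_inclTensor,
    map_antipode_left_inclTensor]
  rfl

theorem antipode_galois₃_antipode_symm_galois₂ (hT₂ : IsGalois₂ (comulMap δ H hτ r) T₂)
    (hT₃ : IsGalois₃ (comulMap δ H hτ r) T₃)
    (h₂ : ∀ t, T₂ (inclTensor δ t) = inclTensor δ (H.T₂ t))
    (h₃ : ∀ t, T₃ (inclTensor δ t) = inclTensor δ (H.T₃ t)) (f g : OreExt δ) :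
    TensorProduct.map (antipodeEquiv hτ hr hc).toLinearMap LinearMap.id
      (T₃ (TensorProduct.comm k _ _ (TensorProduct.map
        (antipodeEquiv hτ hr hc).symm.toLinearMap LinearMap.id (T₂ (g ⊗ₜ[k] f))))) =
      g ⊗ₜ[k] f := by
  have hB := nondegenerateProduct (δ := δ) H.nondegenerate hτ
  have h := skewPrimitive hτ hr hc
  refine induction_tmul_right (P := fun t => TensorProduct.map (antipodeEquiv hτ hr hc).toLinearMap
      LinearMap.id (T₃ (TensorProduct.comm k _ _ (TensorProduct.map
        (antipodeEquiv hτ hr hc).symm.toLinearMap LinearMap.id (T₂ t)))) = t)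
    (fun _ => induction_yLeft hτ) (fun _ => induction_yLeft hτ) (by simp only [map_zero])
    (fun s t hs ht => by simp only [map_add, hs, ht]) (fun a b => ?_)
    (fun f g hfg => h.antipode₂_left hB hT₂ hT₃ hfg)
    (fun f hf g => h.antipode₂_right hB hT₂ hT₃ hf g) f g
  have e : incl δ a ⊗ₜ[k] incl δ b = inclTensor δ (a ⊗ₜ b) := rfl
  rw [e, h₂, map_antipode_symm_left_inclTensor, comm_inclTensor, h₃, map_antipode_left_inclTensor,
    H.antipode₂]

theorem galois₁_antipode_galois₄ (hT₁ : IsGalois₁ (comulMap δ H hτ r) T₁)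
    (hT₄ : IsGalois₄ (comulMap δ H hτ r) T₄)
    (h₁ : ∀ t, T₁ (inclTensor δ t) = inclTensor δ (H.T₁ t))
    (h₄ : ∀ t, T₄ (inclTensor δ t) = inclTensor δ (H.T₄ t)) (f g : OreExt δ) :
    T₁ (TensorProduct.map LinearMap.id (antipodeEquiv hτ hr hc).toLinearMap (T₄ (g ⊗ₜ[k] f))) =
      f ⊗ₜ[k] antipodeEquiv hτ hr hc g := by
  have hB := nondegenerateProduct (δ := δ) H.nondegenerate hτ
  have h := skewPrimitive hτ hr hc
  refine induction_tmul_right (P := fun t => T₁ (TensorProduct.map LinearMap.id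
      (antipodeEquiv hτ hr hc).toLinearMap (T₄ t)) = TensorProduct.map LinearMap.id
        (antipodeEquiv hτ hr hc).toLinearMap (TensorProduct.comm k _ _ t))
    (fun _ => induction_yRight) (fun _ => induction_yLeft hτ) (by simp only [map_zero])
    (fun s t hs ht => by simp only [map_add, hs, ht]) (fun a b => ?_)
    (fun f g hfg => h.antipode₃_left hB hT₁ hT₄ hfg)
    (fun f hf g => h.antipode₃_right hB hT₁ hT₄ hf g) f g
  have e : incl δ a ⊗ₜ[k] incl δ b = inclTensor δ (a ⊗ₜ b) := rfl
  rw [e, h₄, map_antipode_right_inclTensor, h₁, H.antipode₃, comm_inclTensor,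
    map_antipode_right_inclTensor]
  rfl

theorem antipode_galois₄_antipode_symm_galois₁ (hT₁ : IsGalois₁ (comulMap δ H hτ r) T₁)
    (hT₄ : IsGalois₄ (comulMap δ H hτ r) T₄)
    (h₁ : ∀ t, T₁ (inclTensor δ t) = inclTensor δ (H.T₁ t))
    (h₄ : ∀ t, T₄ (inclTensor δ t) = inclTensor δ (H.T₄ t)) (f g : OreExt δ) :
    TensorProduct.map LinearMap.id (antipodeEquiv hτ hr hc).toLinearMap
      (T₄ (TensorProduct.comm k _ _ (TensorProduct.map LinearMap.id
        (antipodeEquiv hτ hr hc).symm.toLinearMap (T₁ (f ⊗ₜ[k] g))))) = f ⊗ₜ[k] g := by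
  have hB := nondegenerateProduct (δ := δ) H.nondegenerate hτ
  have h := skewPrimitive hτ hr hc
  refine induction_tmul (P := fun t => TensorProduct.map LinearMap.id
      (antipodeEquiv hτ hr hc).toLinearMap (T₄ (TensorProduct.comm k _ _ (TensorProduct.map
        LinearMap.id (antipodeEquiv hτ hr hc).symm.toLinearMap (T₁ t)))) = t)
    (fun _ => induction_yRight) (fun _ => induction_yRight) (by simp only [map_zero])
    (fun s t hs ht => by simp only [map_add, hs, ht]) (fun a b => ?_)
    (fun f g hfg => h.antipode₄_left hB hT₁ hT₄ hfg)
    (fun f hf g => h.antipode₄_right hB hT₁ hT₄ hf g) f g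
  have e : incl δ a ⊗ₜ[k] incl δ b = inclTensor δ (a ⊗ₜ b) := rfl
  rw [e, h₁, map_antipode_symm_right_inclTensor, comm_inclTensor, h₄,
    map_antipode_right_inclTensor, H.antipode₄]

end Antipode

/-- The regular multiplier Hopf coquasigroup `A[y; τ, δ]`. -/
def regularMHC : RegularMHC k (OreExt δ) where
  nondegenerate := nondegenerateProduct H.nondegenerate hτ
  Δ := comulHom hτ hc
  ε := counitHom hr hc
  S := antipodeEquiv hτ hr hc
  T₁ := (exists_galois₁ hτ hc).choose
  T₂ := (exists_galois₂ hτ hc).choose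
  T₃ := (exists_galois₃ hτ hc).choose
  T₄ := (exists_galois₄ hτ hc).choose
  T₁_spec := (exists_galois₁ hτ hc).choose_spec.1
  T₂_spec := (exists_galois₂ hτ hc).choose_spec.1
  T₃_spec := (exists_galois₃ hτ hc).choose_spec.1
  T₄_spec := (exists_galois₄ hτ hc).choose_spec.1
  counit_left := leftSlice_galois₁ hτ hr hc (exists_galois₁ hτ hc).choose_spec.1
    (exists_galois₁ hτ hc).choose_spec.2
  counit_right := rightSlice_galois₂ hτ (exists_galois₂ hτ hc).choose_spec.1
    (exists_galois₂ hτ hc).choose_spec.2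
  S_mul := antipodeMap_mul hτ hr hc
  S_comul := comul_antipode hτ hr hc
  antipode₁ := galois₂_antipode_galois₃ hτ hr hc (exists_galois₂ hτ hc).choose_spec.1
    (exists_galois₃ hτ hc).choose_spec.1 (exists_galois₂ hτ hc).choose_spec.2
    (exists_galois₃ hτ hc).choose_spec.2
  antipode₂ := antipode_galois₃_antipode_symm_galois₂ hτ hr hc
    (exists_galois₂ hτ hc).choose_spec.1 (exists_galois₃ hτ hc).choose_spec.1
    (exists_galois₂ hτ hc).choose_spec.2 (exists_galois₃ hτ hc).choose_spec.2
  antipode₃ := galois₁_antipode_galois₄ hτ hr hc (exists_galois₁ hτ hc).choose_spec.1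
    (exists_galois₄ hτ hc).choose_spec.1 (exists_galois₁ hτ hc).choose_spec.2
    (exists_galois₄ hτ hc).choose_spec.2
  antipode₄ := antipode_galois₄_antipode_symm_galois₁ hτ hr hc
    (exists_galois₁ hτ hc).choose_spec.1 (exists_galois₄ hτ hc).choose_spec.1
    (exists_galois₁ hτ hc).choose_spec.2 (exists_galois₄ hτ hc).choose_spec.2

end OreExt

variable {k : Type*} [Field k]
variable {A : Type*} [NonUnitalRing A] [Module k A] [IsScalarTower k A A] [SMulCommClass k A A]
variable {τ : A →ₙₐ[k] A} {δ : TwistedDerivation τ} {H : RegularMHC k A} {r : Mult k A}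

theorem RegularMHC.isOreExtensionWith_iff_oreCompatible [Nontrivial A]
    (hτ : Function.Surjective τ) (hr : H.IsGroupLike r) :
    H.IsOreExtensionWith δ r ↔ H.OreCompatible δ r := by
  refine ⟨IsOreExtensionWith.oreCompatible, fun hc => ⟨OreExt.regularMHC hτ hr hc, fun a => ?_,
    OreExt.multIncl H hτ δ r, OreExt.multIncl_extendsTo H hτ r, fun f =>
      ⟨OreExt.comulMap_yLeft hτ hc f, OreExt.comulMap_yRight hτ f⟩⟩⟩
  have e : (OreExt.regularMHC hτ hr hc).Δ (OreExt.incl δ a) =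
    OreExt.multInclTensor H hτ δ (H.Δ a) := OreExt.comulMap_incl hτ a
  rw [e]
  exact OreExt.multInclTensor_extendsTo H hτ (H.Δ a)

theorem RegularMHC.isOreExtensionWith_iff [Nontrivial A] (hτ : Function.Surjective τ)
    (hr : H.IsGroupLike r) : H.IsOreExtensionWith δ r ↔
      (∃ χ : A →ₙₐ[k] k, χ ≠ 0 ∧ H.CharacterCondition τ χ ∧ H.AdCondition χ r) ∧
        H.DerivationCondition δ r :=
  (isOreExtensionWith_iff_oreCompatible hτ hr).trans (hr.conditions_iff hτ).symm

end

end MHC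

theorem theorem3p4 {k A : Type*} [Field k] [NonUnitalRing A] [Nontrivial A] [Module k A]
    [IsScalarTower k A A] [SMulCommClass k A A] (H : MHC.RegularMHC k A) (τ : A →ₙₐ[k] A)
    (hτ : Function.Surjective τ) (hτ' : MHC.NondegenerateEnd τ) (δ : MHC.TwistedDerivation τ) :
    (H.IsOreExtension δ ↔
      ∃ r : MHC.Mult k A, H.IsGroupLike r ∧
        (∃ χ : A →ₙₐ[k] k, χ ≠ 0 ∧ H.CharacterCondition τ χ ∧ H.AdCondition χ r) ∧
        H.DerivationCondition δ r) ∧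
    ∀ r : MHC.Mult k A, H.IsGroupLike r →
      (H.IsOreExtensionWith δ r ↔
        (∃ χ : A →ₙₐ[k] k, χ ≠ 0 ∧ H.CharacterCondition τ χ ∧ H.AdCondition χ r) ∧
        H.DerivationCondition δ r) :=
  ⟨exists_congr fun _ => and_congr_right (MHC.RegularMHC.isOreExtensionWith_iff hτ),
    fun _ => MHC.RegularMHC.isOreExtensionWith_iff hτ⟩
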